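/- **Setting.** A unit has covariates $X\in\mathbb R^p$, treatment $A\in\{0,1\}$, response indicator $R_0\in\{0,1\}$, pre-treatment outcome $Y_0$ and potential post-treatment outcomes $Y_1^{(0)},Y_1^{(1)}$ (all outcomes integrable). We observe $\mathcal D=(X,R_0,R_0Y_0,A,Y_1)\sim P^\star$ with $Y_1=AY_1^{(1)}+(1-A)Y_1^{(0)}$. The target is $\theta^\star=E[Y_1^{(1)}-Y_1^{(0)}\mid A=1]$. Assume $Y_1^{(0)}-Y_0\perp A\mid X$ and $\pi^\star(X)=P(A=1\mid X)\in(0,1)$ a.s., and one of the following two missing-at-random (MAR) conditions: (I) $Y_0\perp R_0\mid X,A$ and, for $a\in\{0,1\}$, $\gamma^\star(X,a)=P(R_0=1\mid X,A=a)\in(0,1)$ a.s.; or (D) $Y_0\perp R_0\mid X,Y_1,A$ and $\gamma^\star(X,Y_1,A)=P(R_0=1\mid X,Y_1,A)\in(0,1)$ a.s. Put $\mu_1^\star(x,0)=E[Y_1\mid X=x,A=0]$. In case (I) put $\mu_0^\star(x,a)=E[Y_0\mid X=x,A=a,R_0=1]$; in case (D) put $\mu_0^\star(x,y,a)=E[Y_0\mid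 X=x,Y_1=y,A=a,R_0=1]$ and $\eta_0^\star(x,0)=E[\mu_0^\star(X,Y_1,0)\mid X=x,A=0]$. For a real $\theta$ and any nuisance functions $h=(\mu,\pi,\gamma)$ in case (I), $h=(\mu,\pi,\gamma,\eta)$ in case (D), let, in case (I), $$\varphi(\mathcal D;\theta;h)=\tfrac{A}{E[A]}\Big(Y_1-\mu_0(X,1)-\tfrac{R_0}{\gamma(X,1)}(Y_0-\mu_0(X,1))-\mu_1(X,0)+\mu_0(X,0)\Big)-\tfrac{(1-A)\pi(X)}{(1-\pi(X))E[A]}\Big(Y_1-\tfrac{R_0}{\gamma(X,0)}(Y_0-\mu_0(X,0))-\mu_1(X,0)\Big)-\tfrac{A}{E[A]}\theta,$$ and, in case (D), $$\varphi(\mathcal D;\theta;h)=\tfrac{A}{E[A]}\Big(Y_1-\mu_0(X,Y_1,1)-\tfrac{R_0}{\gamma(X,Y_1,1)}(Y_0-\mu_0(X,Y_1,1))-\mu_1(X,0)+\eta_0(X,0)\Big)-\tfrac{(1-A)\pi(X)}{(1-\pi(X))E[A]}\Big(Y_1-\mu_0(X,Y_1,0)-\tfrac{R_0}{\gamma(X,Y_1,0)}(Y_0-\mu_0(X,Y_1,0))-\mu_1(X,0)+\eta_0(X,0)\Big)-\tfrac{A}{E[A]}\theta.$$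 Write $\varphi(\mathcal D)=\varphi(\mathcal D;\theta^\star;h^\star)$ for its value at the true nuisance functions. Let $\psi(P)=E_P\big[\tfrac{A}{E_P[A]}(Y_1-\mu_{0,P}(X,1)-\mu_{1,P}(X,0)+\mu_{0,P}(X,0))\big]$ in case (I) and $\psi(P)=E_P\big[\tfrac{A}{E_P[A]}(Y_1-\mu_{0,P}(X,Y_1,1)-\mu_{1,P}(X,0)+\eta_{0,P}(X,0))\big]$ in case (D), where $\mu_{0,P},\mu_{1,P},\eta_{0,P}$ are the regression functions of $P$. **Cross-fitting.** Let $\mathcal D_1,\mathcal D_2,\dots$ be i.i.d. from $P^\star$ and $J\ge1$ fixed. For $n=Jm$, the first $n$ records are split, independently of their values, into $J$ folds of size $m$, and $\hat h^{[-j]}$ is a measurable function of the split and of the records outside fold $j$. Let $\hat\theta$ be a solution (existing with probability tending to one) of $$\sum_{j=1}^J\sum_{i\in\text{fold }j}\varphi(\mathcal D_i;\theta;\hat h^{[-j]})=0\quad\text{in }\theta,$$ or the average $\frac1J\sum_j\hat\theta^{[j]}$ of the roots of the fold-wise equations $\sum_{i\in\text{fold }j}\varphi(\mathcal D_i;\theta;\hat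 h^{[-j]})=0$. Let $\theta(\hat P^{[-j]})$ be the plug-in estimate obtained from $\psi$ by using $\hat h^{[-j]}$ and the empirical law of the records outside fold $j$. **Assumptions.** (a) There are nuisance functions $\bar h$ with $E[\varphi(\mathcal D;\theta^\star;\bar h)^2]<\infty$ and, for every $j$, $\|\varphi(\cdot;\theta^\star;\hat h^{[-j]})-\varphi(\cdot;\theta^\star;\bar h)\|_{L^2(P^\star)}\to0$ in probability. (b) $\sqrt n\sum_{j}\kappa^{[j]}=o_P(1)$, where $\kappa^{[j]}=\theta(\hat P^{[-j]})-\theta^\star+\int\varphi(o;\theta(\hat P^{[-j]});\hat h^{[-j]})\,dP^\star(o)$. (c) For some $\xi>0$, all $\hat\pi^{[-j]}$ and $\hat\gamma^{[-j]}$ take values in $[\xi,1-\xi]$ with probability one. **Theorem.** In each of the cases (I) and (D), as $n=Jm\to\infty$, $$\sqrt n(\hat\theta-\theta^\star)\to N\big(0,\operatorname{Var}\varphi(\mathcal D;\theta^\star;\bar h)\big)\quad\text{in distribution.}$$ If moreover the limit in (a) is the influence function at the truth, $\varphi(\mathcal D;\theta^\star;\bar h)=\varphi(\mathcal D)$ a.s.,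 and the identification formula converges absolutely, in the sense that $E\big[\tfrac{(1-A)\pi^\star(X)}{1-\pi^\star(X)}|Y_t|\big]<\infty$ for $t=0,1$ (automatic if $\pi^\star(X)$ is bounded away from $1$), then $\theta^\star=\psi(P^\star)$ and the limiting variance is $\operatorname{Var}\varphi(\mathcal D)$, which is the semiparametric efficiency bound for $\psi$ at $P^\star$ in the nonparametric model for the observed data. That is, $\psi$ is differentiable at $t=0$ along every submodel $dP_t=(1+tg)\,dP^\star$ with $g$ bounded and of mean zero, and $\operatorname{Var}\varphi(\mathcal D)$ is the supremum of $\big(\tfrac{d}{dt}\psi(P_t)|_{t=0}\big)^2/E[g^2]$ over all such $g$ with $E[g^2]>0$. -/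

import Mathlib

open MeasureTheory ProbabilityTheory Filter Topology
open scoped ENNReal NNReal

noncomputable section

namespace DiDMissing

/-- The numerical value `1` / `0` of a binary variable. -/
def ind (b : Bool) : ℝ := if b then 1 else 0

/-! ### Full data and observed data -/

/-- An observed record `(X, R₀, R₀ Y₀, A, Y₁)`. -/
abbrev Obs (p : ℕ) : Type := (Fin p → ℝ) × Bool × ℝ × Bool × ℝ

/-- Covariates `X`. -/
def cov {p : ℕ} (o : Obs p) : Fin p → ℝ := o.1
/-- Indicator `R₀` that the pre-treatment outcome is observed. -/
def resp {p : ℕ} (o : Obs p) : Bool := o.2.1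
/-- The product `R₀ Y₀`. -/
def pre {p : ℕ} (o : Obs p) : ℝ := o.2.2.1
/-- Treatment `A`. -/
def trt {p : ℕ} (o : Obs p) : Bool := o.2.2.2.1
/-- Post-treatment outcome `Y₁`. -/
def post {p : ℕ} (o : Obs p) : ℝ := o.2.2.2.2

/-- A prototypical unit: covariates, treatment, response indicator, pre-treatment outcome and the
two potential post-treatment outcomes `Y₁⁽⁰⁾`, `Y₁⁽¹⁾`, as random variables on `Ω₀`. -/
structure FullData (p : ℕ) (Ω₀ : Type*) [MeasurableSpace Ω₀] where
  X : Ω₀ → (Fin p → ℝ)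
  A : Ω₀ → Bool
  R0 : Ω₀ → Bool
  Y0 : Ω₀ → ℝ
  Y10 : Ω₀ → ℝ
  Y11 : Ω₀ → ℝ
  measurable_X : Measurable X
  measurable_A : Measurable A
  measurable_R0 : Measurable R0
  measurable_Y0 : Measurable Y0
  measurable_Y10 : Measurable Y10
  measurable_Y11 : Measurable Y11

section FullData

variable {p : ℕ} {Ω₀ : Type*} [MeasurableSpace Ω₀]

/-- The realized post-treatment outcome, `Y₁ = A Y₁⁽¹⁾ + (1 - A) Y₁⁽⁰⁾` (consistency). -/
def FullData.Y1 (F : FullData p Ω₀) (ω : Ω₀) : ℝ :=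
  ind (F.A ω) * F.Y11 ω + (1 - ind (F.A ω)) * F.Y10 ω

/-- The observed record of the unit. -/
def FullData.obs (F : FullData p Ω₀) (ω : Ω₀) : Obs p :=
  (F.X ω, F.R0 ω, ind (F.R0 ω) * F.Y0 ω, F.A ω, F.Y1 ω)

/-- The law of the observed data. -/
def FullData.obsLaw (F : FullData p Ω₀) (Q : Measure Ω₀) : Measure (Obs p) := Q.map F.obs

/-- The average treatment effect on the treated, `E[Y₁⁽¹⁾ - Y₁⁽⁰⁾ ∣ A = 1]`. -/
def FullData.att (F : FullData p Ω₀) (Q : Measure Ω₀) : ℝ :=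
  ∫ ω, (F.Y11 ω - F.Y10 ω) ∂(Q[|{ω | F.A ω = true}])

theorem measurable_ind : Measurable ind := measurable_of_finite _

theorem FullData.measurable_Y1 (F : FullData p Ω₀) : Measurable F.Y1 := by
  have hA := measurable_ind.comp F.measurable_A
  exact (hA.mul F.measurable_Y11).add ((measurable_const.sub hA).mul F.measurable_Y10)

end FullData

/-! ### True nuisance functions, as functionals of the observed-data law -/

/-- `E[W ∣ Z = z, B]` under `P`: the mean of the regular conditional law of `W` given `Z = z`
under the conditional measure `P(· ∣ B)`. -/
def condMean {p : ℕ} {E : Type*} [MeasurableSpace E] (P : Measure (Obs p)) (B : Set (Obs p))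
    (Z : Obs p → E) (W : Obs p → ℝ) (z : E) : ℝ :=
  ∫ w, w ∂(condDistrib W Z (P[|B]) z)

/-- Propensity score `π⋆(x) = P(A = 1 ∣ X = x)`. -/
def truePi {p : ℕ} (P : Measure (Obs p)) (x : Fin p → ℝ) : ℝ :=
  condMean P Set.univ cov (fun o => ind (trt o)) x

/-- `μ⋆₁(x, 0) = E[Y₁ ∣ X = x, A = 0]`. -/
def trueMu1 {p : ℕ} (P : Measure (Obs p)) (x : Fin p → ℝ) : ℝ :=
  condMean P {o | trt o = false} cov post x

/-- `γ⋆(x, a) = P(R₀ = 1 ∣ X = x, A = a)`. -/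
def trueGammaI {p : ℕ} (P : Measure (Obs p)) (x : Fin p → ℝ) (a : Bool) : ℝ :=
  condMean P {o | trt o = a} cov (fun o => ind (resp o)) x

/-- `μ⋆₀(x, a) = E[Y₀ ∣ X = x, A = a, R₀ = 1]`. -/
def trueMu0I {p : ℕ} (P : Measure (Obs p)) (x : Fin p → ℝ) (a : Bool) : ℝ :=
  condMean P {o | trt o = a ∧ resp o = true} cov pre x

/-- `γ⋆(x, y₁, a) = P(R₀ = 1 ∣ X = x, Y₁ = y₁, A = a)`. -/
def trueGammaD {p : ℕ} (P : Measure (Obs p)) (x : Fin p → ℝ) (y : ℝ) (a : Bool) : ℝ :=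
  condMean P {o | trt o = a} (fun o => (cov o, post o)) (fun o => ind (resp o)) (x, y)

/-- `μ⋆₀(x, y₁, a) = E[Y₀ ∣ X = x, Y₁ = y₁, A = a, R₀ = 1]`. -/
def trueMu0D {p : ℕ} (P : Measure (Obs p)) (x : Fin p → ℝ) (y : ℝ) (a : Bool) : ℝ :=
  condMean P {o | trt o = a ∧ resp o = true} (fun o => (cov o, post o)) pre (x, y)

/-- The nested regression `η⋆₀(x, 0) = E[μ⋆₀(X, Y₁, 0) ∣ X = x, A = 0]`. -/
def trueEta {p : ℕ} (P : Measure (Obs p)) (x : Fin p → ℝ) : ℝ :=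
  condMean P {o | trt o = false} cov (fun o => trueMu0D P (cov o) (post o) false) x

/-! ### Identification assumptions -/

/-- Conditional parallel trends and positivity (consistency holds by construction of `F.Y1`). -/
structure Identifiability {p : ℕ} {Ω₀ : Type*} [MeasurableSpace Ω₀] [StandardBorelSpace Ω₀]
    (F : FullData p Ω₀) (Q : Measure Ω₀) [IsFiniteMeasure Q] : Prop where
  parallel_trends : CondIndepFun (MeasurableSpace.comap F.X inferInstance)
    F.measurable_X.comap_le (fun ω => F.Y10 ω - F.Y0 ω) F.A Q
  positivity : ∀ᵐ ω ∂Q, truePi (F.obsLaw Q) (F.X ω) ∈ Set.Ioo (0 : ℝ) 1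

/-- Outcome independent missingness at random. -/
structure MARIndep {p : ℕ} {Ω₀ : Type*} [MeasurableSpace Ω₀] [StandardBorelSpace Ω₀]
    (F : FullData p Ω₀) (Q : Measure Ω₀) [IsFiniteMeasure Q] : Prop where
  unconfounded : CondIndepFun (MeasurableSpace.comap (fun ω => (F.X ω, F.A ω)) inferInstance)
    (F.measurable_X.prodMk F.measurable_A).comap_le F.Y0 F.R0 Q
  weak_overlap : ∀ᵐ ω ∂Q, ∀ a, trueGammaI (F.obsLaw Q) (F.X ω) a ∈ Set.Ioo (0 : ℝ) 1

/-- Outcome dependent missingness at random. -/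
structure MARDep {p : ℕ} {Ω₀ : Type*} [MeasurableSpace Ω₀] [StandardBorelSpace Ω₀]
    (F : FullData p Ω₀) (Q : Measure Ω₀) [IsFiniteMeasure Q] : Prop where
  unconfounded : CondIndepFun
    (MeasurableSpace.comap (fun ω => (F.X ω, F.Y1 ω, F.A ω)) inferInstance)
    (F.measurable_X.prodMk (F.measurable_Y1.prodMk F.measurable_A)).comap_le F.Y0 F.R0 Q
  weak_overlap : ∀ᵐ ω ∂Q, trueGammaD (F.obsLaw Q) (F.X ω) (F.Y1 ω) (F.A ω) ∈ Set.Ioo (0 : ℝ) 1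

/-! ### Nuisance functions and influence functions in the two missingness regimes -/

/-- Nuisances under outcome independent missingness:
`μ₀(x, a)`, `μ₁(x, 0)`, `π(x)`, `γ(x, a)`. -/
structure NuisI (p : ℕ) where
  mu0 : (Fin p → ℝ) → Bool → ℝ
  mu1 : (Fin p → ℝ) → ℝ
  pi : (Fin p → ℝ) → ℝ
  gamma : (Fin p → ℝ) → Bool → ℝ

/-- Nuisances under outcome dependent missingness:
`μ₀(x, y₁, a)`, `μ₁(x, 0)`, `π(x)`, `γ(x, y₁, a)`, `η₀(x, 0)`. -/
structure NuisD (p : ℕ) where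
  mu0 : (Fin p → ℝ) → ℝ → Bool → ℝ
  mu1 : (Fin p → ℝ) → ℝ
  pi : (Fin p → ℝ) → ℝ
  gamma : (Fin p → ℝ) → ℝ → Bool → ℝ
  eta : (Fin p → ℝ) → ℝ

/-- The ingredients of the estimation problem in one missingness regime. -/
structure Scheme (p : ℕ) where
  /-- nuisance functions -/
  N : Type
  /-- the summand of the numerator of the fold estimator: `E[A]` times the influence function,
  without its last term `-(A / E[A]) θ` -/
  moment : N → Obs p → ℝ
  /-- the integrand of the identification formula (to be weighted by `A / E[A]`) -/
  plug : N → Obs p → ℝ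
  /-- propensity score at the covariates of the record -/
  pi : N → Obs p → ℝ
  /-- missingness probability at the covariates (and outcome) of the record, treatment `a` -/
  gamma : N → Obs p → Bool → ℝ
  /-- joint measurability of a family of nuisance functions in index and argument -/
  MeasFamily : {T : Type} → [MeasurableSpace T] → (T → N) → Prop
  /-- the true nuisance functions of an observed-data law -/
  truth : Measure (Obs p) → N

/-- Outcome independent missingness. -/
def schemeI (p : ℕ) : Scheme p where
  N := NuisI p
  moment h o :=
    ind (trt o) * (post o
        - (h.mu0 (cov o) true
          + ind (resp o) / h.gamma (cov o) true * (pre o - h.mu0 (cov o) true))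
        - h.mu1 (cov o) + h.mu0 (cov o) false)
      - (1 - ind (trt o)) * h.pi (cov o) / (1 - h.pi (cov o)) * (post o
        - ind (resp o) / h.gamma (cov o) false * (pre o - h.mu0 (cov o) false)
        - h.mu1 (cov o))
  plug h o := (post o - h.mu0 (cov o) true) - (h.mu1 (cov o) - h.mu0 (cov o) false)
  pi h o := h.pi (cov o)
  gamma h o a := h.gamma (cov o) a
  MeasFamily {T} _ H :=
    Measurable (fun q : T × (Fin p → ℝ) × Bool => (H q.1).mu0 q.2.1 q.2.2) ∧
    Measurable (fun q : T × (Fin p → ℝ) => (H q.1).mu1 q.2) ∧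
    Measurable (fun q : T × (Fin p → ℝ) => (H q.1).pi q.2) ∧
    Measurable (fun q : T × (Fin p → ℝ) × Bool => (H q.1).gamma q.2.1 q.2.2)
  truth P :=
    { mu0 := trueMu0I P, mu1 := trueMu1 P, pi := truePi P, gamma := trueGammaI P }

/-- Outcome dependent missingness. -/
def schemeD (p : ℕ) : Scheme p where
  N := NuisD p
  moment h o :=
    ind (trt o) * (post o
        - (h.mu0 (cov o) (post o) true + ind (resp o) / h.gamma (cov o) (post o) true
          * (pre o - h.mu0 (cov o) (post o) true))
        - h.mu1 (cov o) + h.eta (cov o))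
      - (1 - ind (trt o)) * h.pi (cov o) / (1 - h.pi (cov o)) * (post o
        - (h.mu0 (cov o) (post o) false + ind (resp o) / h.gamma (cov o) (post o) false
          * (pre o - h.mu0 (cov o) (post o) false))
        - h.mu1 (cov o) + h.eta (cov o))
  plug h o := (post o - h.mu0 (cov o) (post o) true) - (h.mu1 (cov o) - h.eta (cov o))
  pi h o := h.pi (cov o)
  gamma h o a := h.gamma (cov o) (post o) a
  MeasFamily {T} _ H :=
    Measurable (fun q : T × (Fin p → ℝ) × ℝ × Bool => (H q.1).mu0 q.2.1 q.2.2.1 q.2.2.2) ∧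
    Measurable (fun q : T × (Fin p → ℝ) => (H q.1).mu1 q.2) ∧
    Measurable (fun q : T × (Fin p → ℝ) => (H q.1).pi q.2) ∧
    Measurable (fun q : T × (Fin p → ℝ) × ℝ × Bool => (H q.1).gamma q.2.1 q.2.2.1 q.2.2.2) ∧
    Measurable (fun q : T × (Fin p → ℝ) => (H q.1).eta q.2)
  truth P :=
    { mu0 := trueMu0D P, mu1 := trueMu1 P, pi := truePi P, gamma := trueGammaD P,
      eta := trueEta P }

/-- The two missingness regimes. -/
inductive Regime
  | outcomeIndependent
  | outcomeDependent

/-- The estimation scheme of a regime. -/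
def Regime.scheme (r : Regime) (p : ℕ) : Scheme p :=
  match r with
  | .outcomeIndependent => schemeI p
  | .outcomeDependent => schemeD p

/-- The missing at random assumption of a regime. -/
def Regime.MAR (r : Regime) {p : ℕ} {Ω₀ : Type*} [MeasurableSpace Ω₀] [StandardBorelSpace Ω₀]
    (F : FullData p Ω₀) (Q : Measure Ω₀) [IsFiniteMeasure Q] : Prop :=
  match r with
  | .outcomeIndependent => MARIndep F Q
  | .outcomeDependent => MARDep F Q

/-- `E[A]` under `P`. -/
def meanTrt {p : ℕ} (P : Measure (Obs p)) : ℝ := ∫ o, ind (trt o) ∂P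

/-- The influence function `φ(o; θ; h)`, where `h` collects the nuisance functions. -/
def Scheme.phi {p : ℕ} (S : Scheme p) (P : Measure (Obs p)) (θ : ℝ) (h : S.N) (o : Obs p) : ℝ :=
  S.moment h o / meanTrt P - ind (trt o) / meanTrt P * θ

/-- The efficient influence function at `θ` and at the true nuisance functions of `P`. -/
def Scheme.eif {p : ℕ} (S : Scheme p) (P : Measure (Obs p)) (θ : ℝ) (o : Obs p) : ℝ :=
  S.phi P θ (S.truth P) o

/-- The identified parameter as a functional of the observed-data law,
`E[(A / E[A]) (Y₁ - μ₀ - (μ₁ - μ₀))]` with `μ₀`, `μ₁` (and `η₀`) those of the law. -/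
def Scheme.target {p : ℕ} (S : Scheme p) (P : Measure (Obs p)) : ℝ :=
  ∫ o, ind (trt o) / meanTrt P * S.plug (S.truth P) o ∂P

/-! ### The semiparametric efficiency bound -/

/-- Bounded scores at `P`: bounded measurable functions of mean zero. -/
def IsScore {p : ℕ} (P : Measure (Obs p)) (g : Obs p → ℝ) : Prop :=
  Measurable g ∧ (∃ C, ∀ o, |g o| ≤ C) ∧ ∫ o, g o ∂P = 0

/-- The one-dimensional submodel `dP_t = (1 + t g) dP` through `P` with score `g`
(a probability law for `t` near `0`). -/
def submodel {p : ℕ} (P : Measure (Obs p)) (g : Obs p → ℝ) (t : ℝ) : Measure (Obs p) :=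
  P.withDensity (fun o => ENNReal.ofReal (1 + t * g o))

/-- `V` is the semiparametric efficiency bound at `P` for the parameter `ψ` in the nonparametric
model for the observed data: `ψ` is differentiable along the submodels, and `V` is the supremum of
their Cramér-Rao bounds `(dψ(P_t)/dt)² / E[g²]` at `t = 0`. -/
structure IsEfficiencyBound {p : ℕ} (ψ : Measure (Obs p) → ℝ) (P : Measure (Obs p)) (V : ℝ) :
    Prop where
  differentiable : ∀ g, IsScore P g → DifferentiableAt ℝ (fun t => ψ (submodel P g t)) 0
  isLUB : IsLUB {v | ∃ g, IsScore P g ∧ 0 < ∫ o, g o ^ 2 ∂P ∧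
    v = deriv (fun t => ψ (submodel P g t)) 0 ^ 2 / ∫ o, g o ^ 2 ∂P} V

/-! ### Cross-fitting -/

section CrossFit

variable {p : ℕ}

/-- A nuisance learner for `J` folds and samples of size `n = J m`. Given a split `s` of the
indices into folds, it returns for each fold `j` nuisance functions that depend only on the
observations outside fold `j`. -/
abbrev Learner (S : Scheme p) (J : ℕ) : Type :=
  (m : ℕ) → (s : Fin (J * m) → Fin J) → (j : Fin J) → ({i // s i ≠ j} → Obs p) → S.N

/-- The nuisance estimates for fold `j`. -/
def Learner.fit {S : Scheme p} {J : ℕ} (L : Learner S J) (m : ℕ) (s : Fin (J * m) → Fin J)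
    (d : Fin (J * m) → Obs p) (j : Fin J) : S.N :=
  L m s j (fun i => d i)

/-- The estimating equation at `θ`: the influence functions, each at the nuisances estimated
without the fold of the observation, sum to zero. -/
def Learner.EstEq {S : Scheme p} {J : ℕ} (L : Learner S J) (P : Measure (Obs p)) (m : ℕ)
    (s : Fin (J * m) → Fin J) (d : Fin (J * m) → Obs p) (θ : ℝ) : Prop :=
  ∑ j, ∑ i with s i = j, S.phi P θ (L.fit m s d j) (d i) = 0

/-- The estimator of fold `j`. -/
def Learner.foldEst {S : Scheme p} {J : ℕ} (L : Learner S J) (m : ℕ)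
    (s : Fin (J * m) → Fin J) (d : Fin (J * m) → Obs p) (j : Fin J) : ℝ :=
  (∑ i with s i = j, S.moment (L.fit m s d j) (d i)) / ∑ i with s i = j, ind (trt (d i))

/-- The average of the fold estimators. -/
def Learner.avgEst {S : Scheme p} {J : ℕ} (L : Learner S J) (m : ℕ)
    (s : Fin (J * m) → Fin J) (d : Fin (J * m) → Obs p) : ℝ :=
  1 / (J : ℝ) * ∑ j, L.foldEst m s d j

/-- The plug-in estimator `θ(P̂⁽⁻ʲ⁾)`: the identification formula at the estimated nuisances and
the empirical law of the observations outside fold `j`. -/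
def Learner.plugIn {S : Scheme p} {J : ℕ} (L : Learner S J) (m : ℕ)
    (s : Fin (J * m) → Fin J) (d : Fin (J * m) → Obs p) (j : Fin J) : ℝ :=
  (∑ i with s i ≠ j, ind (trt (d i)) * S.plug (L.fit m s d j) (d i)) /
    ∑ i with s i ≠ j, ind (trt (d i))

/-- The remainder `κ⁽ʲ⁾` of the von Mises expansion of the parameter at `P̂⁽⁻ʲ⁾`: plug-in estimate,
minus the parameter, plus the mean (for an independent record) of the influence function
at `P̂⁽⁻ʲ⁾`. -/
def Learner.remainder {S : Scheme p} {J : ℕ} (L : Learner S J) (P : Measure (Obs p)) (θ : ℝ)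
    (m : ℕ) (s : Fin (J * m) → Fin J) (d : Fin (J * m) → Obs p) (j : Fin J) : ℝ :=
  L.plugIn m s d j - θ + ∫ o, S.phi P (L.plugIn m s d j) (L.fit m s d j) o ∂P

/-- An i.i.d. sequence of observed records with law `P`, together with, for every `m`, a possibly
random split of the first `J m` of them into `J` folds of size `m`, independent of the records. -/
structure IsSplitSample {Ω : Type*} [MeasurableSpace Ω] (μ : Measure Ω) (P : Measure (Obs p))
    {J : ℕ} (D : ℕ → Ω → Obs p) (s : (m : ℕ) → Ω → Fin (J * m) → Fin J) : Prop where
  measurable_data : ∀ i, Measurable (D i)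
  indep : iIndepFun D μ
  law : ∀ i, HasLaw (D i) P μ
  measurable_split : ∀ m, Measurable (s m)
  split_indep : ∀ m, IndepFun (s m) (fun ω i => D i ω) μ
  balanced : ∀ m ω j, (Finset.univ.filter (fun i => s m ω i = j)).card = m

/-- The first `n` records. -/
def sample {Ω : Type*} (D : ℕ → Ω → Obs p) (n : ℕ) (ω : Ω) : Fin n → Obs p := fun i => D i ω

/-- The high-level inference assumptions. -/
structure InferenceAssumptions {Ω : Type*} [MeasurableSpace Ω] (μ : Measure Ω)
    (S : Scheme p) (P : Measure (Obs p)) (θ : ℝ) {J : ℕ} (D : ℕ → Ω → Obs p)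
    (s : (m : ℕ) → Ω → Fin (J * m) → Fin J) (L : Learner S J) (hbar : S.N) (ξ : ℝ) : Prop where
  /-- the nuisance estimates are jointly measurable in training data and argument -/
  measurable_learner : ∀ m σ j, S.MeasFamily (L m σ j)
  /-- the limiting influence function has finite variance -/
  memLp_limit : MemLp (S.phi P θ hbar) 2 P
  /-- the estimated influence functions converge in `L²(P)`, in probability over the training
  data, to the influence function at the limiting nuisances -/
  l2_convergence : ∀ j, ∀ ε : ℝ≥0∞, 0 < ε → Tendsto
    (fun m => μ {ω | ε ≤ eLpNorm (fun o =>
      S.phi P θ (L.fit m (s m ω) (sample D (J * m) ω) j) o - S.phi P θ hbar o) 2 P}) atTop (𝓝 0)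
  /-- the remainder terms are of smaller order than `n^{-1/2}` -/
  remainder_small : TendstoInMeasure μ (fun m ω => √((J * m : ℕ) : ℝ) *
    ∑ j, L.remainder P θ m (s m ω) (sample D (J * m) ω) j) atTop (fun _ => 0)
  /-- strong overlap of the estimated propensity and missingness probabilities -/
  xi_pos : 0 < ξ
  strong_overlap : ∀ m j, ∀ᵐ ω ∂μ, ∀ᵐ o ∂P,
    S.pi (L.fit m (s m ω) (sample D (J * m) ω) j) o ∈ Set.Icc ξ (1 - ξ) ∧
    ∀ a, S.gamma (L.fit m (s m ω) (sample D (J * m) ω) j) o a ∈ Set.Icc ξ (1 - ξ)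

/-- `√n (θ̂ - θ)` converges in distribution to `N(0, V)` along `n = J m`, as `m → ∞`. -/
def AsympNormal {Ω : Type*} [MeasurableSpace Ω] (μ : Measure Ω) [IsProbabilityMeasure μ]
    (J : ℕ) (est : ℕ → Ω → ℝ) (θ V : ℝ) : Prop :=
  TendstoInDistribution (fun m ω => √((J * m : ℕ) : ℝ) * (est m ω - θ)) atTop
    (id : ℝ → ℝ) (fun _ => μ) (gaussianReal 0 V.toNNReal)

end CrossFit

end DiDMissing

end

/-!
Inference for the effect on the treated with missing pre-treatment outcomes: asymptotic normality
of the cross-fitted estimators, and their efficiency.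

**Asymptotic normality.** The influence function is affine in `θ` with slope `-A / E[A]`, so the
remainder of the von Mises expansion at the plug-in estimate is just the mean `∫ φ(·; θ⋆; ĥ) dP`,
whatever the value of that estimate (`remainder_eq`). Hence the remainder condition says that these
means sum to `o_P(n^{-1/2})`, and in the `L²` limit the limiting influence function is centred
(`integral_limit_eq_zero`). Given the split and the records outside a fold, the fitted influence
function is a fixed function evaluated at independent records, so Chebyshev's inequality, applied
conditionally, replaces it by its limit up to `o_P(√n)` (`pi_measure_fold_le`,
`littleOP_sum_foldSum_sub`). The central limit theorem and Slutsky's lemma for the treated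
fractions of the folds conclude (`asympNormal_root`, `asympNormal_avgEst`).

**Gradient.** The parameter is built from regressions `m = E[W ∣ Z, B]`, integrated with a weight
`u(Z)` over an event `C`. Conditional independence turns such an integral into one over `B` with
another weight `f(Z)` (`Reweights`: odds of treatment, inverse response probabilities). Along a
submodel `P_t`, orthogonality of regression residuals then gives the identity
`∫_C u m_t dP_t = ∫_B f W dP_t - t ∫_B g f m_t dP + t ∫_C g u m_t dP`, in which `m_t` only has to
converge in weighted `L¹`. That convergence holds because `m_t - m₀`, tested against its own sign,
is a difference of residuals, hence of order `t` up to the change of `W`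
(`hasDerivAt_setIntegral_condMean`); working in `L¹` makes weighted integrability of the outcomes
enough. Applied to each term, and twice to the nested regression `η₀`, this shows that the influence
function at the true nuisances is the gradient of the parameter. The same weights, together with parallel trends, identify the parameter with the
effect on the treated (`Regime.identification_and_gradient`).

**Efficiency bound.** For a centred, square integrable gradient `φ`, Cauchy-Schwarz bounds the
Cramér-Rao ratios by `Var φ`, and centred truncations of `φ` are bounded scores that attain it in
the limit (`isEfficiencyBound_of_gradient`).
-/

noncomputable section

namespace DiDMissing

/-! ### Stochastic order symbols -/

section StochasticOrder

variable {Ω : Type*} [MeasurableSpace Ω] {μ : Measure Ω}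

/-- `X m = o_P(1)`: the sequence converges to zero in (outer) probability. No measurability is
required. -/
def LittleOP (μ : Measure Ω) (X : ℕ → Ω → ℝ) : Prop :=
  ∀ ε : ℝ, 0 < ε → Tendsto (fun m => μ {ω | ε ≤ |X m ω|}) atTop (𝓝 0)

/-- `X m = O_P(1)`: the sequence is bounded in (outer) probability, up to finitely many terms. -/
def BigOP (μ : Measure Ω) (X : ℕ → Ω → ℝ) : Prop :=
  ∀ δ : ℝ≥0∞, 0 < δ → ∃ K : ℝ, 0 < K ∧ ∀ᶠ m in atTop, μ {ω | K ≤ |X m ω|} ≤ δ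

theorem littleOP_iff_tendstoInMeasure {X : ℕ → Ω → ℝ} :
    LittleOP μ X ↔ TendstoInMeasure μ X atTop (fun _ => 0) := by
  simp [LittleOP, tendstoInMeasure_iff_norm]

/-- Domination outside events whose probabilities tend to zero. -/
theorem LittleOP.of_le_off {X Y : ℕ → Ω → ℝ} (hX : LittleOP μ X) {E : ℕ → Set Ω}
    (hE : Tendsto (fun m => μ (E m)) atTop (𝓝 0))
    (h : ∀ᶠ m in atTop, ∀ᵐ ω ∂μ, ω ∉ E m → |Y m ω| ≤ |X m ω|) : LittleOP μ Y := by
  intro ε hε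
  have := (hX ε hε).add hE
  rw [add_zero] at this
  refine tendsto_of_tendsto_of_tendsto_of_le_of_le' tendsto_const_nhds this
    (Eventually.of_forall fun _ => zero_le) ?_
  filter_upwards [h] with m hm
  refine (measure_mono_ae ?_).trans (measure_union_le _ _)
  filter_upwards [hm] with ω hω (h1 : ε ≤ |Y m ω|)
  by_cases h2 : ω ∈ E m
  · exact Or.inr h2
  · exact Or.inl (h1.trans (hω h2))

theorem LittleOP.of_le {X Y : ℕ → Ω → ℝ} (hX : LittleOP μ X)
    (h : ∀ᶠ m in atTop, ∀ ω, |Y m ω| ≤ |X m ω|) : LittleOP μ Y :=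
  hX.of_le_off (E := fun _ => ∅) (by simp)
    (h.mono fun _ hm => Eventually.of_forall fun ω _ => hm ω)

theorem LittleOP.add {X Y : ℕ → Ω → ℝ} (hX : LittleOP μ X) (hY : LittleOP μ Y) :
    LittleOP μ (fun m ω => X m ω + Y m ω) := by
  intro ε hε
  have := (hX (ε / 2) (by positivity)).add (hY (ε / 2) (by positivity))
  rw [add_zero] at this
  refine tendsto_of_tendsto_of_tendsto_of_le_of_le tendsto_const_nhds this (fun _ => zero_le) ?_
  intro m
  refine (measure_mono ?_).trans (measure_union_le _ _)
  intro ω (h1 : ε ≤ |X m ω + Y m ω|)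
  by_contra hc
  simp only [Set.mem_union, Set.mem_ofPred_eq, not_or, not_le] at hc
  have := abs_add_le (X m ω) (Y m ω)
  linarith

theorem LittleOP.zero : LittleOP μ (fun _ _ => 0) := by
  intro ε hε
  simp [not_le.2 hε]

theorem LittleOP.sum {κ : Type*} (s : Finset κ) {X : κ → ℕ → Ω → ℝ}
    (hX : ∀ j ∈ s, LittleOP μ (X j)) : LittleOP μ (fun m ω => ∑ j ∈ s, X j m ω) := by
  classical
  induction s using Finset.induction_on with
  | empty => simpa using LittleOP.zero
  | insert a s ha ih =>
    simp only [Finset.sum_insert ha]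
    exact (hX a (by simp)).add (ih fun j hj => hX j (by simp [hj]))

/-- `O_P(1) · o_P(1) = o_P(1)`. -/
theorem BigOP.mul_littleOP {X Y : ℕ → Ω → ℝ} (hX : BigOP μ X) (hY : LittleOP μ Y) :
    LittleOP μ (fun m ω => X m ω * Y m ω) := by
  intro ε hε
  rw [ENNReal.tendsto_nhds_zero]
  intro δ hδ
  obtain ⟨K, hK, hm⟩ := hX (δ / 2) (ENNReal.half_pos hδ.ne')
  have h2 := ENNReal.tendsto_nhds_zero.1 (hY (ε / K) (by positivity)) (δ / 2)
    (ENNReal.half_pos hδ.ne')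
  filter_upwards [hm, h2] with m h1 h2
  rw [← ENNReal.add_halves δ]
  refine le_trans ((measure_mono ?_).trans (measure_union_le _ _)) (add_le_add h1 h2)
  intro ω (h : ε ≤ |X m ω * Y m ω|)
  by_contra hc
  simp only [Set.mem_union, Set.mem_ofPred_eq, not_or, not_le] at hc
  rw [abs_mul] at h
  have h3 := (lt_div_iff₀ hK).1 hc.2
  nlinarith [abs_nonneg (X m ω), abs_nonneg (Y m ω)]

theorem BigOP.const (c : ℝ) : BigOP μ (fun _ _ => c) := by
  intro δ _
  refine ⟨|c| + 1, by positivity, Eventually.of_forall fun m => ?_⟩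
  simp [not_le.2 (lt_add_one |c|)]

theorem LittleOP.const_mul {X : ℕ → Ω → ℝ} (hX : LittleOP μ X) (c : ℝ) :
    LittleOP μ (fun m ω => c * X m ω) :=
  (BigOP.const c).mul_littleOP hX

theorem LittleOP.bigOP {X : ℕ → Ω → ℝ} (hX : LittleOP μ X) : BigOP μ X := fun δ hδ =>
  ⟨1, one_pos, ENNReal.tendsto_nhds_zero.1 (hX 1 one_pos) δ hδ⟩

theorem BigOP.add {X Y : ℕ → Ω → ℝ} (hX : BigOP μ X) (hY : BigOP μ Y) :
    BigOP μ (fun m ω => X m ω + Y m ω) := by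
  intro δ hδ
  obtain ⟨K, hK, h1⟩ := hX (δ / 2) (ENNReal.half_pos hδ.ne')
  obtain ⟨K', hK', h2⟩ := hY (δ / 2) (ENNReal.half_pos hδ.ne')
  refine ⟨K + K', by positivity, ?_⟩
  filter_upwards [h1, h2] with m h1 h2
  rw [← ENNReal.add_halves δ]
  refine le_trans ((measure_mono ?_).trans (measure_union_le _ _)) (add_le_add h1 h2)
  intro ω (h : K + K' ≤ |X m ω + Y m ω|)
  by_contra hc
  simp only [Set.mem_union, Set.mem_ofPred_eq, not_or, not_le] at hc
  have := abs_add_le (X m ω) (Y m ω)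
  linarith

theorem BigOP.mul {X Y : ℕ → Ω → ℝ} (hX : BigOP μ X) (hY : BigOP μ Y) :
    BigOP μ (fun m ω => X m ω * Y m ω) := by
  intro δ hδ
  obtain ⟨K, hK, h1⟩ := hX (δ / 2) (ENNReal.half_pos hδ.ne')
  obtain ⟨K', hK', h2⟩ := hY (δ / 2) (ENNReal.half_pos hδ.ne')
  refine ⟨K * K', by positivity, ?_⟩
  filter_upwards [h1, h2] with m h1 h2
  rw [← ENNReal.add_halves δ]
  refine le_trans ((measure_mono ?_).trans (measure_union_le _ _)) (add_le_add h1 h2)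
  intro ω (h : K * K' ≤ |X m ω * Y m ω|)
  by_contra hc
  simp only [Set.mem_union, Set.mem_ofPred_eq, not_or, not_le] at hc
  rw [abs_mul] at h
  nlinarith [abs_nonneg (X m ω), abs_nonneg (Y m ω)]

theorem BigOP.sum {κ : Type*} (s : Finset κ) {X : κ → ℕ → Ω → ℝ}
    (hX : ∀ j ∈ s, BigOP μ (X j)) : BigOP μ (fun m ω => ∑ j ∈ s, X j m ω) := by
  classical
  induction s using Finset.induction_on with
  | empty => simpa using BigOP.const 0
  | insert a s ha ih =>
    simp only [Finset.sum_insert ha]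
    exact (hX a (by simp)).add (ih fun j hj => hX j (by simp [hj]))

/-- If `B = 1 + o_P(1)`, then `1 / B = O_P(1)`. -/
theorem LittleOP.bigOP_inv {B : ℕ → Ω → ℝ} (hB : LittleOP μ (fun m ω => B m ω - 1)) :
    BigOP μ (fun m ω => (B m ω)⁻¹) := by
  intro δ hδ
  refine ⟨3, by norm_num, ?_⟩
  filter_upwards [ENNReal.tendsto_nhds_zero.1 (hB (1 / 2) (by norm_num)) δ hδ] with m hm
  refine (measure_mono ?_).trans hm
  intro ω (h : 3 ≤ |(B m ω)⁻¹|)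
  by_contra hc
  simp only [Set.mem_ofPred_eq, not_le] at hc
  have h1 : 1 / 2 < B m ω := by have := abs_lt.1 hc; linarith
  rw [abs_of_pos (by positivity)] at h
  have : (B m ω)⁻¹ ≤ (1 / 2 : ℝ)⁻¹ := inv_anti₀ (by norm_num) h1.le
  norm_num at this
  linarith

/-- A deterministic constant that is `o_P(1)` vanishes. -/
theorem LittleOP.eq_zero_of_const [IsProbabilityMeasure μ] {c : ℝ}
    (h : LittleOP μ (fun _ _ => c)) : c = 0 := by
  by_contra hc
  have := h |c| (abs_pos.2 hc)
  simp at this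

end StochasticOrder

/-! ### Conditional Chebyshev inequality over a fold -/

section FoldChebyshev

variable {α : Type*} [MeasurableSpace α]

theorem memLp_two_of_eLpNorm_le {P : Measure α} {k : α → ℝ} (hk : AEStronglyMeasurable k P) {δ : ℝ}
    (h : eLpNorm k 2 P ≤ ENNReal.ofReal δ) : MemLp k 2 P :=
  ⟨hk, h.trans_lt ENNReal.ofReal_lt_top⟩

variable (P : Measure α) [IsProbabilityMeasure P]

theorem variance_le_of_eLpNorm_le {k : α → ℝ} (hk : AEStronglyMeasurable k P) {δ : ℝ}
    (hδ : 0 ≤ δ) (h : eLpNorm k 2 P ≤ ENNReal.ofReal δ) : Var[k; P] ≤ δ ^ 2 := by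
  have hm := memLp_two_of_eLpNorm_le hk h
  refine (variance_le_expectation_sq hk).trans ?_
  have h1 : (eLpNorm k 2 P).toReal ≤ δ := ENNReal.toReal_le_of_le_ofReal hδ h
  have h2 : (∫ x, (k ^ 2) x ∂P) = (eLpNorm k 2 P).toReal ^ 2 := by
    rw [hm.eLpNorm_eq_integral_rpow_norm (by norm_num) (by norm_num),
      ENNReal.toReal_ofReal (by positivity)]
    simp only [ENNReal.toReal_ofNat, Real.rpow_ofNat, Real.norm_eq_abs, sq_abs, Pi.pow_apply]
    rw [← Real.rpow_natCast, ← Real.rpow_mul (integral_nonneg fun _ => by positivity)]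
    norm_num
  rw [h2]
  gcongr

/-- Chebyshev's inequality for a sum over an i.i.d. sample. -/
theorem pi_measure_sum_ge_le {ι : Type*} [Fintype ι] {k : α → ℝ}
    (hk : AEStronglyMeasurable k P) {δ : ℝ} (hδ : 0 ≤ δ)
    (h : eLpNorm k 2 P ≤ ENNReal.ofReal δ) {c : ℝ} (hc : 0 < c) :
    Measure.pi (fun _ : ι => P) {v | c ≤ |∑ i, k (v i) - Fintype.card ι * ∫ x, k x ∂P|}
      ≤ ENNReal.ofReal (Fintype.card ι * δ ^ 2 / c ^ 2) := by
  have hm := memLp_two_of_eLpNorm_le hk h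
  have hmi (i : ι) : MemLp (fun v : ι → α => k (v i)) 2 (Measure.pi fun _ : ι => P) :=
    hm.comp_measurePreserving (measurePreserving_eval _ i)
  have hS : MemLp (∑ i, fun v : ι → α => k (v i)) 2 (Measure.pi fun _ : ι => P) :=
    memLp_finsetSum' _ fun i _ => hmi i
  have hE : (∫ v, (∑ i, fun v : ι → α => k (v i)) v ∂(Measure.pi fun _ : ι => P))
      = Fintype.card ι * ∫ x, k x ∂P := by
    simp only [Finset.sum_apply]
    rw [integral_finsetSum _ fun i _ => (hmi i).integrable (by norm_num)]
    have (i : ι) : (∫ v, k (v i) ∂(Measure.pi fun _ : ι => P)) = ∫ x, k x ∂P := by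
      have := measurePreserving_eval (fun _ : ι => P) i
      rw [← integral_map (φ := Function.eval i) (f := k) this.measurable.aemeasurable]
      · rw [this.map_eq]
      · rw [this.map_eq]; exact hk
    simp [this]
  have := meas_ge_le_variance_div_sq hS hc
  rw [hE, variance_sum_pi (fun _ => hm)] at this
  simp only [Finset.sum_apply] at this
  refine this.trans (ENNReal.ofReal_le_ofReal ?_)
  simp only [Finset.sum_const, Finset.card_univ, nsmul_eq_mul]
  gcongr
  exact variance_le_of_eLpNorm_le P hk hδ h

variable {ι κ : Type*} [Fintype ι] [DecidableEq κ]

/-- Given the observations outside a fold, a random function `k` that depends only on them is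
evaluated at independent records inside the fold, so the Chebyshev inequality applies. -/
theorem pi_measure_fold_le (σ : ι → κ) (j : κ)
    (k : ({i // σ i ≠ j} → α) → α → ℝ) (hk : Measurable (Function.uncurry k))
    {δ : ℝ} (hδ : 0 ≤ δ) {c : ℝ} (hc : 0 < c) :
    Measure.pi (fun _ : ι => P)
      {d | eLpNorm (k fun i => d i) 2 P ≤ ENNReal.ofReal δ ∧
        c ≤ |∑ i with σ i = j, k (fun i => d i) (d i)
          - (Finset.univ.filter (fun i => σ i = j)).card * ∫ x, k (fun i => d i) x ∂P|}
      ≤ ENNReal.ofReal ((Finset.univ.filter (fun i => σ i = j)).card * δ ^ 2 / c ^ 2) := by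
  classical
  set N := (Finset.univ.filter (fun i => σ i = j)).card
  have hcard : Fintype.card {i // ¬ (σ i ≠ j)} = N := by
    rw [Fintype.card_subtype]; simp [N]
  let e := MeasurableEquiv.piEquivPiSubtypeProd (fun _ : ι => α) (fun i => σ i ≠ j)
  have he := measurePreserving_piEquivPiSubtypeProd (fun _ : ι => P) (fun i => σ i ≠ j)
  let E : Set (({i // σ i ≠ j} → α) × ({i // ¬ (σ i ≠ j)} → α)) :=
    {q | eLpNorm (k q.1) 2 P ≤ ENNReal.ofReal δ ∧
      c ≤ |∑ i, k q.1 (q.2 i) - N * ∫ x, k q.1 x ∂P|}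
  have hku (u) : Measurable (k u) := hk.of_uncurry_left
  have hE : MeasurableSet E := by
    have h1 : Measurable fun u => eLpNorm (k u) 2 P := by
      simp only [eLpNorm_eq_lintegral_rpow_enorm_toReal (two_ne_zero) (ENNReal.ofNat_ne_top)]
      refine Measurable.pow_const ?_ _
      exact Measurable.lintegral_prod_right' (f := fun q : _ × α =>
        ‖Function.uncurry k q‖ₑ ^ (2 : ℝ≥0∞).toReal) (hk.enorm.pow_const _)
    have h2 : Measurable fun u => ∫ x, k u x ∂P :=
      (hk.stronglyMeasurable.integral_prod_right' (ν := P)).measurable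
    have h3 : Measurable fun q : (({i // σ i ≠ j} → α) × ({i // ¬ (σ i ≠ j)} → α)) =>
        ∑ i, k q.1 (q.2 i) := by
      refine Finset.measurable_sum _ fun i _ => ?_
      exact hk.comp (measurable_fst.prodMk ((measurable_pi_apply i).comp measurable_snd))
    have h4 : Measurable fun q : (({i // σ i ≠ j} → α) × ({i // ¬ (σ i ≠ j)} → α)) =>
        |∑ i, k q.1 (q.2 i) - N * ∫ x, k q.1 x ∂P| :=
      (h3.sub (measurable_const.mul (h2.comp measurable_fst))).abs
    exact (measurableSet_le (h1.comp measurable_fst) measurable_const).inter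
      (measurableSet_le measurable_const h4)
  have hset : {d : ι → α | eLpNorm (k fun i => d i) 2 P ≤ ENNReal.ofReal δ ∧
        c ≤ |∑ i with σ i = j, k (fun i => d i) (d i) - N * ∫ x, k (fun i => d i) x ∂P|}
      = e ⁻¹' E := by
    ext d
    have : ∑ i with σ i = j, k (fun i : {i // σ i ≠ j} => d i) (d i)
        = ∑ i : {i // ¬ (σ i ≠ j)}, k (fun i : {i // σ i ≠ j} => d i) (d i) := by
      rw [← Finset.sum_subtype (Finset.univ.filter (fun i => σ i = j))
        (p := fun i => ¬ (σ i ≠ j)) (by simp)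
        (f := fun i => k (fun i : {i // σ i ≠ j} => d i) (d i))]
    simp only [Set.mem_ofPred_eq, Set.mem_preimage, E, this]
    rfl
  rw [hset, he.measure_preimage hE.nullMeasurableSet, Measure.prod_apply hE]
  refine (lintegral_mono (g := fun _ => ENNReal.ofReal (N * δ ^ 2 / c ^ 2)) fun u => ?_).trans
    (by simp)
  by_cases hu : eLpNorm (k u) 2 P ≤ ENNReal.ofReal δ
  · have := pi_measure_sum_ge_le P (ι := {i // ¬ (σ i ≠ j)}) (hku u).aestronglyMeasurable hδ hu hc
    rw [hcard] at this
    refine (measure_mono ?_).trans this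
    intro v hv
    exact hv.2
  · have : Prod.mk u ⁻¹' E = ∅ := by
      ext v; simp [E, hu]
    simp [this]

end FoldChebyshev

/-! ### Fold sums of a split sample -/

section SplitSample

variable {p : ℕ} {Ω : Type*} [MeasurableSpace Ω] {μ : Measure Ω}
  {P : Measure (Obs p)} {J : ℕ} {D : ℕ → Ω → Obs p}
  {s : (m : ℕ) → Ω → Fin (J * m) → Fin J}

theorem measurable_sample (hD : IsSplitSample μ P D s) (n : ℕ) : Measurable (sample D n) :=
  measurable_pi_lambda _ fun _ => hD.measurable_data _

theorem map_sample (hD : IsSplitSample μ P D s) (n : ℕ) :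
    μ.map (sample D n) = Measure.pi fun _ => P := by
  have h := hD.indep.precomp (g := fun i : Fin n => (i : ℕ)) Fin.val_injective
  have h2 := iIndepFun.map_fun_eq_pi_map (f := fun (i : Fin n) => D i) (h := h) fun i =>
    (hD.measurable_data i).aemeasurable
  simp only [(hD.law _).map_eq] at h2
  exact h2

theorem indepFun_split_sample (hD : IsSplitSample μ P D s) (m : ℕ) :
    IndepFun (s m) (sample D (J * m)) μ :=
  (hD.split_indep m).comp (φ := id) (ψ := fun (d : ℕ → Obs p) (i : Fin (J * m)) => d i)
    measurable_id (by fun_prop)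

variable [IsProbabilityMeasure μ]

/-- An event bounded for every fixed split is bounded for the random split. -/
theorem measure_split_le (hD : IsSplitSample μ P D s) (m : ℕ)
    (E : (Fin (J * m) → Fin J) → Set (Fin (J * m) → Obs p))
    (B : ℝ≥0∞)
    (hB : ∀ ω, (Measure.pi fun _ => P) (E (s m ω)) ≤ B) :
    μ {ω | sample D (J * m) ω ∈ E (s m ω)} ≤ B := by
  let E' (σ) := toMeasurable (Measure.pi fun _ : Fin (J * m) => P) (E σ)
  have h1 : {ω | sample D (J * m) ω ∈ E (s m ω)}
      ⊆ ⋃ σ ∈ (Finset.univ : Finset (Fin (J * m) → Fin J)),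
        (s m ⁻¹' {σ} ∩ sample D (J * m) ⁻¹' E' σ) := by
    intro ω hω
    simp only [Finset.mem_univ, Set.iUnion_true, Set.mem_iUnion, Set.mem_inter_iff,
      Set.mem_preimage, Set.mem_singleton_iff]
    exact ⟨s m ω, rfl, subset_toMeasurable _ _ hω⟩
  calc μ {ω | sample D (J * m) ω ∈ E (s m ω)}
      ≤ ∑ σ, μ (s m ⁻¹' {σ} ∩ sample D (J * m) ⁻¹' E' σ) :=
        (measure_mono h1).trans (measure_biUnion_finset_le _ _)
    _ ≤ ∑ σ, μ (s m ⁻¹' {σ}) * B := by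
        refine Finset.sum_le_sum fun σ _ => ?_
        rw [(indepFun_split_sample hD m).measure_inter_preimage_eq_mul _ _
          (measurableSet_singleton σ) (measurableSet_toMeasurable _ _)]
        by_cases hσ : ∃ ω, s m ω = σ
        · obtain ⟨ω, rfl⟩ := hσ
          gcongr
          rw [← Measure.map_apply (measurable_sample hD _) (measurableSet_toMeasurable _ _),
            map_sample hD, measure_toMeasurable]
          exact hB ω
        · have : s m ⁻¹' {σ} = ∅ := by
            ext ω; simp; exact fun h => hσ ⟨ω, h⟩
          simp [this]
    _ = B := by
        rw [← Finset.sum_mul]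
        have : ∑ σ, μ (s m ⁻¹' {σ}) = 1 := by
          rw [sum_measure_preimage_singleton _ fun σ _ => hD.measurable_split m
            (measurableSet_singleton σ)]
          simp
        rw [this, one_mul]

variable [IsProbabilityMeasure P]

variable (k : (m : ℕ) → (σ : Fin (J * m) → Fin J) → (j : Fin J) →
    ({i // σ i ≠ j} → Obs p) → Obs p → ℝ)

/-- Sum over fold `j` of the functions `k`, fitted outside the fold. -/
def foldSum (D : ℕ → Ω → Obs p)
    (s : (m : ℕ) → Ω → Fin (J * m) → Fin J) (j : Fin J) (m : ℕ) (ω : Ω) : ℝ :=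
  ∑ i with s m ω i = j, k m (s m ω) j (fun i => sample D (J * m) ω i) (sample D (J * m) ω i)

/-- Mean, for an independent record, of the function `k` fitted outside fold `j`. -/
def foldMean (P : Measure (Obs p)) (D : ℕ → Ω → Obs p)
    (s : (m : ℕ) → Ω → Fin (J * m) → Fin J) (j : Fin J) (m : ℕ) (ω : Ω) : ℝ :=
  ∫ o, k m (s m ω) j (fun i => sample D (J * m) ω i) o ∂P

/-- Sum over fold `j` of the functions `k`, fitted outside the fold, centred conditionally on the
records outside the fold. -/
def foldDev (P : Measure (Obs p)) (D : ℕ → Ω → Obs p)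
    (s : (m : ℕ) → Ω → Fin (J * m) → Fin J) (j : Fin J) (m : ℕ) (ω : Ω) : ℝ :=
  foldSum k D s j m ω - m * foldMean k P D s j m ω

/-- Chebyshev's inequality for a fold sum, on the event that the fitted function is small in
`L²`. -/
theorem measure_foldDev_le (hD : IsSplitSample μ P D s)
    (hk : ∀ m σ j, Measurable (Function.uncurry (k m σ j))) (j : Fin J) {m : ℕ} (hm : 0 < m)
    {δ : ℝ} (hδ : 0 ≤ δ) {ε : ℝ} (hε : 0 < ε) :
    μ {ω | eLpNorm (k m (s m ω) j (fun i => sample D (J * m) ω i)) 2 P ≤ ENNReal.ofReal δ ∧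
      ε * √(m : ℝ) ≤ |foldDev k P D s j m ω|} ≤ ENNReal.ofReal (δ ^ 2 / ε ^ 2) := by
  have hm' : (0 : ℝ) < m := by exact_mod_cast hm
  refine measure_split_le hD m (fun σ => {d | eLpNorm (k m σ j (fun i => d i)) 2 P
    ≤ ENNReal.ofReal δ ∧ ε * √(m : ℝ) ≤ |∑ i with σ i = j, k m σ j (fun i => d i) (d i)
    - m * ∫ o, k m σ j (fun i => d i) o ∂P|}) _ fun ω => ?_
  have := pi_measure_fold_le P (s m ω) j (k m (s m ω) j) (hk _ _ _) hδ
    (c := ε * √(m : ℝ)) (by positivity)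
  rw [hD.balanced] at this
  refine this.trans (ENNReal.ofReal_le_ofReal (le_of_eq ?_))
  rw [mul_pow, Real.sq_sqrt hm'.le]
  field_simp

/-- Fold sums of functions that converge to zero in `L²`, in probability, are `o_P(√m)` after
conditional centring. -/
theorem littleOP_foldDev (hD : IsSplitSample μ P D s)
    (hk : ∀ m σ j, Measurable (Function.uncurry (k m σ j))) (j : Fin J)
    (h : ∀ ε : ℝ≥0∞, 0 < ε → Tendsto (fun m => μ {ω | ε ≤
      eLpNorm (k m (s m ω) j (fun i => sample D (J * m) ω i)) 2 P}) atTop (𝓝 0)) :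
    LittleOP μ (fun m ω => foldDev k P D s j m ω / √(m : ℝ)) := by
  intro ε hε
  rw [ENNReal.tendsto_nhds_zero]
  intro η hη
  obtain ⟨δ, hδ, hδη⟩ : ∃ δ : ℝ, 0 < δ ∧ ENNReal.ofReal (δ ^ 2 / ε ^ 2) ≤ η / 2 := by
    have hc : Tendsto (fun δ : ℝ => ENNReal.ofReal (δ ^ 2 / ε ^ 2)) (𝓝[>] 0) (𝓝 0) := by
      have : Continuous fun δ : ℝ => ENNReal.ofReal (δ ^ 2 / ε ^ 2) :=
        ENNReal.continuous_ofReal.comp (by fun_prop)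
      simpa using (this.tendsto 0).mono_left nhdsWithin_le_nhds
    have h1 := ENNReal.tendsto_nhds_zero.1 hc (η / 2) (ENNReal.half_pos hη.ne')
    obtain ⟨δ, h2, h3⟩ := (h1.and self_mem_nhdsWithin).exists
    exact ⟨δ, h3, h2⟩
  filter_upwards [ENNReal.tendsto_nhds_zero.1 (h (ENNReal.ofReal δ) (by simpa)) (η / 2)
    (ENNReal.half_pos hη.ne'), eventually_gt_atTop 0] with m h1 hm
  rw [← ENNReal.add_halves η]
  refine le_trans ((measure_mono ?_).trans (measure_union_le _ _))
    (add_le_add h1 ((measure_foldDev_le k hD hk j hm hδ.le hε).trans hδη))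
  intro ω (hω : ε ≤ |foldDev k P D s j m ω / √(m : ℝ)|)
  have hm' : (0 : ℝ) < √(m : ℝ) := by positivity
  rw [abs_div, abs_of_pos hm', le_div_iff₀ hm'] at hω
  rcases le_total (ENNReal.ofReal δ)
    (eLpNorm (k m (s m ω) j (fun i => sample D (J * m) ω i)) 2 P) with h | h
  · exact Or.inl h
  · exact Or.inr ⟨h, hω⟩

/-- Centred fold sums of a fixed square integrable function are `O_P(√m)`. -/
theorem bigOP_foldDev_const (hD : IsSplitSample μ P D s) {g : Obs p → ℝ} (hg : Measurable g)
    (hg2 : MemLp g 2 P) (j : Fin J) :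
    BigOP μ (fun m ω => foldDev (fun _ _ _ _ => g) P D s j m ω / √(m : ℝ)) := by
  intro η hη
  set δ := (eLpNorm g 2 P).toReal
  have hδ : eLpNorm g 2 P ≤ ENNReal.ofReal δ := by
    rw [ENNReal.ofReal_toReal hg2.2.ne]
  obtain ⟨K, hK, hKη⟩ : ∃ K : ℝ, 0 < K ∧ ENNReal.ofReal (δ ^ 2 / K ^ 2) ≤ η := by
    have hc : Tendsto (fun K : ℝ => ENNReal.ofReal (δ ^ 2 / K ^ 2)) atTop (𝓝 0) := by
      rw [← ENNReal.ofReal_zero]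
      refine ENNReal.tendsto_ofReal ?_
      exact tendsto_const_nhds.div_atTop (tendsto_pow_atTop two_ne_zero)
    obtain ⟨K, h1, h2⟩ := ((ENNReal.tendsto_nhds_zero.1 hc η hη).and
      (eventually_gt_atTop 0)).exists
    exact ⟨K, h2, h1⟩
  refine ⟨K, hK, ?_⟩
  filter_upwards [eventually_gt_atTop 0] with m hm
  refine (measure_mono ?_).trans ((measure_foldDev_le (fun _ _ _ _ => g) hD
    (fun _ _ _ => hg.comp measurable_snd) j hm ENNReal.toReal_nonneg hK).trans hKη)
  intro ω (hω : K ≤ |foldDev (fun _ _ _ _ => g) P D s j m ω / √(m : ℝ)|)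
  have hm' : (0 : ℝ) < √(m : ℝ) := by positivity
  rw [abs_div, abs_of_pos hm', le_div_iff₀ hm'] at hω
  exact ⟨hδ, hω⟩

end SplitSample

/-! ### Cross-fitted averages -/

section CrossFitted

variable {p : ℕ} {Ω : Type*} [MeasurableSpace Ω] {μ : Measure Ω} [IsProbabilityMeasure μ]
  {P : Measure (Obs p)} [IsProbabilityMeasure P] {J : ℕ} {D : ℕ → Ω → Obs p}
  {s : (m : ℕ) → Ω → Fin (J * m) → Fin J}

theorem littleOP_of_tendsto {a : ℕ → ℝ} (ha : Tendsto a atTop (𝓝 0)) :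
    LittleOP μ (fun m _ => a m) := by
  intro ε hε
  have : ∀ᶠ m in atTop, |a m| < ε := by
    have := ha.abs
    rw [abs_zero] at this
    exact this.eventually_lt_const hε
  refine tendsto_const_nhds.congr' ?_
  filter_upwards [this] with m hm
  simp [not_le.2 hm]

theorem tendsto_inv_sqrt_natCast : Tendsto (fun m : ℕ => (√(m : ℝ))⁻¹) atTop (𝓝 0) :=
  tendsto_inv_atTop_zero.comp (Real.tendsto_sqrt_atTop.comp tendsto_natCast_atTop_atTop)

section Averages

variable {k : (m : ℕ) → (σ : Fin (J * m) → Fin J) → (j : Fin J) →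
    ({i // σ i ≠ j} → Obs p) → Obs p → ℝ}
  (hk : ∀ m σ j, Measurable (Function.uncurry (k m σ j)))
  {g : Obs p → ℝ} (hg : Measurable g) (hg2 : MemLp g 2 P)
  (hl2 : ∀ j, ∀ ε : ℝ≥0∞, 0 < ε → Tendsto (fun m => μ {ω | ε ≤
      eLpNorm (fun o => k m (s m ω) j (fun i => sample D (J * m) ω i) o - g o) 2 P}) atTop (𝓝 0))

include hk hg hg2 hl2

/-- Off an event of vanishing probability, the fitted function is square integrable. -/
theorem exists_event_memLp (j : Fin J) : ∃ E : ℕ → Set Ω,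
    Tendsto (fun m => μ (E m)) atTop (𝓝 0) ∧ ∀ m ω, ω ∉ E m →
      MemLp (k m (s m ω) j (fun i => sample D (J * m) ω i)) 2 P := by
  refine ⟨_, hl2 j 1 one_pos, fun m ω hω => ?_⟩
  have h1 : MemLp (fun o => k m (s m ω) j (fun i => sample D (J * m) ω i) o - g o) 2 P := by
    refine ⟨?_, (not_le.1 hω).trans ENNReal.one_lt_top⟩
    exact (((hk _ _ _).of_uncurry_left).sub hg).aestronglyMeasurable
  have h2 := h1.add hg2
  simpa [Pi.add_def] using h2

theorem littleOP_foldMean_sub (j : Fin J) :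
    LittleOP μ (fun m ω => foldMean k P D s j m ω - ∫ o, g o ∂P) := by
  obtain ⟨E, hE, hmem⟩ := exists_event_memLp hk hg hg2 hl2 j
  have h1 : LittleOP μ (fun m ω =>
      (eLpNorm (fun o => k m (s m ω) j (fun i => sample D (J * m) ω i) o - g o) 2 P).toReal) := by
    intro ε hε
    refine tendsto_of_tendsto_of_tendsto_of_le_of_le tendsto_const_nhds
      (hl2 j (ENNReal.ofReal ε) (by simpa)) (fun _ => zero_le) fun m => measure_mono ?_
    intro ω (hω : ε ≤ |_|)
    rw [abs_of_nonneg ENNReal.toReal_nonneg] at hω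
    exact ENNReal.ofReal_le_of_le_toReal hω
  refine h1.of_le_off hE (Eventually.of_forall fun m => Eventually.of_forall fun ω hω => ?_)
  have hm := hmem m ω hω
  have hsub := hm.sub hg2
  rw [foldMean, ← integral_sub (hm.integrable (by norm_num)) (hg2.integrable (by norm_num)),
    abs_of_nonneg (a := ENNReal.toReal _) ENNReal.toReal_nonneg]
  have h3 := eLpNorm_le_eLpNorm_of_exponent_le (p := 1) (q := 2) (by norm_num) hsub.1
  refine le_trans ?_ (ENNReal.toReal_mono hsub.2.ne h3)
  rw [← Real.norm_eq_abs, eLpNorm_one_eq_lintegral_enorm, ← integral_norm_eq_lintegral_enorm hsub.1]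
  exact norm_integral_le_integral_norm _

/-- The sum over a fold of the fitted function, minus the sum of its limit, is governed by the
difference of the means: this is where sample splitting replaces empirical process conditions. -/
theorem littleOP_foldSum_sub (hD : IsSplitSample μ P D s) (j : Fin J) :
    LittleOP μ (fun m ω => (foldSum k D s j m ω - foldSum (fun _ _ _ _ => g) D s j m ω
      - m * (foldMean k P D s j m ω - ∫ o, g o ∂P)) / √(m : ℝ)) := by
  obtain ⟨E, hE, hmem⟩ := exists_event_memLp hk hg hg2 hl2 j
  have h := littleOP_foldDev (P := P) (fun m σ j u o => k m σ j u o - g o) hD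
    (fun m σ j => (hk m σ j).sub (hg.comp measurable_snd)) j (hl2 j)
  refine h.of_le_off hE (Eventually.of_forall fun m => Eventually.of_forall fun ω hω => ?_)
  have hm := hmem m ω hω
  refine le_of_eq ?_
  congr 2
  simp only [foldDev, foldSum, foldMean, Finset.sum_sub_distrib]
  rw [integral_sub (hm.integrable (by norm_num)) (hg2.integrable (by norm_num))]

variable (hJ : 0 < J)
  (hκ : LittleOP μ (fun m ω => √((J * m : ℕ) : ℝ) * ∑ j, foldMean k P D s j m ω))

include hJ hκ

/-- The limiting function is centred, because the cross-fitted means vanish in the limit. -/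
theorem integral_limit_eq_zero : ∫ o, g o ∂P = 0 := by
  have h1 : LittleOP μ (fun m ω => ∑ j : Fin J, foldMean k P D s j m ω) := by
    refine hκ.of_le ?_
    filter_upwards [eventually_gt_atTop 0] with m hm ω
    rw [abs_mul, abs_of_nonneg (Real.sqrt_nonneg _)]
    refine le_mul_of_one_le_left (abs_nonneg _) (Real.one_le_sqrt.2 ?_)
    exact_mod_cast Nat.mul_pos hJ hm
  have h2 := LittleOP.sum Finset.univ fun j _ => littleOP_foldMean_sub hk hg hg2 hl2 j
  have h3 := h1.add (h2.const_mul (-1))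
  simp only [Finset.sum_sub_distrib, Finset.sum_const, Finset.card_univ, Fintype.card_fin,
    nsmul_eq_mul] at h3
  have h4 : LittleOP μ (fun _ _ => (J : ℝ) * ∫ o, g o ∂P) := by
    refine h3.of_le (Eventually.of_forall fun m ω => le_of_eq ?_)
    congr 1
    ring
  have h5 := h4.eq_zero_of_const
  have : (J : ℝ) ≠ 0 := by positivity
  simpa [this] using h5

theorem littleOP_foldSum_div (hD : IsSplitSample μ P D s) (j : Fin J) :
    LittleOP μ (fun m ω => foldSum k D s j m ω / m) := by
  have h0 := integral_limit_eq_zero hk hg hg2 hl2 hJ hκ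
  have h1 := littleOP_foldSum_sub hk hg hg2 hl2 hD j
  have h2 := bigOP_foldDev_const hD hg hg2 j
  have h3 := littleOP_foldMean_sub hk hg hg2 hl2 j
  have h4 := (h1.bigOP.add h2).mul_littleOP (littleOP_of_tendsto tendsto_inv_sqrt_natCast)
  refine (h4.add h3).of_le ?_
  filter_upwards [eventually_gt_atTop 0] with m hm ω
  refine le_of_eq ?_
  congr 1
  have hm' : (0 : ℝ) < m := by exact_mod_cast hm
  have hs : √(m : ℝ) * √(m : ℝ) = m := Real.mul_self_sqrt hm'.le
  have hg0 : foldMean (fun _ _ _ _ => g) P D s j m ω = 0 := h0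
  simp only [foldDev, hg0, h0, ← add_div]
  rw [← div_eq_mul_inv, div_div, hs]
  field_simp
  ring

/-- The cross-fitted average is asymptotically linear with influence function `g`. -/
theorem littleOP_sum_foldSum_sub (hD : IsSplitSample μ P D s) :
    LittleOP μ (fun m ω => (√((J * m : ℕ) : ℝ))⁻¹ * ∑ j, foldSum k D s j m ω
      - (√((J * m : ℕ) : ℝ))⁻¹ * ∑ i ∈ Finset.range (J * m), g (D i ω)) := by
  have h0 := integral_limit_eq_zero hk hg hg2 hl2 hJ hκ
  have h1 := LittleOP.sum Finset.univ fun j _ => littleOP_foldSum_sub hk hg hg2 hl2 hD j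
  refine ((h1.const_mul (√(J : ℝ))⁻¹).add (hκ.const_mul (J : ℝ)⁻¹)).of_le ?_
  filter_upwards [eventually_gt_atTop 0] with m hm ω
  refine le_of_eq ?_
  congr 1
  have hm' : (0 : ℝ) < m := by exact_mod_cast hm
  have hJ' : (0 : ℝ) < J := by exact_mod_cast hJ
  have hsum : ∑ i ∈ Finset.range (J * m), g (D i ω)
      = ∑ j, foldSum (fun _ _ _ _ => g) D s j m ω := by
    simp only [foldSum]
    rw [Finset.sum_fiberwise]
    exact (Fin.sum_univ_eq_sum_range (fun i => g (D i ω)) (J * m)).symm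
  rw [hsum, h0]
  simp only [sub_zero, ← Finset.sum_div, Finset.sum_sub_distrib, ← Finset.mul_sum]
  push_cast
  rw [Real.sqrt_mul hJ'.le]
  set a := √(J : ℝ) with ha
  set b := √(m : ℝ) with hb
  have ha' : 0 < a := Real.sqrt_pos.2 hJ'
  have hb' : 0 < b := Real.sqrt_pos.2 hm'
  have hJa : (J : ℝ) = a ^ 2 := (Real.sq_sqrt hJ'.le).symm
  have hmb : (m : ℝ) = b ^ 2 := (Real.sq_sqrt hm'.le).symm
  rw [hJa, hmb]
  field_simp
  ring

end Averages

/-- The central limit theorem along the sample sizes `J m`. -/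
theorem tendstoInDistribution_sum_range (hD : IsSplitSample μ P D s) (hJ : 0 < J)
    {g : Obs p → ℝ} (hg : Measurable g) (hg2 : MemLp g 2 P) (h0 : ∫ o, g o ∂P = 0) :
    TendstoInDistribution (fun m ω => (√((J * m : ℕ) : ℝ))⁻¹ *
      ∑ i ∈ Finset.range (J * m), g (D i ω)) atTop (id : ℝ → ℝ) (fun _ => μ)
      (gaussianReal 0 Var[g; P].toNNReal) := by
  have hlaw (i) : HasLaw (fun ω => D i ω) P μ := hD.law i
  have hmp (i) : MeasurePreserving (D i) μ P := ⟨hD.measurable_data i, (hD.law i).map_eq⟩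
  have hE : ∫ ω, g (D 0 ω) ∂μ = 0 := by
    rw [← h0, ← (hmp 0).map_eq, integral_map (hmp 0).measurable.aemeasurable]
    exact hg.aestronglyMeasurable
  have hV : Var[fun ω => g (D 0 ω); μ] = Var[g; P] := by
    rw [← (hmp 0).map_eq, variance_map hg.aemeasurable (hmp 0).measurable.aemeasurable]
    rfl
  have h := tendstoInDistribution_inv_sqrt_mul_sum_sub (X := fun i ω => g (D i ω)) (P := μ)
    (Y := (id : ℝ → ℝ)) (P' := gaussianReal 0 Var[g; P].toNNReal)
    (by rw [hV]; exact HasLaw.id) (hg2.comp_measurePreserving (hmp 0))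
    (hD.indep.comp (fun _ => g) fun _ => hg)
    (fun i => by
      refine IdentDistrib.comp (u := g) ⟨?_, ?_, ?_⟩ hg
      · exact (hmp i).measurable.aemeasurable
      · exact (hmp 0).measurable.aemeasurable
      · rw [(hmp i).map_eq, (hmp 0).map_eq])
  have h2 : Tendsto (fun m => J * m) atTop atTop :=
    tendsto_id.const_mul_atTop' hJ
  rw [hE] at h
  simp only [mul_zero, sub_zero] at h
  exact ⟨fun m => h.forall_aemeasurable (J * m), h.aemeasurable_limit, h.tendsto.comp h2⟩

end CrossFitted

/-! ### Asymptotic normality of the cross-fitted estimators -/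

section Measurability

variable {p : ℕ}

theorem measurable_cov : Measurable (cov : Obs p → _) := measurable_fst
theorem measurable_resp : Measurable (resp : Obs p → _) := measurable_fst.comp measurable_snd
theorem measurable_pre : Measurable (pre : Obs p → _) :=
  measurable_fst.comp (measurable_snd.comp measurable_snd)
theorem measurable_trt : Measurable (trt : Obs p → _) :=
  measurable_fst.comp (measurable_snd.comp (measurable_snd.comp measurable_snd))
theorem measurable_post : Measurable (post : Obs p → _) :=
  measurable_snd.comp (measurable_snd.comp (measurable_snd.comp measurable_snd))
theorem measurable_ind_trt : Measurable fun o : Obs p => ind (trt o) :=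
  measurable_ind.comp measurable_trt
theorem measurable_ind_resp : Measurable fun o : Obs p => ind (resp o) :=
  measurable_ind.comp measurable_resp

theorem ind_nonneg (b : Bool) : 0 ≤ ind b := by cases b <;> simp [ind]
theorem ind_le_one (b : Bool) : ind b ≤ 1 := by cases b <;> simp [ind]

theorem measurable_moment (r : Regime) {T : Type} [MeasurableSpace T] (H : T → (r.scheme p).N)
    (hH : (r.scheme p).MeasFamily H) :
    Measurable fun q : T × Obs p => (r.scheme p).moment (H q.1) q.2 := by
  have hX : Measurable fun q : T × Obs p => cov q.2 := measurable_cov.comp measurable_snd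
  have hY : Measurable fun q : T × Obs p => post q.2 := measurable_post.comp measurable_snd
  have hY0 : Measurable fun q : T × Obs p => pre q.2 := measurable_pre.comp measurable_snd
  have hA : Measurable fun q : T × Obs p => ind (trt q.2) :=
    measurable_ind_trt.comp measurable_snd
  have hR : Measurable fun q : T × Obs p => ind (resp q.2) :=
    measurable_ind_resp.comp measurable_snd
  cases r with
  | outcomeIndependent =>
    obtain ⟨h0, h1, hpi, hg⟩ := hH
    have h0' (a : Bool) : Measurable fun q : T × Obs p => (H q.1).mu0 (cov q.2) a :=
      h0.comp (measurable_fst.prodMk (hX.prodMk measurable_const))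
    have hg' (a : Bool) : Measurable fun q : T × Obs p => (H q.1).gamma (cov q.2) a :=
      hg.comp (measurable_fst.prodMk (hX.prodMk measurable_const))
    have h1' : Measurable fun q : T × Obs p => (H q.1).mu1 (cov q.2) :=
      h1.comp (measurable_fst.prodMk hX)
    have hpi' : Measurable fun q : T × Obs p => (H q.1).pi (cov q.2) :=
      hpi.comp (measurable_fst.prodMk hX)
    exact (hA.mul (((hY.sub ((h0' true).add ((hR.div (hg' true)).mul (hY0.sub (h0' true))))).sub
      h1').add (h0' false))).sub
      ((((measurable_const.sub hA).mul hpi').div (measurable_const.sub hpi')).mul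
        ((hY.sub ((hR.div (hg' false)).mul (hY0.sub (h0' false)))).sub h1'))
  | outcomeDependent =>
    obtain ⟨h0, h1, hpi, hg, he⟩ := hH
    have h0' (a : Bool) : Measurable fun q : T × Obs p => (H q.1).mu0 (cov q.2) (post q.2) a :=
      h0.comp (measurable_fst.prodMk (hX.prodMk (hY.prodMk measurable_const)))
    have hg' (a : Bool) : Measurable fun q : T × Obs p => (H q.1).gamma (cov q.2) (post q.2) a :=
      hg.comp (measurable_fst.prodMk (hX.prodMk (hY.prodMk measurable_const)))
    have h1' : Measurable fun q : T × Obs p => (H q.1).mu1 (cov q.2) :=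
      h1.comp (measurable_fst.prodMk hX)
    have he' : Measurable fun q : T × Obs p => (H q.1).eta (cov q.2) :=
      he.comp (measurable_fst.prodMk hX)
    have hpi' : Measurable fun q : T × Obs p => (H q.1).pi (cov q.2) :=
      hpi.comp (measurable_fst.prodMk hX)
    exact (hA.mul (((hY.sub ((h0' true).add ((hR.div (hg' true)).mul (hY0.sub (h0' true))))).sub
      h1').add he')).sub
      ((((measurable_const.sub hA).mul hpi').div (measurable_const.sub hpi')).mul
        (((hY.sub ((h0' false).add ((hR.div (hg' false)).mul (hY0.sub (h0' false))))).sub h1').add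
          he'))

end Measurability

section Normality

variable {r : Regime} {p : ℕ} {Ω : Type*} [MeasurableSpace Ω] {μ : Measure Ω}
  [IsProbabilityMeasure μ] {P : Measure (Obs p)} [IsProbabilityMeasure P] {J : ℕ}
  {D : ℕ → Ω → Obs p} {s : (m : ℕ) → Ω → Fin (J * m) → Fin J}
  {L : Learner (r.scheme p) J} {hbar : (r.scheme p).N} {ξ θ : ℝ}

/-- The influence function fitted outside a fold, at the true parameter. -/
def fittedPhi (P : Measure (Obs p)) (θ : ℝ) (L : Learner (r.scheme p) J) (m : ℕ)
    (σ : Fin (J * m) → Fin J) (j : Fin J) (u : {i // σ i ≠ j} → Obs p) (o : Obs p) : ℝ :=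
  (r.scheme p).phi P θ (L m σ j u) o

/-- The normalized treated fraction `∑ A / (m E[A])` of fold `j`. -/
def treatedRatio (P : Measure (Obs p)) (D : ℕ → Ω → Obs p)
    (s : (m : ℕ) → Ω → Fin (J * m) → Fin J) (j : Fin J) (m : ℕ) (ω : Ω) : ℝ :=
  foldSum (fun _ _ _ _ o => ind (trt o) / meanTrt P) D s j m ω / m

theorem sqrt_mul_treatedRatio_sub (hP : 0 < meanTrt P) (hD : IsSplitSample μ P D s) (j : Fin J) :
    BigOP μ (fun m ω => √(m : ℝ) * (treatedRatio P D s j m ω - 1)) := by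
  have hmeas : Measurable fun o : Obs p => ind (trt o) / meanTrt P :=
    measurable_ind_trt.div_const _
  have hmem : MemLp (fun o : Obs p => ind (trt o) / meanTrt P) 2 P := by
    refine MemLp.of_bound hmeas.aestronglyMeasurable (1 / meanTrt P) (Eventually.of_forall ?_)
    intro o
    rw [Real.norm_of_nonneg (div_nonneg (ind_nonneg _) hP.le)]
    gcongr
    exact ind_le_one _
  have h := bigOP_foldDev_const hD hmeas hmem j
  have hint : ∫ o, ind (trt o) / meanTrt P ∂P = 1 := by
    rw [integral_div]
    exact div_self hP.ne'
  intro δ hδ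
  obtain ⟨K, hK, hm⟩ := h δ hδ
  refine ⟨K, hK, ?_⟩
  filter_upwards [hm, eventually_gt_atTop 0] with m hm hm0
  convert hm using 6 with ω
  have hm' : (0 : ℝ) < m := by exact_mod_cast hm0
  have hs : √(m : ℝ) * √(m : ℝ) = m := Real.mul_self_sqrt hm'.le
  have hs0 : 0 < √(m : ℝ) := Real.sqrt_pos.2 hm'
  simp only [treatedRatio, foldDev, foldMean, hint]
  rw [eq_div_iff hs0.ne', mul_right_comm, hs]
  field_simp

theorem littleOP_treatedRatio_sub (hP : 0 < meanTrt P) (hD : IsSplitSample μ P D s) (j : Fin J) :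
    LittleOP μ (fun m ω => treatedRatio P D s j m ω - 1) := by
  refine ((sqrt_mul_treatedRatio_sub hP hD j).mul_littleOP
    (littleOP_of_tendsto tendsto_inv_sqrt_natCast)).of_le ?_
  filter_upwards [eventually_gt_atTop 0] with m hm ω
  have hs0 : 0 < √(m : ℝ) := Real.sqrt_pos.2 (by exact_mod_cast hm)
  refine le_of_eq ?_
  congr 1
  field_simp

theorem measurable_fittedPhi (hinf : InferenceAssumptions μ (r.scheme p) P θ D s L hbar ξ)
    (m : ℕ) (σ : Fin (J * m) → Fin J) (j : Fin J) :
    Measurable (Function.uncurry (fittedPhi P θ L m σ j)) := by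
  have h := measurable_moment r (L m σ j) (hinf.measurable_learner m σ j)
  exact (h.div_const _).sub
    (((measurable_ind_trt.comp measurable_snd).div_const _).mul_const _)

/-- A square integrable, measurable version `g` of the limiting influence function. -/
theorem exists_limit_version (hinf : InferenceAssumptions μ (r.scheme p) P θ D s L hbar ξ) :
    ∃ g : Obs p → ℝ, Measurable g ∧ MemLp g 2 P ∧ (r.scheme p).phi P θ hbar =ᵐ[P] g ∧
      ∀ j, ∀ ε : ℝ≥0∞, 0 < ε → Tendsto (fun m => μ {ω | ε ≤
        eLpNorm (fun o => fittedPhi P θ L m (s m ω) j (fun i => sample D (J * m) ω i) o - g o)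
          2 P}) atTop (𝓝 0) := by
  have h := hinf.memLp_limit
  refine ⟨h.1.mk _, h.1.stronglyMeasurable_mk.measurable, (memLp_congr_ae h.1.ae_eq_mk).1 h,
    h.1.ae_eq_mk, fun j ε hε => ?_⟩
  refine (hinf.l2_convergence j ε hε).congr fun m => ?_
  congr 1
  ext ω
  have : eLpNorm (fun o => (r.scheme p).phi P θ (L.fit m (s m ω) (sample D (J * m) ω) j) o
      - (r.scheme p).phi P θ hbar o) 2 P
      = eLpNorm (fun o => fittedPhi P θ L m (s m ω) j (fun i => sample D (J * m) ω i) o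
        - h.1.mk _ o) 2 P := by
    refine eLpNorm_congr_ae ?_
    filter_upwards [h.1.ae_eq_mk] with o ho
    rw [← ho]
    rfl
  simp only [Set.mem_ofPred_eq, this]

/-- The von Mises remainder is the mean, at the true parameter, of the fitted influence function,
whatever the value of the plug-in estimate. -/
theorem remainder_eq (hP : 0 < meanTrt P) {m : ℕ} {σ : Fin (J * m) → Fin J}
    {d : Fin (J * m) → Obs p} {j : Fin J}
    (hint : Integrable (fittedPhi P θ L m σ j (fun i => d i)) P) :
    L.remainder P θ m σ d j = ∫ o, fittedPhi P θ L m σ j (fun i => d i) o ∂P := by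
  set t := L.plugIn m σ d j with ht
  have hA : Integrable (fun o : Obs p => ind (trt o) / meanTrt P) P := by
    refine Integrable.of_bound (measurable_ind_trt.div_const _).aestronglyMeasurable
      (1 / meanTrt P) (Eventually.of_forall fun o => ?_)
    rw [Real.norm_of_nonneg (div_nonneg (ind_nonneg _) hP.le)]
    gcongr
    exact ind_le_one _
  have hA1 : ∫ o, ind (trt o) / meanTrt P ∂P = 1 := by
    rw [integral_div]
    exact div_self hP.ne'
  have h1 : (fun o => (r.scheme p).phi P t (L.fit m σ d j) o)
      = fun o => fittedPhi P θ L m σ j (fun i => d i) o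
        - ind (trt o) / meanTrt P * (t - θ) := by
    ext o
    simp only [fittedPhi, Scheme.phi, Learner.fit]
    ring
  rw [Learner.remainder, ← ht, h1, integral_sub hint (hA.mul_const _), integral_mul_const, hA1]
  ring

/-- The remainder condition, as a statement on the means of the fitted influence functions. -/
theorem littleOP_sum_foldMean (hP : 0 < meanTrt P)
    (hinf : InferenceAssumptions μ (r.scheme p) P θ D s L hbar ξ) :
    LittleOP μ (fun m ω => √((J * m : ℕ) : ℝ) * ∑ j, foldMean (fittedPhi P θ L) P D s j m ω) := by
  obtain ⟨g, hg, hg2, -, hl2⟩ := exists_limit_version hinf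
  choose E hE hmem using exists_event_memLp (measurable_fittedPhi hinf) hg hg2 hl2
  have h := littleOP_iff_tendstoInMeasure.2 hinf.remainder_small
  refine h.of_le_off (E := fun m => ⋃ j ∈ Finset.univ, E j m) ?_ ?_
  · have := tendsto_finsetSum Finset.univ fun j _ => hE j
    rw [Finset.sum_const_zero] at this
    exact tendsto_of_tendsto_of_tendsto_of_le_of_le tendsto_const_nhds this (fun _ => zero_le)
      fun m => measure_biUnion_finset_le _ _
  · refine Eventually.of_forall fun m => Eventually.of_forall fun ω hω => le_of_eq ?_
    simp only [Finset.mem_univ, Set.iUnion_true, Set.mem_iUnion, not_exists] at hω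
    congr 2
    refine Finset.sum_congr rfl fun j _ => ?_
    exact (remainder_eq hP ((hmem j m ω (hω j)).integrable (by norm_num))).symm

theorem measurable_comp_split_sample (hD : IsSplitSample μ P D s) (m : ℕ)
    {T : (Fin (J * m) → Fin J) → (Fin (J * m) → Obs p) → ℝ} (hT : ∀ σ, Measurable (T σ)) :
    Measurable fun ω => T (s m ω) (sample D (J * m) ω) := by
  have h : Measurable (Function.uncurry T) := measurable_from_prod_countable_right hT
  exact h.comp ((hD.measurable_split m).prodMk (measurable_sample hD _))

theorem measurable_foldEst (hinf : InferenceAssumptions μ (r.scheme p) P θ D s L hbar ξ) (m : ℕ)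
    (σ : Fin (J * m) → Fin J) (j : Fin J) :
    Measurable fun d : Fin (J * m) → Obs p => L.foldEst m σ d j := by
  have h0 := measurable_moment r (L m σ j) (hinf.measurable_learner m σ j)
  have hr : Measurable fun (d : Fin (J * m) → Obs p) (i : {i // σ i ≠ j}) => d i :=
    measurable_pi_lambda _ fun i => measurable_pi_apply _
  have h1 (i : Fin (J * m)) : Measurable fun d : Fin (J * m) → Obs p =>
      (r.scheme p).moment (L.fit m σ d j) (d i) :=
    h0.comp (hr.prodMk (measurable_pi_apply i))
  have h2 (i : Fin (J * m)) : Measurable fun d : Fin (J * m) → Obs p => ind (trt (d i)) :=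
    measurable_ind_trt.comp (measurable_pi_apply i)
  exact (Finset.measurable_sum _ fun i _ => h1 i).div (Finset.measurable_sum _ fun i _ => h2 i)

theorem measurable_avgEst (hD : IsSplitSample μ P D s)
    (hinf : InferenceAssumptions μ (r.scheme p) P θ D s L hbar ξ) (m : ℕ) :
    Measurable fun ω => L.avgEst m (s m ω) (sample D (J * m) ω) := by
  refine measurable_comp_split_sample (T := L.avgEst m) hD m fun σ => ?_
  exact (Finset.measurable_sum _ fun j _ => measurable_foldEst hinf m σ j).const_mul _

variable (hJ : 0 < J) (hP : 0 < meanTrt P) (hD : IsSplitSample μ P D s)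
  (hinf : InferenceAssumptions μ (r.scheme p) P θ D s L hbar ξ)

include hJ hP hD hinf

/-- An estimator that is asymptotically equivalent to the cross-fitted average of the influence
functions is asymptotically normal. -/
theorem asympNormal_of_littleOP_sub {est : ℕ → Ω → ℝ} (hest : ∀ m, AEMeasurable (est m) μ)
    (h : LittleOP μ (fun m ω => √((J * m : ℕ) : ℝ) * (est m ω - θ)
      - (√((J * m : ℕ) : ℝ))⁻¹ * ∑ j, foldSum (fittedPhi P θ L) D s j m ω)) :
    AsympNormal μ J est θ Var[(r.scheme p).phi P θ hbar; P] := by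
  obtain ⟨g, hg, hg2, hgae, hl2⟩ := exists_limit_version hinf
  have hk := measurable_fittedPhi hinf
  have hκ := littleOP_sum_foldMean hP hinf
  have h0 := integral_limit_eq_zero hk hg hg2 hl2 hJ hκ
  have h1 := littleOP_sum_foldSum_sub hk hg hg2 hl2 hJ hκ hD
  have h2 := tendstoInDistribution_sum_range hD hJ hg hg2 h0
  rw [AsympNormal, variance_congr hgae]
  refine tendstoInDistribution_of_tendstoInMeasure_sub _ _ h2 ?_ fun m => ?_
  · refine littleOP_iff_tendstoInMeasure.1 ((h.add h1).of_le
      (Eventually.of_forall fun m => fun ω => le_of_eq ?_))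
    simp only [Pi.sub_apply]
    congr 1
    ring
  · exact ((hest m).sub_const _).const_mul _

theorem littleOP_foldSum_fittedPhi_div (j : Fin J) :
    LittleOP μ (fun m ω => foldSum (fittedPhi P θ L) D s j m ω / m) := by
  obtain ⟨g, hg, hg2, hgae, hl2⟩ := exists_limit_version hinf
  exact littleOP_foldSum_div (measurable_fittedPhi hinf) hg hg2 hl2 hJ
    (littleOP_sum_foldMean hP hinf) hD j

/-- Asymptotic normality of the solutions of the estimating equation, which is linear in the
parameter with the treated fraction as slope. -/
theorem asympNormal_root {est : ℕ → Ω → ℝ} (hest : ∀ m, AEMeasurable (est m) μ)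
    (hroot : Tendsto (fun m => μ {ω | ¬ L.EstEq P m (s m ω) (sample D (J * m) ω) (est m ω)})
      atTop (𝓝 0)) :
    AsympNormal μ J est θ Var[(r.scheme p).phi P θ hbar; P] := by
  refine asympNormal_of_littleOP_sub hJ hP hD hinf hest ?_
  have hJ' : (0 : ℝ) < J := by exact_mod_cast hJ
  -- the treated fraction of the whole sample, relative to `E[A]`
  let B : ℕ → Ω → ℝ := fun m ω => (J : ℝ)⁻¹ * ∑ j, treatedRatio P D s j m ω
  have hBeq : ∀ m ω, B m ω - 1 = (J : ℝ)⁻¹ * ∑ j, (treatedRatio P D s j m ω - 1) := by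
    intro m ω
    simp only [B, Finset.sum_sub_distrib, Finset.sum_const, Finset.card_univ, Fintype.card_fin,
      nsmul_eq_mul, mul_one, mul_sub]
    rw [inv_mul_cancel₀ hJ'.ne']
  have hB1 : LittleOP μ (fun m ω => B m ω - 1) := by
    simp only [hBeq]
    exact (LittleOP.sum _ fun j _ => littleOP_treatedRatio_sub hP hD j).const_mul _
  have hB2 : BigOP μ (fun m ω => √(m : ℝ) * (B m ω - 1)) := by
    have := (BigOP.const (μ := μ) (J : ℝ)⁻¹).mul (BigOP.sum Finset.univ fun j _ =>
      sqrt_mul_treatedRatio_sub hP hD j)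
    simp only [hBeq]
    convert this using 3
    rw [← Finset.mul_sum]
    ring
  have hS := (LittleOP.sum Finset.univ fun j _ =>
    littleOP_foldSum_fittedPhi_div hJ hP hD hinf j).const_mul ((√(J : ℝ))⁻¹)
  have hprod := (hB2.mul hB1.bigOP_inv).mul_littleOP hS
  refine hprod.of_le_off (E := fun m => {ω | ¬ L.EstEq P m (s m ω) (sample D (J * m) ω) (est m ω)} ∪
    {ω | 1 ≤ |B m ω - 1|}) ?_ ?_
  · have := hroot.add (hB1 1 one_pos)
    rw [add_zero] at this
    exact tendsto_of_tendsto_of_tendsto_of_le_of_le tendsto_const_nhds this (fun _ => zero_le)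
      fun m => measure_union_le _ _
  · filter_upwards [eventually_gt_atTop 0] with m hm
    refine Eventually.of_forall fun ω hω => le_of_eq ?_
    simp only [Set.mem_union, Set.mem_ofPred_eq, not_or, not_not, not_le] at hω
    obtain ⟨heq, hB⟩ := hω
    have hB0 : B m ω ≠ 0 := by
      intro h0
      rw [h0] at hB
      norm_num at hB
    have hm' : (0 : ℝ) < m := by exact_mod_cast hm
    -- the estimating equation is linear in the parameter
    have hlin : ∑ j, foldSum (fittedPhi P θ L) D s j m ω = (est m ω - θ) * (J * m * B m ω) := by
      have h1 : (J : ℝ) * m * B m ω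
          = ∑ j, foldSum (fun _ _ _ _ o => ind (trt o) / meanTrt P) D s j m ω := by
        simp only [B, treatedRatio, ← Finset.sum_div]
        field_simp
      rw [h1, ← sub_eq_zero, Finset.mul_sum, ← Finset.sum_sub_distrib, ← heq]
      refine Finset.sum_congr rfl fun j _ => ?_
      simp only [foldSum, Finset.mul_sum]
      rw [← Finset.sum_sub_distrib]
      refine Finset.sum_congr rfl fun i _ => ?_
      simp only [fittedPhi, Scheme.phi, Learner.fit]
      ring
    rw [← Finset.sum_div, hlin, ← abs_neg]
    congr 1
    push_cast
    rw [Real.sqrt_mul hJ'.le]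
    set a := √(J : ℝ)
    set b := √(m : ℝ)
    have ha' : 0 < a := Real.sqrt_pos.2 hJ'
    have hb' : 0 < b := Real.sqrt_pos.2 hm'
    have hJa : (J : ℝ) = a ^ 2 := (Real.sq_sqrt hJ'.le).symm
    have hmb : (m : ℝ) = b ^ 2 := (Real.sq_sqrt hm'.le).symm
    rw [hJa, hmb]
    field_simp
    ring

theorem asympNormal_avgEst :
    AsympNormal μ J (fun m ω => L.avgEst m (s m ω) (sample D (J * m) ω)) θ
      Var[(r.scheme p).phi P θ hbar; P] := by
  refine asympNormal_of_littleOP_sub hJ hP hD hinf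
    (fun m => (measurable_avgEst hD hinf m).aemeasurable) ?_
  have hJ' : (0 : ℝ) < J := by exact_mod_cast hJ
  have hB1 (j) := littleOP_treatedRatio_sub hP hD j
  have hterm (j : Fin J) := ((sqrt_mul_treatedRatio_sub hP hD j).mul
    (hB1 j).bigOP_inv).mul_littleOP (littleOP_foldSum_fittedPhi_div hJ hP hD hinf j)
  have hsum := (LittleOP.sum Finset.univ fun j _ => hterm j).const_mul ((√(J : ℝ))⁻¹)
  refine hsum.of_le_off (E := fun m => ⋃ j ∈ Finset.univ,
    {ω | 1 ≤ |treatedRatio P D s j m ω - 1|}) ?_ ?_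
  · have := tendsto_finsetSum Finset.univ fun j _ => hB1 j 1 one_pos
    rw [Finset.sum_const_zero] at this
    exact tendsto_of_tendsto_of_tendsto_of_le_of_le tendsto_const_nhds this (fun _ => zero_le)
      fun m => measure_biUnion_finset_le _ _
  · filter_upwards [eventually_gt_atTop 0] with m hm
    refine Eventually.of_forall fun ω hω => le_of_eq ?_
    simp only [Finset.mem_univ, Set.iUnion_true, Set.mem_iUnion, not_exists, Set.mem_ofPred_eq,
      not_le] at hω
    have hm' : (0 : ℝ) < m := by exact_mod_cast hm
    have hB0 (j) : treatedRatio P D s j m ω ≠ 0 := by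
      intro h0
      have := hω j
      rw [h0] at this
      norm_num at this
    have hfold (j : Fin J) : L.foldEst m (s m ω) (sample D (J * m) ω) j - θ
        = foldSum (fittedPhi P θ L) D s j m ω / m * (treatedRatio P D s j m ω)⁻¹ := by
      have hA : foldSum (fun _ _ _ _ o => ind (trt o) / meanTrt P) D s j m ω
          = (∑ i with s m ω i = j, ind (trt (sample D (J * m) ω i))) / meanTrt P := by
        simp only [foldSum, Finset.sum_div]
      have hA0 : ∑ i with s m ω i = j, ind (trt (sample D (J * m) ω i)) ≠ 0 := by
        intro h0
        apply hB0 j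
        rw [treatedRatio, hA, h0]
        simp
      have hφ : foldSum (fittedPhi P θ L) D s j m ω
          = ((∑ i with s m ω i = j, (r.scheme p).moment
              (L.fit m (s m ω) (sample D (J * m) ω) j) (sample D (J * m) ω i))
            - θ * ∑ i with s m ω i = j, ind (trt (sample D (J * m) ω i))) / meanTrt P := by
        simp only [foldSum, Finset.mul_sum, ← Finset.sum_sub_distrib, Finset.sum_div]
        refine Finset.sum_congr rfl fun i _ => ?_
        simp only [fittedPhi, Scheme.phi, Learner.fit]
        ring
      rw [treatedRatio, hA, hφ, Learner.foldEst]
      field_simp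
    have havg : L.avgEst m (s m ω) (sample D (J * m) ω) - θ = (J : ℝ)⁻¹ * ∑ j,
        foldSum (fittedPhi P θ L) D s j m ω / m * (treatedRatio P D s j m ω)⁻¹ := by
      simp only [← hfold, Finset.sum_sub_distrib, Finset.sum_const, Finset.card_univ,
        Fintype.card_fin, nsmul_eq_mul, Learner.avgEst]
      field_simp
    rw [havg, ← abs_neg]
    congr 1
    push_cast
    rw [Real.sqrt_mul hJ'.le, Finset.mul_sum, Finset.mul_sum, Finset.mul_sum, Finset.mul_sum,
      ← Finset.sum_sub_distrib, ← Finset.sum_neg_distrib]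
    refine Finset.sum_congr rfl fun j _ => ?_
    have hBj := hB0 j
    set a := √(J : ℝ)
    set b := √(m : ℝ)
    have ha' : 0 < a := Real.sqrt_pos.2 hJ'
    have hb' : 0 < b := Real.sqrt_pos.2 hm'
    have hJa : (J : ℝ) = a ^ 2 := (Real.sq_sqrt hJ'.le).symm
    have hmb : (m : ℝ) = b ^ 2 := (Real.sq_sqrt hm'.le).symm
    rw [hJa, hmb]
    field_simp
    ring

end Normality

/-! ### Regression functions: orthogonality -/

section CondMean

variable {p : ℕ} {E : Type*} [MeasurableSpace E] {P : Measure (Obs p)}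
  {B : Set (Obs p)} {Z : Obs p → E} {W : Obs p → ℝ} {f : E → ℝ}

theorem measurable_condMean : Measurable (condMean P B Z W) :=
  (StronglyMeasurable.integral_condDistrib (X := Z) (Y := W) (μ := P[|B])
    (f := fun q : E × ℝ => q.2) measurable_snd.stronglyMeasurable).measurable

theorem integral_cond (W : Obs p → ℝ) :
    ∫ o, W o ∂(P[|B]) = (P.real B)⁻¹ * ∫ o in B, W o ∂P := by
  rw [ProbabilityTheory.cond, integral_smul_measure, ENNReal.toReal_inv, smul_eq_mul,
    Measure.real]

variable [IsFiniteMeasure P]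

theorem integrable_cond_iff (h0 : P B ≠ 0) :
    Integrable W (P[|B]) ↔ IntegrableOn W B P := by
  rw [ProbabilityTheory.cond, integrable_smul_measure (ENNReal.inv_ne_zero.2 (measure_ne_top _ _))
    (ENNReal.inv_ne_top.2 h0), IntegrableOn]

/-- The regression function times a function of the regressors is, on the conditioning event, the
conditional expectation of the product. -/
theorem condExp_mul_ae_eq (hZ : Measurable Z) (hf : Measurable f) (h0 : P B ≠ 0)
    (hW : IntegrableOn W B P) (hfW : IntegrableOn (fun o => f (Z o) * W o) B P) :
    (P[|B])[fun o => f (Z o) * W o | MeasurableSpace.comap Z inferInstance]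
      =ᵐ[P[|B]] fun o => f (Z o) * condMean P B Z W (Z o) := by
  have h1 := condExp_ae_eq_integral_condDistrib' hZ ((integrable_cond_iff h0).2 hW)
  have h2 := condExp_mul_of_stronglyMeasurable_left (μ := P[|B])
    (m := MeasurableSpace.comap Z inferInstance)
    (f := fun o => f (Z o)) (g := W)
    (hf.comp (comap_measurable Z)).stronglyMeasurable
    ((integrable_cond_iff h0).2 hfW) ((integrable_cond_iff h0).2 hW)
  filter_upwards [h1, h2] with o h1 h2
  refine h2.trans ?_
  rw [Pi.mul_apply, h1]
  rfl

theorem integrableOn_mul_condMean (hZ : Measurable Z) (hf : Measurable f)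
    (hW : IntegrableOn W B P) (hfW : IntegrableOn (fun o => f (Z o) * W o) B P) :
    IntegrableOn (fun o => f (Z o) * condMean P B Z W (Z o)) B P := by
  by_cases h0 : P B = 0
  · rw [IntegrableOn, Measure.restrict_eq_zero.2 h0]
    exact integrable_zero_measure
  rw [← integrable_cond_iff h0]
  exact integrable_condExp.congr (condExp_mul_ae_eq hZ hf h0 hW hfW)

/-- Orthogonality of the regression residual to functions of the regressors. -/
theorem setIntegral_mul_condMean (hZ : Measurable Z) (hf : Measurable f)
    (hW : IntegrableOn W B P) (hfW : IntegrableOn (fun o => f (Z o) * W o) B P) :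
    ∫ o in B, f (Z o) * condMean P B Z W (Z o) ∂P = ∫ o in B, f (Z o) * W o ∂P := by
  by_cases h0 : P B = 0
  · simp [Measure.restrict_eq_zero.2 h0]
  have h1 := integral_congr_ae (condExp_mul_ae_eq hZ hf h0 hW hfW)
  rw [integral_condExp hZ.comap_le, integral_cond, integral_cond] at h1
  have : (P.real B)⁻¹ ≠ 0 := by
    rw [ne_eq, inv_eq_zero, measureReal_eq_zero_iff]
    exact h0
  exact (mul_left_cancel₀ this h1).symm

end CondMean

/-! ### Submodels -/

section Submodel

variable {p : ℕ} {P : Measure (Obs p)} {g : Obs p → ℝ} {t : ℝ} {B : Set (Obs p)}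

theorem submodel_zero : submodel P g 0 = P := by
  simp [submodel]

theorem IsScore.eventually_small (hg : IsScore P g) : ∀ᶠ t : ℝ in 𝓝 0, ∀ o, |t * g o| ≤ 1 / 2 := by
  obtain ⟨-, ⟨C, hC⟩, -⟩ := hg
  have h : Tendsto (fun t : ℝ => |t| * |C|) (𝓝 0) (𝓝 0) := by
    have : Continuous fun t : ℝ => |t| * |C| := by fun_prop
    simpa using this.tendsto 0
  filter_upwards [h.eventually_le_const (by norm_num : (0 : ℝ) < 1 / 2)] with t ht o
  rw [abs_mul]
  exact (mul_le_mul_of_nonneg_left ((hC o).trans (le_abs_self C)) (abs_nonneg t)).trans ht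

theorem setIntegral_submodel [SFinite P] (hg : Measurable g) (ht : ∀ o, |t * g o| ≤ 1 / 2)
    (B : Set (Obs p)) (F : Obs p → ℝ) :
    ∫ o in B, F o ∂(submodel P g t) = ∫ o in B, (1 + t * g o) * F o ∂P := by
  rw [submodel, restrict_withDensity', integral_withDensity_eq_integral_toReal_smul
    (by fun_prop) (Eventually.of_forall fun _ => ENNReal.ofReal_lt_top)]
  refine integral_congr_ae (Eventually.of_forall fun o => ?_)
  simp only [smul_eq_mul]
  rw [ENNReal.toReal_ofReal]
  linarith [(abs_le.1 (ht o)).1]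

theorem submodel_le_two_smul (ht : ∀ o, |t * g o| ≤ 1 / 2) :
    submodel P g t ≤ (2 : ℝ≥0∞) • P := by
  rw [submodel, ← withDensity_const]
  refine withDensity_mono (Eventually.of_forall fun o => ?_)
  rw [← ENNReal.ofReal_ofNat 2]
  exact ENNReal.ofReal_le_ofReal (by linarith [(abs_le.1 (ht o)).2])

theorem isFiniteMeasure_submodel [IsFiniteMeasure P] (ht : ∀ o, |t * g o| ≤ 1 / 2) :
    IsFiniteMeasure (submodel P g t) :=
  ⟨(submodel_le_two_smul ht Set.univ).trans_lt
    (ENNReal.mul_lt_top ENNReal.ofNat_lt_top (measure_lt_top P _))⟩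

theorem le_two_smul_submodel (hg : Measurable g) (ht : ∀ o, |t * g o| ≤ 1 / 2) :
    P ≤ (2 : ℝ≥0∞) • submodel P g t := by
  rw [submodel, ← withDensity_smul _ (by fun_prop)]
  refine le_trans (le_of_eq withDensity_one.symm) (withDensity_mono (Eventually.of_forall fun o => ?_))
  simp only [Pi.smul_apply, Pi.one_apply, smul_eq_mul]
  rw [← ENNReal.ofReal_ofNat 2, ← ENNReal.ofReal_mul (by norm_num), ← ENNReal.ofReal_one]
  exact ENNReal.ofReal_le_ofReal (by linarith [(abs_le.1 (ht o)).1])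

theorem integrableOn_submodel_iff (hg : Measurable g) (ht : ∀ o, |t * g o| ≤ 1 / 2)
    {F : Obs p → ℝ} : IntegrableOn F B (submodel P g t) ↔ IntegrableOn F B P := by
  constructor
  · intro h
    have h2 := Integrable.smul_measure h (c := 2) (by norm_num)
    refine h2.mono_measure ?_
    rw [← Measure.restrict_smul]
    exact Measure.restrict_mono le_rfl (le_two_smul_submodel hg ht)
  · intro h
    have h2 := Integrable.smul_measure h (c := 2) (by norm_num)
    refine h2.mono_measure ?_
    rw [← Measure.restrict_smul]
    exact Measure.restrict_mono le_rfl (submodel_le_two_smul ht)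

theorem IntegrableOn.score_mul (hgm : Measurable g) {C : ℝ} (hC : ∀ o, |g o| ≤ C)
    {F : Obs p → ℝ} (hF : IntegrableOn F B P) : IntegrableOn (fun o => g o * F o) B P :=
  hF.bdd_mul hgm.aestronglyMeasurable (Eventually.of_forall hC)

theorem setIntegral_submodel_eq_add [SFinite P] (hg : IsScore P g) (ht : ∀ o, |t * g o| ≤ 1 / 2)
    {F : Obs p → ℝ} (hF : IntegrableOn F B P) :
    ∫ o in B, F o ∂(submodel P g t)
      = ∫ o in B, F o ∂P + t * ∫ o in B, g o * F o ∂P := by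
  obtain ⟨hgm, ⟨C, hC⟩, -⟩ := hg
  rw [setIntegral_submodel hgm ht, ← integral_const_mul, ← integral_add hF
    ((IntegrableOn.score_mul hgm hC hF).const_mul t)]
  refine integral_congr_ae (Eventually.of_forall fun o => ?_)
  simp only
  ring

theorem setIntegral_le_two_mul_submodel [SFinite P] (hg : Measurable g)
    (ht : ∀ o, |t * g o| ≤ 1 / 2) {F : Obs p → ℝ} (hF0 : ∀ o, 0 ≤ F o) (hF : IntegrableOn F B P) :
    ∫ o in B, F o ∂P ≤ 2 * ∫ o in B, F o ∂(submodel P g t) := by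
  have h := (integrableOn_submodel_iff hg ht).2 hF
  have h2 := Integrable.smul_measure h (c := 2) (by norm_num)
  have h3 : P.restrict B ≤ (2 : ℝ≥0∞) • (submodel P g t).restrict B := by
    rw [← Measure.restrict_smul]
    exact Measure.restrict_mono le_rfl (le_two_smul_submodel hg ht)
  have h4 := integral_mono_measure h3 (Eventually.of_forall hF0) h2
  rwa [integral_smul_measure, ENNReal.toReal_ofNat, smul_eq_mul] at h4

theorem setIntegral_submodel_le_two_mul (ht : ∀ o, |t * g o| ≤ 1 / 2)
    {F : Obs p → ℝ} (hF0 : ∀ o, 0 ≤ F o) (hF : IntegrableOn F B P) :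
    ∫ o in B, F o ∂(submodel P g t) ≤ 2 * ∫ o in B, F o ∂P := by
  have h2 := Integrable.smul_measure hF (c := 2) (by norm_num)
  have h3 : (submodel P g t).restrict B ≤ (2 : ℝ≥0∞) • P.restrict B := by
    rw [← Measure.restrict_smul]
    exact Measure.restrict_mono le_rfl (submodel_le_two_smul ht)
  have h4 := integral_mono_measure h3 (Eventually.of_forall hF0) h2
  rwa [integral_smul_measure, ENNReal.toReal_ofNat, smul_eq_mul] at h4

end Submodel

/-! ### Pathwise derivatives of regression functionals -/

section Reweighting

variable {α E : Type*} [MeasurableSpace α] [MeasurableSpace E]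

/-- Integrals of functions of `Z` over the event `C`, weighted by `u(Z)`, are integrals over the
event `B`, weighted by `f(Z)`. -/
structure Reweights (P : Measure α) (Z : α → E) (C : Set α) (u : E → ℝ)
    (B : Set α) (f : E → ℝ) : Prop where
  measurable_left : Measurable u
  measurable_right : Measurable f
  nonneg_left : ∀ᵐ o ∂P.restrict C, 0 ≤ u (Z o)
  nonneg_right : ∀ᵐ o ∂P.restrict B, 0 ≤ f (Z o)
  lintegral_eq : ∀ k : E → ℝ≥0∞, Measurable k →
    ∫⁻ o in C, ENNReal.ofReal (u (Z o)) * k (Z o) ∂P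
      = ∫⁻ o in B, ENNReal.ofReal (f (Z o)) * k (Z o) ∂P

variable {P : Measure α} {Z : α → E} {C B : Set α} {u f : E → ℝ}

theorem Reweights.integrableOn_iff (h : Reweights P Z C u B f) (hZ : Measurable Z) {k : E → ℝ}
    (hk : Measurable k) : IntegrableOn (fun o => u (Z o) * k (Z o)) C P ↔
      IntegrableOn (fun o => f (Z o) * k (Z o)) B P := by
  have h1 : ∫⁻ o in C, ‖u (Z o) * k (Z o)‖ₑ ∂P = ∫⁻ o in B, ‖f (Z o) * k (Z o)‖ₑ ∂P := by
    have := h.lintegral_eq (fun z => ‖k z‖ₑ) hk.enorm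
    convert this using 1
    · refine lintegral_congr_ae ?_
      filter_upwards [h.nonneg_left] with o ho
      rw [enorm_mul, Real.enorm_of_nonneg ho]
    · refine lintegral_congr_ae ?_
      filter_upwards [h.nonneg_right] with o ho
      rw [enorm_mul, Real.enorm_of_nonneg ho]
  have m1 : AEStronglyMeasurable (fun o => u (Z o) * k (Z o)) (P.restrict C) :=
    ((h.measurable_left.comp hZ).mul (hk.comp hZ)).aestronglyMeasurable
  have m2 : AEStronglyMeasurable (fun o => f (Z o) * k (Z o)) (P.restrict B) :=
    ((h.measurable_right.comp hZ).mul (hk.comp hZ)).aestronglyMeasurable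
  simp only [IntegrableOn, Integrable, m1, m2, true_and, HasFiniteIntegral, h1]

theorem Reweights.setIntegral_eq (h : Reweights P Z C u B f) (hZ : Measurable Z) {k : E → ℝ}
    (hk : Measurable k) : ∫ o in C, u (Z o) * k (Z o) ∂P = ∫ o in B, f (Z o) * k (Z o) ∂P := by
  by_cases hi : IntegrableOn (fun o => u (Z o) * k (Z o)) C P
  swap
  · rw [integral_undef hi, integral_undef (mt (h.integrableOn_iff hZ hk).2 hi)]
  have hi' := (h.integrableOn_iff hZ hk).1 hi
  rw [integral_eq_lintegral_pos_part_sub_lintegral_neg_part hi,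
    integral_eq_lintegral_pos_part_sub_lintegral_neg_part hi']
  have key (k' : E → ℝ) (hk' : Measurable k') :
      ∫⁻ o in C, ENNReal.ofReal (u (Z o) * k' (Z o)) ∂P
        = ∫⁻ o in B, ENNReal.ofReal (f (Z o) * k' (Z o)) ∂P := by
    have := h.lintegral_eq (fun z => ENNReal.ofReal (k' z)) hk'.ennreal_ofReal
    convert this using 1
    · refine lintegral_congr_ae ?_
      filter_upwards [h.nonneg_left] with o ho
      rw [ENNReal.ofReal_mul ho]
    · refine lintegral_congr_ae ?_
      filter_upwards [h.nonneg_right] with o ho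
      rw [ENNReal.ofReal_mul ho]
  rw [key k hk]
  have := key (fun z => -k z) hk.neg
  simp only [mul_neg] at this
  rw [this]

end Reweighting

section PathwiseDerivative

theorem hasDerivAt_mul_of_tendsto {G : ℝ → ℝ} {d : ℝ} (hG : Tendsto G (𝓝 0) (𝓝 d)) :
    HasDerivAt (fun t => t * G t) d 0 := by
  rw [hasDerivAt_iff_tendsto_slope_zero]
  refine (hG.mono_left nhdsWithin_le_nhds).congr' ?_
  filter_upwards [self_mem_nhdsWithin] with t (ht : t ≠ 0)
  simp [ht]

variable {p : ℕ} {E : Type*} [MeasurableSpace E] {P : Measure (Obs p)} [IsProbabilityMeasure P]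
  {Z : Obs p → E} {C B : Set (Obs p)} {u f : E → ℝ} {g : Obs p → ℝ}

/-- The difference of the regression functions of a submodel and of the law itself, in weighted
`L¹`: tested against its own sign, it is a difference of residuals, which is of order `t`. -/
theorem setIntegral_abs_condMean_sub_le (hZ : Measurable Z) (hf : Measurable f)
    (hg : IsScore P g) {K : ℝ} (hK : ∀ o, |g o| ≤ K) {t : ℝ} (ht : ∀ o, |t * g o| ≤ 1 / 2)
    {W W0 : Obs p → ℝ} (hW : IntegrableOn W B P) (hW0 : IntegrableOn W0 B P)
    (hfW : IntegrableOn (fun o => f (Z o) * W o) B P)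
    (hfW0 : IntegrableOn (fun o => f (Z o) * W0 o) B P) :
    ∫ o in B, |f (Z o) * (condMean (submodel P g t) B Z W (Z o) - condMean P B Z W0 (Z o))| ∂P
      ≤ 4 * ∫ o in B, |f (Z o) * (W o - W0 o)| ∂P
        + |t| * (2 * K * ∫ o in B, |f (Z o) * (W0 o - condMean P B Z W0 (Z o))| ∂P) := by
  have hgm := hg.1
  set Pt := submodel P g t with hPt
  have : IsFiniteMeasure Pt := isFiniteMeasure_submodel ht
  set m := condMean Pt B Z W with hm
  set m0 := condMean P B Z W0 with hm0
  have hmm : Measurable m := measurable_condMean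
  have hmm0 : Measurable m0 := measurable_condMean
  have iff (F : Obs p → ℝ) : IntegrableOn F B Pt ↔ IntegrableOn F B P :=
    integrableOn_submodel_iff hgm ht
  have im : IntegrableOn (fun o => f (Z o) * m (Z o)) B Pt :=
    integrableOn_mul_condMean hZ hf ((iff _).2 hW) ((iff _).2 hfW)
  have im' := (iff _).1 im
  have im0 : IntegrableOn (fun o => f (Z o) * m0 (Z o)) B P :=
    integrableOn_mul_condMean hZ hf hW0 hfW0
  have idiff : IntegrableOn (fun o => f (Z o) * (m (Z o) - m0 (Z o))) B P := by
    simp only [mul_sub]; exact im'.sub im0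
  have idW : IntegrableOn (fun o => f (Z o) * (W o - W0 o)) B P := by
    simp only [mul_sub]; exact hfW.sub hfW0
  have ires : IntegrableOn (fun o => f (Z o) * (W0 o - m0 (Z o))) B P := by
    simp only [mul_sub]; exact hfW0.sub im0
  -- the test function is the weight times the sign of the weighted difference
  let σ : E → ℝ := fun z => if 0 ≤ f z * (m z - m0 z) then 1 else -1
  have hσm : Measurable σ :=
    Measurable.ite (measurableSet_le measurable_const (hf.mul (hmm.sub hmm0)))
      measurable_const measurable_const
  have hσ1 (z) : |σ z| = 1 := by
    simp only [σ]; split_ifs <;> simp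
  have hσabs (z) : |f z * (m z - m0 z)| = σ z * (f z * (m z - m0 z)) := by
    simp only [σ]; split_ifs with h
    · rw [abs_of_nonneg h, one_mul]
    · rw [abs_of_neg (not_le.1 h)]; ring
  have iσ {F : Obs p → ℝ} (hF : IntegrableOn F B P) :
      IntegrableOn (fun o => σ (Z o) * F o) B P :=
    hF.bdd_mul (hσm.comp hZ).aestronglyMeasurable
      (Eventually.of_forall fun o => (le_of_eq (hσ1 (Z o)) : |σ (Z o)| ≤ 1))
  -- orthogonality of residuals under the submodel and under the law itself
  have o1 : ∫ o in B, σ (Z o) * f (Z o) * m (Z o) ∂Pt = ∫ o in B, σ (Z o) * f (Z o) * W o ∂Pt :=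
    setIntegral_mul_condMean hZ (f := fun z => σ z * f z) (hσm.mul hf) ((iff _).2 hW)
      ((iff _).2 (by simpa only [mul_assoc] using iσ hfW))
  have o2 : ∫ o in B, σ (Z o) * f (Z o) * m0 (Z o) ∂P = ∫ o in B, σ (Z o) * f (Z o) * W0 o ∂P :=
    setIntegral_mul_condMean hZ (f := fun z => σ z * f z) (hσm.mul hf) hW0
      (by simpa only [mul_assoc] using iσ hfW0)
  simp only [mul_assoc] at o1 o2
  have e1 : ∫ o in B, |f (Z o) * (m (Z o) - m0 (Z o))| ∂Pt
      = ∫ o in B, σ (Z o) * (f (Z o) * (W o - W0 o)) ∂Pt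
        + ∫ o in B, σ (Z o) * (f (Z o) * (W0 o - m0 (Z o))) ∂Pt := by
    simp only [hσabs]
    simp only [mul_sub]
    rw [integral_sub ((iff _).2 (iσ im')) ((iff _).2 (iσ im0)), o1,
      integral_sub ((iff _).2 (iσ hfW)) ((iff _).2 (iσ hfW0)),
      integral_sub ((iff _).2 (iσ hfW0)) ((iff _).2 (iσ im0))]
    ring
  have e2 : ∫ o in B, σ (Z o) * (f (Z o) * (W0 o - m0 (Z o))) ∂Pt
      = t * ∫ o in B, g o * (σ (Z o) * (f (Z o) * (W0 o - m0 (Z o)))) ∂P := by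
    rw [hPt, setIntegral_submodel_eq_add hg ht (iσ ires)]
    have : ∫ o in B, σ (Z o) * (f (Z o) * (W0 o - m0 (Z o))) ∂P = 0 := by
      simp only [mul_sub]
      rw [integral_sub (iσ hfW0) (iσ im0), o2, sub_self]
    rw [this, zero_add]
  have b1 : ∫ o in B, σ (Z o) * (f (Z o) * (W o - W0 o)) ∂Pt
      ≤ 2 * ∫ o in B, |f (Z o) * (W o - W0 o)| ∂P := by
    refine le_trans ?_ (setIntegral_submodel_le_two_mul ht (fun _ => abs_nonneg _) idW.abs)
    refine integral_mono ((iff _).2 (iσ idW)) ((iff _).2 idW.abs) fun o => ?_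
    refine (le_abs_self _).trans ?_
    rw [abs_mul, hσ1, one_mul]
  have b2 : t * ∫ o in B, g o * (σ (Z o) * (f (Z o) * (W0 o - m0 (Z o)))) ∂P
      ≤ |t| * (K * ∫ o in B, |f (Z o) * (W0 o - m0 (Z o))| ∂P) := by
    refine (le_abs_self _).trans ?_
    rw [abs_mul]
    refine mul_le_mul_of_nonneg_left ?_ (abs_nonneg t)
    rw [← integral_const_mul]
    refine (abs_integral_le_integral_abs).trans ?_
    refine integral_mono (IntegrableOn.score_mul hgm hK (iσ ires)).abs (ires.abs.const_mul K)
      fun o => ?_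
    simp only [abs_mul, hσ1, one_mul]
    exact mul_le_mul_of_nonneg_right (hK o) (by positivity)
  have b3 := setIntegral_le_two_mul_submodel hgm ht (fun _ => abs_nonneg _) idiff.abs
  rw [← hPt, e1, e2] at b3
  linarith

/-- **Pathwise derivative of a regression functional.** Along the submodel with score `g`, let
`m_t` be the regression of `W t` on `Z` in the event `B`, and let `Φ` be the functional
`t ↦ E_t[1_B f(Z) W t]`. The functional `E_t[1_C u(Z) m_t(Z)]` has derivative
`Φ' - E[g 1_B f(Z) m_0(Z)] + E[g 1_C u(Z) m_0(Z)]` at `t = 0`. -/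
theorem hasDerivAt_setIntegral_condMean (hZ : Measurable Z) (hr : Reweights P Z C u B f)
    (hg : IsScore P g) {W : ℝ → Obs p → ℝ} (hW : ∀ᶠ t in 𝓝 0, IntegrableOn (W t) B P)
    (hfW : ∀ᶠ t in 𝓝 0, IntegrableOn (fun o => f (Z o) * W t o) B P)
    (hL1 : Tendsto (fun t => ∫ o in B, |f (Z o) * (W t o - W 0 o)| ∂P) (𝓝 0) (𝓝 0))
    {d : ℝ} (hΦ : HasDerivAt (fun t => ∫ o in B, f (Z o) * W t o ∂(submodel P g t)) d 0) :
    (∀ᶠ t in 𝓝 0, IntegrableOn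
      (fun o => u (Z o) * condMean (submodel P g t) B Z (W t) (Z o)) C P) ∧
    Tendsto (fun t => ∫ o in C, |u (Z o) * (condMean (submodel P g t) B Z (W t) (Z o)
      - condMean P B Z (W 0) (Z o))| ∂P) (𝓝 0) (𝓝 0) ∧
    HasDerivAt (fun t => ∫ o in C, u (Z o) * condMean (submodel P g t) B Z (W t) (Z o)
        ∂(submodel P g t))
      (d - ∫ o in B, g o * (f (Z o) * condMean P B Z (W 0) (Z o)) ∂P
        + ∫ o in C, g o * (u (Z o) * condMean P B Z (W 0) (Z o)) ∂P) 0 := by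
  have hgm := hg.1
  obtain ⟨K, hK⟩ := hg.2.1
  have hf := hr.measurable_right
  set m : ℝ → E → ℝ := fun t => condMean (submodel P g t) B Z (W t) with hm
  set m0 := condMean P B Z (W 0) with hm0
  have hm00 : m 0 = m0 := by simp only [hm, hm0, submodel_zero]
  have hmm (t) : Measurable (m t) := measurable_condMean
  have hmm0 : Measurable m0 := measurable_condMean
  have hW0 := hW.self_of_nhds
  have hfW0 := hfW.self_of_nhds
  have im0 : IntegrableOn (fun o => f (Z o) * m0 (Z o)) B P :=
    integrableOn_mul_condMean hZ hf hW0 hfW0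
  have im : ∀ᶠ t in 𝓝 0, IntegrableOn (fun o => f (Z o) * m t (Z o)) B P := by
    filter_upwards [hg.eventually_small, hW, hfW] with t ht h1 h2
    have : IsFiniteMeasure (submodel P g t) := isFiniteMeasure_submodel ht
    exact (integrableOn_submodel_iff hgm ht).1 (integrableOn_mul_condMean hZ hf
      ((integrableOn_submodel_iff hgm ht).2 h1) ((integrableOn_submodel_iff hgm ht).2 h2))
  have imC : ∀ᶠ t in 𝓝 0, IntegrableOn (fun o => u (Z o) * m t (Z o)) C P :=
    im.mono fun t h => (hr.integrableOn_iff hZ (hmm t)).2 h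
  have im0C : IntegrableOn (fun o => u (Z o) * m0 (Z o)) C P :=
    (hr.integrableOn_iff hZ hmm0).2 im0
  -- weighted `L¹` convergence of the regression functions
  have hconvB : Tendsto (fun t => ∫ o in B, |f (Z o) * (m t (Z o) - m0 (Z o))| ∂P)
      (𝓝 0) (𝓝 0) := by
    have h1 : Tendsto (fun t => 4 * ∫ o in B, |f (Z o) * (W t o - W 0 o)| ∂P
        + |t| * (2 * K * ∫ o in B, |f (Z o) * (W 0 o - m0 (Z o))| ∂P)) (𝓝 0) (𝓝 0) := by
      have h2 : Tendsto (fun t : ℝ => |t|) (𝓝 0) (𝓝 0) := by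
        simpa using (continuous_abs.tendsto (0 : ℝ))
      simpa using (hL1.const_mul 4).add (h2.mul_const
        (2 * K * ∫ o in B, |f (Z o) * (W 0 o - m0 (Z o))| ∂P))
    refine tendsto_of_tendsto_of_tendsto_of_le_of_le' tendsto_const_nhds h1
      (Eventually.of_forall fun t => integral_nonneg fun o => abs_nonneg _) ?_
    filter_upwards [hg.eventually_small, hW, hfW] with t ht h1 h2
    exact setIntegral_abs_condMean_sub_le hZ hf hg hK ht h1 hW0 h2 hfW0
  have hconvC : Tendsto (fun t => ∫ o in C, |u (Z o) * (m t (Z o) - m0 (Z o))| ∂P)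
      (𝓝 0) (𝓝 0) := by
    refine hconvB.congr fun t => ?_
    have h1 := hr.setIntegral_eq hZ (k := fun z => |m t z - m0 z|) ((hmm t).sub hmm0).abs
    rw [integral_congr_ae (g := fun o => |u (Z o) * (m t (Z o) - m0 (Z o))|)
        (by filter_upwards [hr.nonneg_left] with o ho; rw [abs_mul, abs_of_nonneg ho]),
      integral_congr_ae (f := fun o => f (Z o) * _)
        (g := fun o => |f (Z o) * (m t (Z o) - m0 (Z o))|)
        (by filter_upwards [hr.nonneg_right] with o ho; rw [abs_mul, abs_of_nonneg ho])] at h1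
    exact h1.symm
  -- integrals against the score converge
  have hlim {A : Set (Obs p)} {F : ℝ → Obs p → ℝ} {F0 : Obs p → ℝ}
      (hF : ∀ᶠ t in 𝓝 0, IntegrableOn (F t) A P) (hF0 : IntegrableOn F0 A P)
      (hc : Tendsto (fun t => ∫ o in A, |F t o - F0 o| ∂P) (𝓝 0) (𝓝 0)) :
      Tendsto (fun t => ∫ o in A, g o * F t o ∂P) (𝓝 0) (𝓝 (∫ o in A, g o * F0 o ∂P)) := by
    rw [tendsto_iff_dist_tendsto_zero]
    have h1 : Tendsto (fun t => K * ∫ o in A, |F t o - F0 o| ∂P) (𝓝 0) (𝓝 0) := by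
      simpa using hc.const_mul K
    refine tendsto_of_tendsto_of_tendsto_of_le_of_le' tendsto_const_nhds h1
      (Eventually.of_forall fun t => dist_nonneg) ?_
    filter_upwards [hF] with t hFt
    rw [Real.dist_eq, ← integral_sub (IntegrableOn.score_mul hgm hK hFt)
      (IntegrableOn.score_mul hgm hK hF0), ← integral_const_mul]
    refine abs_integral_le_integral_abs.trans (integral_mono ?_ ((hFt.sub hF0).abs.const_mul K) ?_)
    · exact ((IntegrableOn.score_mul hgm hK hFt).sub (IntegrableOn.score_mul hgm hK hF0)).abs
    · intro o
      simp only [← mul_sub, abs_mul]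
      exact mul_le_mul_of_nonneg_right (hK o) (abs_nonneg _)
  have limB := hlim im im0 (by simpa only [mul_sub] using hconvB)
  have limC := hlim imC im0C (by simpa only [mul_sub] using hconvC)
  refine ⟨imC, hconvC, ?_⟩
  have hd := (hΦ.sub (hasDerivAt_mul_of_tendsto limB)).add (hasDerivAt_mul_of_tendsto limC)
  refine hd.congr_of_eventuallyEq ?_
  filter_upwards [hg.eventually_small, hW, hfW, im, imC] with t ht h1 h2 h3 h4
  have : IsFiniteMeasure (submodel P g t) := isFiniteMeasure_submodel ht
  have e1 := setIntegral_submodel_eq_add hg ht h4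
  have e2 := setIntegral_submodel_eq_add hg ht h3
  have e3 := hr.setIntegral_eq hZ (hmm t)
  have e4 : ∫ o in B, f (Z o) * m t (Z o) ∂(submodel P g t)
      = ∫ o in B, f (Z o) * W t o ∂(submodel P g t) :=
    setIntegral_mul_condMean hZ hf ((integrableOn_submodel_iff hgm ht).2 h1)
      ((integrableOn_submodel_iff hgm ht).2 h2)
  simp only [Pi.add_apply, Pi.sub_apply]
  rw [e1, e3]
  linarith

/-- The pathwise derivative of a regression functional with a fixed response. -/
theorem hasDerivAt_setIntegral_condMean_const (hZ : Measurable Z) (hr : Reweights P Z C u B f)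
    (hg : IsScore P g) {W : Obs p → ℝ} (hW : IntegrableOn W B P)
    (hfW : IntegrableOn (fun o => f (Z o) * W o) B P) :
    (∀ᶠ t in 𝓝 0, IntegrableOn
      (fun o => u (Z o) * condMean (submodel P g t) B Z W (Z o)) C P) ∧
    Tendsto (fun t => ∫ o in C, |u (Z o) * (condMean (submodel P g t) B Z W (Z o)
      - condMean P B Z W (Z o))| ∂P) (𝓝 0) (𝓝 0) ∧
    HasDerivAt (fun t => ∫ o in C, u (Z o) * condMean (submodel P g t) B Z W (Z o)
        ∂(submodel P g t))
      (∫ o in B, g o * (f (Z o) * (W o - condMean P B Z W (Z o))) ∂P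
        + ∫ o in C, g o * (u (Z o) * condMean P B Z W (Z o)) ∂P) 0 := by
  have hgm := hg.1
  obtain ⟨K, hK⟩ := hg.2.1
  have hΦ : HasDerivAt (fun t => ∫ o in B, f (Z o) * W o ∂(submodel P g t))
      (∫ o in B, g o * (f (Z o) * W o) ∂P) 0 := by
    have h1 := (hasDerivAt_mul_of_tendsto (tendsto_const_nhds (x := ∫ o in B,
      g o * (f (Z o) * W o) ∂P))).const_add (∫ o in B, f (Z o) * W o ∂P)
    refine h1.congr_of_eventuallyEq ?_
    filter_upwards [hg.eventually_small] with t ht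
    exact setIntegral_submodel_eq_add hg ht hfW
  have h := hasDerivAt_setIntegral_condMean hZ hr hg (W := fun _ => W)
    (Eventually.of_forall fun _ => hW) (Eventually.of_forall fun _ => hfW) (by simp) hΦ
  refine ⟨h.1, h.2.1, ?_⟩
  convert h.2.2 using 2
  have im0 := integrableOn_mul_condMean hZ hr.measurable_right hW hfW
  rw [← integral_sub (IntegrableOn.score_mul hgm hK hfW) (IntegrableOn.score_mul hgm hK im0)]
  simp only [mul_sub]

end PathwiseDerivative

/-! ### The efficiency bound from a gradient -/

section Efficiency

variable {p : ℕ} {P : Measure (Obs p)} [IsProbabilityMeasure P]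

/-- Cauchy-Schwarz for a bounded score and a square integrable function. -/
theorem sq_integral_score_mul_div_le {φ g : Obs p → ℝ} (hφ : MemLp φ 2 P) (hg : IsScore P g)
    (hpos : 0 < ∫ o, g o ^ 2 ∂P) :
    (∫ o, g o * φ o ∂P) ^ 2 / ∫ o, g o ^ 2 ∂P ≤ ∫ o, φ o ^ 2 ∂P := by
  obtain ⟨hgm, ⟨K, hK⟩, -⟩ := hg
  have hg2 : MemLp g 2 P :=
    MemLp.of_bound hgm.aestronglyMeasurable K (Eventually.of_forall hK)
  have i1 : Integrable (fun o => φ o ^ 2) P := hφ.integrable_sq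
  have i2 : Integrable (fun o => g o ^ 2) P := hg2.integrable_sq
  have i3 : Integrable (fun o => g o * φ o) P :=
    (hφ.integrable (by norm_num)).bdd_mul hgm.aestronglyMeasurable (Eventually.of_forall hK)
  set c := (∫ o, g o * φ o ∂P) / ∫ o, g o ^ 2 ∂P with hc
  have h : 0 ≤ ∫ o, (φ o - c * g o) ^ 2 ∂P := integral_nonneg fun o => sq_nonneg _
  have e : ∫ o, (φ o - c * g o) ^ 2 ∂P
      = ∫ o, φ o ^ 2 ∂P - 2 * c * ∫ o, g o * φ o ∂P + c ^ 2 * ∫ o, g o ^ 2 ∂P := by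
    have i4 : Integrable (fun o => φ o ^ 2 - 2 * c * (g o * φ o)) P := i1.sub (i3.const_mul _)
    rw [← integral_const_mul, ← integral_const_mul, ← integral_sub i1 (i3.const_mul _),
      ← integral_add i4 (i2.const_mul _)]
    refine integral_congr_ae (Eventually.of_forall fun o => ?_)
    simp only
    ring
  rw [e] at h
  have : (∫ o, g o * φ o ∂P) ^ 2 / ∫ o, g o ^ 2 ∂P
      = 2 * c * ∫ o, g o * φ o ∂P - c ^ 2 * ∫ o, g o ^ 2 ∂P := by
    rw [hc]
    field_simp
    ring
  linarith

/-- Truncation of a function at the levels `±n`. -/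
def trunc (φ : Obs p → ℝ) (n : ℕ) (o : Obs p) : ℝ := max (-(n : ℝ)) (min (n : ℝ) (φ o))

theorem abs_trunc_le (φ : Obs p → ℝ) (n : ℕ) (o : Obs p) : |trunc φ n o| ≤ n := by
  have : (0 : ℝ) ≤ n := Nat.cast_nonneg n
  rw [abs_le]
  exact ⟨le_max_left _ _, max_le (by linarith) (min_le_left _ _)⟩

theorem abs_trunc_le_abs (φ : Obs p → ℝ) (n : ℕ) (o : Obs p) : |trunc φ n o| ≤ |φ o| := by
  have hn : (0 : ℝ) ≤ n := Nat.cast_nonneg n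
  rw [abs_le]
  constructor
  · refine le_max_of_le_right (le_min ?_ (neg_abs_le _))
    linarith [abs_nonneg (φ o)]
  · exact max_le (by linarith [abs_nonneg (φ o)]) ((min_le_right _ _).trans (le_abs_self _))

theorem tendsto_trunc (φ : Obs p → ℝ) (o : Obs p) :
    Tendsto (fun n => trunc φ n o) atTop (𝓝 (φ o)) := by
  refine tendsto_const_nhds.congr' ?_
  obtain ⟨N, hN⟩ := exists_nat_ge |φ o|
  filter_upwards [eventually_ge_atTop N] with n hn
  have h1 : |φ o| ≤ n := hN.trans (by exact_mod_cast hn)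
  rw [trunc, min_eq_right (le_of_abs_le h1), max_eq_right (neg_le_of_abs_le h1)]

/-- If a centred square integrable `φ` is the gradient of `ψ` at `P`, its variance is the
efficiency bound: `φ` is the `L²` limit of its centred truncations, which are scores. -/
theorem isEfficiencyBound_of_gradient {ψ : Measure (Obs p) → ℝ} {φ : Obs p → ℝ}
    (hφ : MemLp φ 2 P) (h0 : ∫ o, φ o ∂P = 0) (hne : ∃ g, IsScore P g ∧ 0 < ∫ o, g o ^ 2 ∂P)
    (hd : ∀ g, IsScore P g →
      HasDerivAt (fun t => ψ (submodel P g t)) (∫ o, g o * φ o ∂P) 0) :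
    IsEfficiencyBound ψ P Var[φ; P] := by
  have hvar : Var[φ; P] = ∫ o, φ o ^ 2 ∂P :=
    variance_of_integral_eq_zero hφ.1.aemeasurable h0
  refine ⟨fun g hg => (hd g hg).differentiableAt, ?_, ?_⟩
  · rintro v ⟨g, hg, hpos, rfl⟩
    rw [(hd g hg).deriv, hvar]
    exact sq_integral_score_mul_div_le hφ hg hpos
  · intro b hb
    rw [hvar]
    rcases (integral_nonneg fun o => sq_nonneg (φ o) : 0 ≤ ∫ o, φ o ^ 2 ∂P).eq_or_lt with hz | hz
    · obtain ⟨g, hg, hpos⟩ := hne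
      rw [← hz]
      exact le_trans (by positivity) (hb ⟨g, hg, hpos, rfl⟩)
    set φ' := hφ.1.mk φ with hφ'
    have hae : φ =ᵐ[P] φ' := hφ.1.ae_eq_mk
    have hm' : Measurable φ' := hφ.1.stronglyMeasurable_mk.measurable
    have hL : MemLp φ' 2 P := (memLp_congr_ae hae).1 hφ
    have hsq : ∫ o, φ o ^ 2 ∂P = ∫ o, φ' o ^ 2 ∂P :=
      integral_congr_ae (hae.mono fun o ho => by simp only [ho])
    have h0' : ∫ o, φ' o ∂P = 0 := by rw [← h0]; exact (integral_congr_ae hae).symm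
    have i1 := hL.integrable (by norm_num : (1 : ℝ≥0∞) ≤ 2)
    have htm (n) : Measurable (trunc φ' n) :=
      measurable_const.max (measurable_const.min hm')
    have hti (n) : Integrable (trunc φ' n) P :=
      Integrable.of_bound (htm n).aestronglyMeasurable n
        (Eventually.of_forall (abs_trunc_le φ' n))
    have hti2 (n) : Integrable (fun o => trunc φ' n o ^ 2) P :=
      (MemLp.of_bound (htm n).aestronglyMeasurable n
        (Eventually.of_forall (abs_trunc_le φ' n)) : MemLp _ 2 P).integrable_sq
    have htφ (n) : Integrable (fun o => trunc φ' n o * φ' o) P :=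
      i1.bdd_mul (htm n).aestronglyMeasurable (Eventually.of_forall (abs_trunc_le φ' n))
    let c : ℕ → ℝ := fun n => ∫ o, trunc φ' n o ∂P
    let G : ℕ → Obs p → ℝ := fun n o => trunc φ' n o - c n
    have hG (n) : IsScore P (G n) := by
      refine ⟨(htm n).sub_const _, ⟨n + |c n|, fun o => ?_⟩, ?_⟩
      · exact (abs_sub _ _).trans (add_le_add (abs_trunc_le φ' n o) le_rfl)
      · simp only [G]
        rw [integral_sub (hti n) (integrable_const _)]
        simp [c]
    have c1 : Tendsto c atTop (𝓝 0) := by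
      rw [← h0']
      exact tendsto_integral_of_dominated_convergence (fun o => |φ' o|)
        (fun n => (htm n).aestronglyMeasurable) i1.abs
        (fun n => Eventually.of_forall (abs_trunc_le_abs φ' n))
        (Eventually.of_forall (tendsto_trunc φ'))
    have c2 : Tendsto (fun n => ∫ o, trunc φ' n o * φ' o ∂P) atTop (𝓝 (∫ o, φ' o ^ 2 ∂P)) := by
      refine tendsto_integral_of_dominated_convergence (fun o => φ' o ^ 2)
        (fun n => (htφ n).1) hL.integrable_sq
        (fun n => Eventually.of_forall fun o => ?_) (Eventually.of_forall fun o => ?_)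
      · rw [Real.norm_eq_abs, abs_mul, ← sq_abs, sq]
        exact mul_le_mul_of_nonneg_right (abs_trunc_le_abs φ' n o) (abs_nonneg _)
      · rw [sq]
        exact (tendsto_trunc φ' o).mul_const _
    have c3 : Tendsto (fun n => ∫ o, trunc φ' n o ^ 2 ∂P) atTop (𝓝 (∫ o, φ' o ^ 2 ∂P)) := by
      refine tendsto_integral_of_dominated_convergence (fun o => φ' o ^ 2)
        (fun n => (hti2 n).1) hL.integrable_sq
        (fun n => Eventually.of_forall fun o => ?_) (Eventually.of_forall fun o => ?_)
      · rw [Real.norm_eq_abs, abs_pow, ← sq_abs (φ' o)]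
        exact pow_le_pow_left₀ (abs_nonneg _) (abs_trunc_le_abs φ' n o) 2
      · exact (tendsto_trunc φ' o).pow 2
    have e1 (n) : ∫ o, G n o * φ o ∂P = ∫ o, trunc φ' n o * φ' o ∂P := by
      rw [integral_congr_ae (g := fun o => trunc φ' n o * φ' o - c n * φ' o)
        (by filter_upwards [hae] with o ho; rw [ho]; simp only [G]; ring),
        integral_sub (htφ n) (i1.const_mul _), integral_const_mul, h0', mul_zero, sub_zero]
    have e2 (n) : ∫ o, G n o ^ 2 ∂P = ∫ o, trunc φ' n o ^ 2 ∂P - c n ^ 2 := by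
      have : ∀ o, G n o ^ 2 = trunc φ' n o ^ 2 - 2 * c n * trunc φ' n o + c n ^ 2 := by
        intro o; simp only [G]; ring
      simp only [this]
      have i4 : Integrable (fun o => trunc φ' n o ^ 2 - 2 * c n * trunc φ' n o) P :=
        (hti2 n).sub ((hti n).const_mul _)
      rw [integral_add i4 (integrable_const _),
        integral_sub (hti2 n) ((hti n).const_mul _), integral_const_mul]
      simp only [integral_const, probReal_univ, one_smul]
      simp only [c]
      ring
    have c4 : Tendsto (fun n => ∫ o, G n o ^ 2 ∂P) atTop (𝓝 (∫ o, φ' o ^ 2 ∂P)) := by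
      simp only [e2]
      simpa using c3.sub (c1.pow 2)
    have hlim : Tendsto (fun n => (∫ o, G n o * φ o ∂P) ^ 2 / ∫ o, G n o ^ 2 ∂P) atTop
        (𝓝 (∫ o, φ o ^ 2 ∂P)) := by
      simp only [e1]
      rw [hsq] at hz ⊢
      have hdiv := (c2.pow 2).div c4 hz.ne'
      rwa [show (∫ o, φ' o ^ 2 ∂P) ^ 2 / ∫ o, φ' o ^ 2 ∂P = ∫ o, φ' o ^ 2 ∂P by
        field_simp] at hdiv
    refine le_of_tendsto hlim ?_
    rw [hsq] at hz
    filter_upwards [c4.eventually_const_lt hz] with n hn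
    refine hb ⟨G n, hG n, hn, ?_⟩
    rw [(hd _ (hG n)).deriv]

end Efficiency

/-! ### Conditional probabilities as densities, and inverse weighting -/

section Versions

variable {α E : Type*} [MeasurableSpace α] [MeasurableSpace E] {ν : Measure α}

/-- `q(Z)` is a version of the conditional probability of `b` given `Z` on the event `B`, phrased
for nonnegative test functions of `Z`. -/
def IsCondProb (ν : Measure α) (B : Set α) (Z : α → E) (b : α → Bool) (q : E → ℝ) : Prop :=
  ∀ k : E → ℝ≥0∞, Measurable k →
    ∫⁻ o in B ∩ {o | b o = true}, k (Z o) ∂ν = ∫⁻ o in B, ENNReal.ofReal (q (Z o)) * k (Z o) ∂ν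

theorem measurableSet_bool_eq {b : α → Bool} (hb : Measurable b) (c : Bool) :
    MeasurableSet {o | b o = c} := hb (measurableSet_singleton c)

theorem isCondProb_of_setIntegral [IsFiniteMeasure ν] {B : Set α}
    {Z : α → E} (hZ : Measurable Z) {b : α → Bool} (hb : Measurable b) {q : E → ℝ}
    (hq : Measurable q) (hqi : IntegrableOn (fun o => q (Z o)) B ν)
    (hq0 : ∀ᵐ o ∂ν.restrict B, 0 ≤ q (Z o))
    (h : ∀ T, MeasurableSet T → ∫ o in B ∩ Z ⁻¹' T, q (Z o) ∂ν
      = ∫ o in B ∩ Z ⁻¹' T, ind (b o) ∂ν) :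
    IsCondProb ν B Z b q := by
  have hbm := measurableSet_bool_eq hb true
  have hmeas : (ν.restrict (B ∩ {o | b o = true})).map Z
      = ((ν.restrict B).map Z).withDensity (fun z => ENNReal.ofReal (q z)) := by
    ext T hT
    rw [Measure.map_apply hZ hT, withDensity_apply _ hT,
      setLIntegral_map hT hq.ennreal_ofReal hZ, Measure.restrict_restrict (hZ hT),
      Measure.restrict_apply (hZ hT)]
    have e1 : ∫⁻ o in Z ⁻¹' T ∩ B, ENNReal.ofReal (q (Z o)) ∂ν
        = ENNReal.ofReal (∫ o in B ∩ Z ⁻¹' T, q (Z o) ∂ν) := by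
      rw [Set.inter_comm, ofReal_integral_eq_lintegral_ofReal]
      · exact hqi.mono_set Set.inter_subset_left
      · exact ae_restrict_of_ae_restrict_of_subset Set.inter_subset_left hq0
    have e2 : ∫ o in B ∩ Z ⁻¹' T, ind (b o) ∂ν
        = ν.real (Z ⁻¹' T ∩ (B ∩ {o | b o = true})) := by
      have : (fun o => ind (b o)) = {o | b o = true}.indicator (fun _ => (1 : ℝ)) := by
        ext o
        by_cases hbo : b o = true <;> simp [ind, hbo]
      rw [this, integral_indicator hbm, Measure.restrict_restrict hbm]
      simp only [integral_const, smul_eq_mul, mul_one, Measure.real, Measure.restrict_apply_univ]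
      congr 2
      ext o; simp only [Set.mem_inter_iff, Set.mem_ofPred_eq]; tauto
    rw [e1, h T hT, e2, ofReal_measureReal]
  intro k hk
  rw [← lintegral_map hk hZ, hmeas, lintegral_withDensity_eq_lintegral_mul _ hq.ennreal_ofReal hk,
    lintegral_map (hq.ennreal_ofReal.mul hk) hZ]
  rfl

theorem isCondProb_of_false {B : Set α} {Z : α → E} {b : α → Bool} {q : E → ℝ}
    (h : IsCondProb ν B Z (fun o => !b o) q) {k : E → ℝ≥0∞} (hk : Measurable k) :
    ∫⁻ o in B ∩ {o | b o = false}, k (Z o) ∂ν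
      = ∫⁻ o in B, ENNReal.ofReal (q (Z o)) * k (Z o) ∂ν := by
  have := h k hk
  simpa using this

/-- Inverse probability weighting. -/
theorem IsCondProb.reweights {B : Set α} {Z : α → E} {b : α → Bool}
    {q u : E → ℝ} (h : IsCondProb ν B Z b q)
    (hq : Measurable q) (hu : Measurable u)
    (hq0 : ∀ᵐ o ∂ν.restrict B, 0 < q (Z o)) (hu0 : ∀ᵐ o ∂ν.restrict B, 0 ≤ u (Z o)) :
    Reweights ν Z B u (B ∩ {o | b o = true}) (fun z => u z / q z) where
  measurable_left := hu
  measurable_right := hu.div hq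
  nonneg_left := hu0
  nonneg_right := by
    refine ae_restrict_of_ae_restrict_of_subset Set.inter_subset_left ?_
    filter_upwards [hq0, hu0] with o h1 h2
    positivity
  lintegral_eq k hk := by
    rw [h (fun z => ENNReal.ofReal (u z / q z) * k z) ((hu.div hq).ennreal_ofReal.mul hk)]
    refine lintegral_congr_ae ?_
    filter_upwards [hq0] with o h1
    rw [← mul_assoc, ← ENNReal.ofReal_mul h1.le, mul_div_cancel₀ _ h1.ne']

/-- Odds weighting: the distribution of `Z` on the event `b` is the one on its complement,
weighted by the odds `q / (1 - q)`. -/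
theorem IsCondProb.reweights_odds {Z : α → E} {b : α → Bool} {q : E → ℝ}
    (h : IsCondProb ν Set.univ Z b q)
    (h' : IsCondProb ν Set.univ Z (fun o => !b o) (fun z => 1 - q z)) (hq : Measurable q)
    (hq0 : ∀ᵐ o ∂ν, q (Z o) ∈ Set.Ioo (0 : ℝ) 1) :
    Reweights ν Z {o | b o = true} (fun _ => 1) {o | b o = false} (fun z => q z / (1 - q z)) where
  measurable_left := measurable_const
  measurable_right := hq.div (measurable_const.sub hq)
  nonneg_left := by simp
  nonneg_right := by
    refine ae_restrict_of_ae ?_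
    filter_upwards [hq0] with o h1
    exact div_nonneg h1.1.le (by linarith [h1.2])
  lintegral_eq k hk := by
    have h1 := h k hk
    have h2 := isCondProb_of_false h' (k := fun z => ENNReal.ofReal (q z / (1 - q z)) * k z)
      ((hq.div (measurable_const.sub hq)).ennreal_ofReal.mul hk)
    simp only [Set.univ_inter, Measure.restrict_univ] at h1 h2
    simp only [ENNReal.ofReal_one, one_mul]
    rw [h1, h2]
    refine lintegral_congr_ae ?_
    filter_upwards [hq0] with o h1
    have : 0 < 1 - q (Z o) := by linarith [h1.2]
    rw [← mul_assoc, ← ENNReal.ofReal_mul this.le, mul_div_cancel₀ _ this.ne']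

theorem Reweights.trans {Z : α → E} {C B B' : Set α} {u f f' : E → ℝ} (h : Reweights ν Z C u B f)
    (h' : Reweights ν Z B f B' f') : Reweights ν Z C u B' f' where
  measurable_left := h.measurable_left
  measurable_right := h'.measurable_right
  nonneg_left := h.nonneg_left
  nonneg_right := h'.nonneg_right
  lintegral_eq k hk := (h.lintegral_eq k hk).trans (h'.lintegral_eq k hk)

end Versions

section ObservedVersions

variable {p : ℕ} {E : Type*} [MeasurableSpace E] {P : Measure (Obs p)} [IsFiniteMeasure P]
  {B : Set (Obs p)} {Z : Obs p → E} {b : Obs p → Bool}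

theorem integrableOn_ind (hb : Measurable b) : IntegrableOn (fun o => ind (b o)) B P := by
  refine Integrable.of_bound (measurable_ind.comp hb).aestronglyMeasurable 1
    (Eventually.of_forall fun o => ?_)
  rw [Real.norm_of_nonneg (ind_nonneg _)]
  exact ind_le_one _

theorem setIntegral_condMean_ind (hZ : Measurable Z) (hb : Measurable b) {T : Set E}
    (hT : MeasurableSet T) :
    ∫ o in B ∩ Z ⁻¹' T, condMean P B Z (fun o => ind (b o)) (Z o) ∂P
      = ∫ o in B ∩ Z ⁻¹' T, ind (b o) ∂P := by
  have hm : Measurable (T.indicator (fun _ => (1 : ℝ))) := measurable_const.indicator hT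
  have hi (F : Obs p → ℝ) : (fun o => T.indicator (fun _ => (1 : ℝ)) (Z o) * F o)
      = (Z ⁻¹' T).indicator F := by
    ext o
    by_cases ho : Z o ∈ T <;> simp [ho]
  have h := setIntegral_mul_condMean (P := P) (B := B) (W := fun o => ind (b o)) hZ hm
    (integrableOn_ind hb) (by rw [hi]; exact (integrableOn_ind hb).indicator (hZ hT))
  rw [hi, hi, integral_indicator (hZ hT), integral_indicator (hZ hT),
    Measure.restrict_restrict (hZ hT), Set.inter_comm] at h
  exact h

theorem integrableOn_condMean_ind (hZ : Measurable Z) (hb : Measurable b) :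
    IntegrableOn (fun o => condMean P B Z (fun o => ind (b o)) (Z o)) B P := by
  have := integrableOn_mul_condMean (P := P) (B := B) (W := fun o => ind (b o)) hZ
    (f := fun _ => 1) measurable_const (integrableOn_ind hb)
    (by simpa using integrableOn_ind hb)
  simpa using this

theorem isCondProb_condMean (hZ : Measurable Z) (hb : Measurable b)
    (h0 : ∀ᵐ o ∂P.restrict B, 0 ≤ condMean P B Z (fun o => ind (b o)) (Z o)) :
    IsCondProb P B Z b (condMean P B Z fun o => ind (b o)) :=
  isCondProb_of_setIntegral hZ hb measurable_condMean (integrableOn_condMean_ind hZ hb) h0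
    fun _ hT => setIntegral_condMean_ind hZ hb hT

theorem isCondProb_not_condMean (hZ : Measurable Z) (hb : Measurable b)
    (h1 : ∀ᵐ o ∂P.restrict B, condMean P B Z (fun o => ind (b o)) (Z o) ≤ 1) :
    IsCondProb P B Z (fun o => !b o) (fun z => 1 - condMean P B Z (fun o => ind (b o)) z) := by
  refine isCondProb_of_setIntegral (b := fun o => !b o) hZ ((measurable_of_finite Bool.not).comp hb)
    (measurable_const.sub measurable_condMean)
    ((integrable_const _).sub (integrableOn_condMean_ind hZ hb))
    (h1.mono fun o ho => by linarith) fun T hT => ?_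
  have e : ∀ o, ind (!b o) = 1 - ind (b o) := by
    intro o
    cases b o <;> simp [ind]
  simp only [e]
  have hi := (integrableOn_condMean_ind (P := P) (B := B) hZ hb).mono_set
    (Set.inter_subset_left (t := Z ⁻¹' T))
  rw [integral_sub (integrable_const _) hi, integral_sub (integrable_const _) (integrableOn_ind hb),
    setIntegral_condMean_ind hZ hb hT]

end ObservedVersions

/-! ### Conditional independence -/

section ConditionalIndependence

variable {Ω₀ : Type*} [MeasurableSpace Ω₀] {Q : Measure Ω₀}
  [IsProbabilityMeasure Q] {β : Type*} [MeasurableSpace β]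

theorem setLIntegral_eq_condDistrib {β' : Type*} [MeasurableSpace β'] {V : Ω₀ → β'}
    (hV : Measurable V) {R : Ω₀ → Bool} (hR : Measurable R) {k : β' → ℝ≥0∞} (hk : Measurable k) :
    ∫⁻ ω in {ω | R ω = true}, k (V ω) ∂Q = ∫⁻ ω, condDistrib R V Q (V ω) {true} * k (V ω) ∂Q := by
  have hset : MeasurableSet {ω | R ω = true} := measurableSet_bool_eq hR true
  have hm : Measurable fun q : β' × Bool => ({true} : Set Bool).indicator (fun _ => k q.1) q.2 :=
    Measurable.ite (measurable_snd (measurableSet_singleton true)) (hk.comp measurable_fst)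
      measurable_const
  have h1 : ∫⁻ ω in {ω | R ω = true}, k (V ω) ∂Q
      = ∫⁻ q, ({true} : Set Bool).indicator (fun _ => k q.1) q.2 ∂(Q.map fun ω => (V ω, R ω)) := by
    rw [lintegral_map hm (hV.prodMk hR), ← lintegral_indicator hset]
    rfl
  rw [h1, ← compProd_map_condDistrib hR.aemeasurable, Measure.lintegral_compProd hm,
    lintegral_map hm.lintegral_kernel_prod_right' hV]
  refine lintegral_congr fun ω => ?_
  change ∫⁻ c, ({true} : Set Bool).indicator (fun _ => k (V ω)) c ∂_ = _
  rw [lintegral_indicator (measurableSet_singleton true)]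
  simp [mul_comm]

variable [StandardBorelSpace Ω₀]

/-- If `T` and `R` are conditionally independent given `V`, a version of the conditional
probability of `R` given `V` is one given `(V, T)`. -/
theorem isCondProb_of_condIndepFun {V : Ω₀ → β} (hV : Measurable V) {T : Ω₀ → ℝ}
    (hT : Measurable T) {R : Ω₀ → Bool} (hR : Measurable R)
    (h : CondIndepFun (MeasurableSpace.comap V inferInstance) hV.comap_le T R Q)
    {q : β → ℝ} (hq : Measurable q) (hver : IsCondProb Q Set.univ V R q) :
    IsCondProb Q Set.univ (fun ω => (V ω, T ω)) R (fun v => q v.1) := by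
  intro k hk
  have hpair : Measurable fun ω => (V ω, T ω) := hV.prodMk hT
  have hker := (condIndepFun_iff_condDistrib_prod_ae_eq_prodMkRight hR hT hV).1 h
  have hκ : Measurable fun v => condDistrib R V Q v {true} :=
    Kernel.measurable_coe _ (measurableSet_singleton true)
  have hqae : (fun v => condDistrib R V Q v {true}) =ᵐ[Q.map V] fun v => ENNReal.ofReal (q v) := by
    refine ae_eq_of_forall_setLIntegral_eq_of_sigmaFinite hκ hq.ennreal_ofReal fun s hs _ => ?_
    have h1 := setLIntegral_eq_condDistrib (Q := Q) hV hR
      (k := s.indicator fun _ => 1) (measurable_const.indicator hs)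
    have h2 := hver (s.indicator fun _ => 1) (measurable_const.indicator hs)
    simp only [Set.univ_inter, Measure.restrict_univ] at h2
    rw [h1] at h2
    have e (F : β → ℝ≥0∞) (hF : Measurable F) :
        ∫⁻ ω, F (V ω) * s.indicator (fun _ => 1) (V ω) ∂Q = ∫⁻ v in s, F v ∂(Q.map V) := by
      rw [← lintegral_indicator hs, lintegral_map (hF.indicator hs) hV]
      refine lintegral_congr fun ω => ?_
      by_cases hω : V ω ∈ s <;> simp [hω]
    rw [← e _ hκ, ← e _ hq.ennreal_ofReal, h2]
  have hqae' := ae_of_ae_map hV.aemeasurable hqae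
  have hker' := ae_of_ae_map hpair.aemeasurable hker
  rw [Set.univ_inter, setLIntegral_eq_condDistrib hpair hR hk, Measure.restrict_univ]
  refine lintegral_congr_ae ?_
  filter_upwards [hqae', hker'] with ω h1 h2
  rw [h2, ← h1]
  rfl

end ConditionalIndependence

/-! ### Identification from the full data -/

section Identification

variable {p : ℕ} {Ω₀ : Type*} [MeasurableSpace Ω₀] {F : FullData p Ω₀} {Q : Measure Ω₀}

theorem measurable_obs : Measurable F.obs :=
  F.measurable_X.prodMk (F.measurable_R0.prodMk
    (((measurable_ind.comp F.measurable_R0).mul F.measurable_Y0).prodMk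
      (F.measurable_A.prodMk F.measurable_Y1)))

theorem isProbabilityMeasure_obsLaw [IsProbabilityMeasure Q] :
    IsProbabilityMeasure (F.obsLaw Q) :=
  Measure.isProbabilityMeasure_map measurable_obs.aemeasurable

theorem ae_obsLaw_iff {q : Obs p → Prop} (hq : MeasurableSet {o | q o}) :
    (∀ᵐ o ∂F.obsLaw Q, q o) ↔ ∀ᵐ ω ∂Q, q (F.obs ω) :=
  ae_map_iff measurable_obs.aemeasurable hq

theorem integrableOn_obsLaw_iff {B : Set (Obs p)} (hB : MeasurableSet B) {G : Obs p → ℝ}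
    (hG : Measurable G) :
    IntegrableOn G B (F.obsLaw Q) ↔ IntegrableOn (fun ω => G (F.obs ω)) (F.obs ⁻¹' B) Q := by
  rw [FullData.obsLaw, IntegrableOn, Measure.restrict_map measurable_obs hB,
    integrable_map_measure hG.aestronglyMeasurable measurable_obs.aemeasurable]
  rfl

theorem setIntegral_obsLaw {B : Set (Obs p)} (hB : MeasurableSet B) {G : Obs p → ℝ}
    (hG : Measurable G) :
    ∫ o in B, G o ∂(F.obsLaw Q) = ∫ ω in F.obs ⁻¹' B, G (F.obs ω) ∂Q := by
  rw [FullData.obsLaw, setIntegral_map hB hG.aestronglyMeasurable measurable_obs.aemeasurable]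

/-- Conditional probabilities under the observed-data law, pulled back to the full data. -/
theorem IsCondProb.of_obsLaw {E : Type*} [MeasurableSpace E] {B : Set (Obs p)}
    (hB : MeasurableSet B) {Z : Obs p → E} (hZ : Measurable Z) {b : Obs p → Bool}
    (hb : Measurable b) {q : E → ℝ} (hq : Measurable q) (h : IsCondProb (F.obsLaw Q) B Z b q) :
    IsCondProb Q (F.obs ⁻¹' B) (fun ω => Z (F.obs ω)) (fun ω => b (F.obs ω)) q := by
  intro k hk
  have := h k hk
  have m1 : Measurable fun o => k (Z o) := hk.comp hZ
  have m2 : Measurable fun o => ENNReal.ofReal (q (Z o)) * k (Z o) :=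
    (hq.comp hZ).ennreal_ofReal.mul m1
  rw [FullData.obsLaw, setLIntegral_map (hB.inter (measurableSet_bool_eq hb true)) m1
    measurable_obs, setLIntegral_map hB m2 measurable_obs] at this
  exact this

theorem IsCondProb.univ_of_forall_bool {E : Type*} [MeasurableSpace E] {α : Type*}
    [MeasurableSpace α] {ν : Measure α} {Z : α → E} {A b : α → Bool} (hA : Measurable A)
    {q : E → Bool → ℝ}
    (h : ∀ a, IsCondProb ν {o | A o = a} Z b fun z => q z a) :
    IsCondProb ν Set.univ (fun o => (Z o, A o)) b fun v => q v.1 v.2 := by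
  intro k hk
  have hc : {o | A o = false} = {o | A o = true}ᶜ := by
    ext o; simp
  have hAt := measurableSet_bool_eq hA true
  have key (ν' : Measure α) (G : α → ℝ≥0∞) : ∫⁻ o, G o ∂ν'
      = ∫⁻ o in {o | A o = true}, G o ∂ν' + ∫⁻ o in {o | A o = false}, G o ∂ν' := by
    rw [hc, lintegral_add_compl _ hAt]
  have hk' (a : Bool) : Measurable fun z => k (z, a) :=
    hk.comp (measurable_id.prodMk measurable_const)
  rw [key, key (ν.restrict Set.univ)]
  have h2 (a : Bool) : ∫⁻ o in {o | A o = a}, k (Z o, A o) ∂(ν.restrict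
        (Set.univ ∩ {o | b o = true}))
      = ∫⁻ o in {o | A o = a}, ENNReal.ofReal (q (Z o) (A o)) * k (Z o, A o)
        ∂(ν.restrict Set.univ) := by
    have hm := measurableSet_bool_eq hA a
    rw [Measure.restrict_univ, Set.univ_inter, Measure.restrict_restrict hm]
    rw [setLIntegral_congr_fun_ae (g := fun o => ENNReal.ofReal (q (Z o) a) * k (Z o, a)) hm
      (Eventually.of_forall fun o (ho : A o = a) => by simp only [ho])]
    rw [← h a _ (hk' a)]
    refine lintegral_congr_ae ?_
    filter_upwards [ae_restrict_of_ae_restrict_of_subset Set.inter_subset_left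
      (ae_restrict_mem hm)] with o (ho : A o = a)
    simp only [ho]
  rw [h2, h2]

variable [IsProbabilityMeasure Q]

section Propensity

variable (hpos : ∀ᵐ ω ∂Q, truePi (F.obsLaw Q) (F.X ω) ∈ Set.Ioo (0 : ℝ) 1)
include hpos

theorem ae_truePi_mem : ∀ᵐ o ∂F.obsLaw Q, truePi (F.obsLaw Q) (cov o) ∈ Set.Ioo (0 : ℝ) 1 :=
  (ae_obsLaw_iff ((measurable_condMean.comp measurable_cov) measurableSet_Ioo)).2 hpos

theorem isCondProb_truePi :
    IsCondProb (F.obsLaw Q) Set.univ cov trt (truePi (F.obsLaw Q)) := by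
  have := isProbabilityMeasure_obsLaw (F := F) (Q := Q)
  exact isCondProb_condMean measurable_cov measurable_trt
    (ae_restrict_of_ae ((ae_truePi_mem hpos).mono fun o ho => ho.1.le))

theorem isCondProb_not_truePi :
    IsCondProb (F.obsLaw Q) Set.univ cov (fun o => !trt o)
      (fun x => 1 - truePi (F.obsLaw Q) x) := by
  have := isProbabilityMeasure_obsLaw (F := F) (Q := Q)
  exact isCondProb_not_condMean measurable_cov measurable_trt
    (ae_restrict_of_ae ((ae_truePi_mem hpos).mono fun o ho => ho.2.le))

/-- The treated covariate distribution is the untreated one, weighted by the odds of treatment. -/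
theorem reweights_odds_cov : Reweights (F.obsLaw Q) cov {o | trt o = true} (fun _ => 1)
    {o | trt o = false} (fun x => truePi (F.obsLaw Q) x / (1 - truePi (F.obsLaw Q) x)) :=
  (isCondProb_truePi hpos).reweights_odds (isCondProb_not_truePi hpos) measurable_condMean
    (ae_truePi_mem hpos)

theorem measure_trt_ne_zero (a : Bool) : F.obsLaw Q {o | trt o = a} ≠ 0 := by
  have := isProbabilityMeasure_obsLaw (F := F) (Q := Q)
  intro h0
  have hne : NeZero (F.obsLaw Q) := inferInstance
  have hzero : ∀ q : (Fin p → ℝ) → ℝ, Measurable q →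
      ∫⁻ o, ENNReal.ofReal (q (cov o)) ∂(F.obsLaw Q) = 0 →
      ¬ ∀ᵐ o ∂F.obsLaw Q, 0 < q (cov o) := by
    intro q hq hz hall
    have hm : Measurable fun o : Obs p => ENNReal.ofReal (q (cov o)) :=
      (hq.comp measurable_cov).ennreal_ofReal
    rw [lintegral_eq_zero_iff hm] at hz
    obtain ⟨o, h1, h2⟩ := (hz.and hall).exists
    simp only [Pi.zero_apply, ENNReal.ofReal_eq_zero] at h1
    linarith
  cases a with
  | true =>
    have h1 := isCondProb_truePi hpos (fun _ => 1) measurable_const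
    simp only [Set.univ_inter, Measure.restrict_univ, mul_one, lintegral_one,
      Measure.restrict_apply_univ] at h1
    exact hzero _ measurable_condMean (h1.symm.trans h0)
      ((ae_truePi_mem hpos).mono fun o ho => ho.1)
  | false =>
    have h1 := isCondProb_of_false (isCondProb_not_truePi hpos) (k := fun _ => 1) measurable_const
    simp only [Set.univ_inter, Measure.restrict_univ, mul_one, lintegral_one,
      Measure.restrict_apply_univ] at h1
    exact hzero (fun x => 1 - truePi (F.obsLaw Q) x) (measurable_const.sub measurable_condMean)
      (h1.symm.trans h0) ((ae_truePi_mem hpos).mono fun o ho => by linarith [ho.2])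

end Propensity

theorem meanTrt_eq {P : Measure (Obs p)} : meanTrt P = P.real {o | trt o = true} := by
  have h : (fun o : Obs p => ind (trt o)) = {o | trt o = true}.indicator (fun _ => (1 : ℝ)) := by
    ext o
    by_cases ho : trt o = true <;> simp [ind, ho]
  rw [meanTrt, h, integral_indicator (measurableSet_bool_eq measurable_trt true)]
  simp

theorem meanTrt_pos (hpos : ∀ᵐ ω ∂Q, truePi (F.obsLaw Q) (F.X ω) ∈ Set.Ioo (0 : ℝ) 1) :
    0 < meanTrt (F.obsLaw Q) := by
  have := isProbabilityMeasure_obsLaw (F := F) (Q := Q)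
  rw [meanTrt_eq]
  exact ENNReal.toReal_pos (measure_trt_ne_zero hpos true) (measure_ne_top _ _)

/-- The centred treatment indicator is a nondegenerate score. -/
theorem exists_score (hpos : ∀ᵐ ω ∂Q, truePi (F.obsLaw Q) (F.X ω) ∈ Set.Ioo (0 : ℝ) 1) :
    ∃ g, IsScore (F.obsLaw Q) g ∧ 0 < ∫ o, g o ^ 2 ∂F.obsLaw Q := by
  have := isProbabilityMeasure_obsLaw (F := F) (Q := Q)
  set P := F.obsLaw Q with hP
  have hi : Integrable (fun o : Obs p => ind (trt o)) P := by
    rw [← integrableOn_univ]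
    exact integrableOn_ind measurable_trt
  have h1 : 0 < meanTrt P := meanTrt_pos hpos
  have h2 : meanTrt P < 1 := by
    have h3 : 0 < P.real {o | trt o = false} :=
      ENNReal.toReal_pos (measure_trt_ne_zero hpos false) (measure_ne_top _ _)
    have h4 := probReal_compl_eq_one_sub (μ := P) (measurableSet_bool_eq
      (measurable_trt (p := p)) true)
    have hc : {o : Obs p | trt o = true}ᶜ = {o | trt o = false} := by ext o; simp
    rw [hc, ← meanTrt_eq] at h4
    linarith
  refine ⟨fun o => ind (trt o) - meanTrt P, ⟨measurable_ind_trt.sub_const _,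
    ⟨1 + meanTrt P, fun o => ?_⟩, ?_⟩, ?_⟩
  · refine (abs_sub _ _).trans (add_le_add ?_ (abs_of_pos h1).le)
    rw [abs_of_nonneg (ind_nonneg _)]
    exact ind_le_one _
  · rw [integral_sub hi (integrable_const _)]
    simp [meanTrt]
  · have e : ∀ o : Obs p, (ind (trt o) - meanTrt P) ^ 2
        = (1 - 2 * meanTrt P) * ind (trt o) + meanTrt P ^ 2 := by
      intro o
      cases h : trt o <;> simp [ind] <;> ring
    simp only [e]
    rw [integral_add (hi.const_mul _) (integrable_const _), integral_const_mul]
    simp only [integral_const, probReal_univ, one_smul]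
    change 0 < (1 - 2 * meanTrt P) * meanTrt P + meanTrt P ^ 2
    nlinarith

section ParallelTrends

variable [StandardBorelSpace Ω₀]

/-- Conditional parallel trends identify the untreated trend of the treated. -/
theorem setIntegral_trend (hid : Identifiability F Q) :
    ∫ ω in {ω | F.A ω = true}, (F.Y10 ω - F.Y0 ω) ∂Q
      = ∫ ω in {ω | F.A ω = false}, truePi (F.obsLaw Q) (F.X ω) / (1 - truePi (F.obsLaw Q) (F.X ω))
        * (F.Y10 ω - F.Y0 ω) ∂Q := by
  have hpos := hid.positivity
  have hT : Measurable fun ω => F.Y10 ω - F.Y0 ω := F.measurable_Y10.sub F.measurable_Y0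
  have hnot : Measurable fun ω => !F.A ω := (measurable_of_finite Bool.not).comp F.measurable_A
  have hqm : Measurable (truePi (F.obsLaw Q)) := measurable_condMean
  have v1 : IsCondProb Q Set.univ F.X F.A (truePi (F.obsLaw Q)) :=
    (isCondProb_truePi hpos).of_obsLaw MeasurableSet.univ measurable_cov measurable_trt hqm
  have v0 : IsCondProb Q Set.univ F.X (fun ω => !F.A ω) (fun x => 1 - truePi (F.obsLaw Q) x) :=
    (isCondProb_not_truePi hpos).of_obsLaw MeasurableSet.univ measurable_cov
      ((measurable_of_finite Bool.not).comp measurable_trt) (measurable_const.sub hqm)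
  have c1 := isCondProb_of_condIndepFun F.measurable_X hT F.measurable_A hid.parallel_trends hqm v1
  have c0 := isCondProb_of_condIndepFun F.measurable_X hT hnot
    (hid.parallel_trends.comp measurable_id (measurable_of_finite Bool.not))
    (measurable_const.sub hqm) v0
  have hr := c1.reweights_odds c0 (hqm.comp measurable_fst) hpos
  have := hr.setIntegral_eq (F.measurable_X.prodMk hT) (k := fun v => v.2) measurable_snd
  simpa using this

end ParallelTrends

section MissingAtRandom

variable {E : Type*} [MeasurableSpace E] {β : Type*} [MeasurableSpace β]

/-- Missingness at random: a response probability given the regressors, in each treatment arm, is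
one given the regressors and the possibly missing outcome. -/
theorem isCondProb_resp_of_condIndepFun [StandardBorelSpace Ω₀] {Z : Ω₀ → E} {γ : E → Bool → ℝ}
    (hγm : ∀ a, Measurable fun z => γ z a)
    (h : ∀ a, IsCondProb Q {ω | F.A ω = a} Z F.R0 (fun z => γ z a))
    (e : E × Bool ≃ᵐ β) {V : Ω₀ → β} (hV : Measurable V) (hVe : ∀ ω, V ω = e (Z ω, F.A ω))
    (hmar : CondIndepFun (MeasurableSpace.comap V inferInstance) hV.comap_le F.Y0 F.R0 Q)
    (a : Bool) :
    IsCondProb Q {ω | F.A ω = a} (fun ω => (Z ω, F.Y0 ω)) F.R0 (fun v => γ v.1 a) := by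
  have hγ2 : Measurable fun v : E × Bool => γ v.1 v.2 :=
    measurable_from_prod_countable_left hγm
  have h2 := IsCondProb.univ_of_forall_bool F.measurable_A h
  have h3 : IsCondProb Q Set.univ V F.R0 (fun v => γ (e.symm v).1 (e.symm v).2) := by
    intro k hk
    have := h2 (fun v => k (e v)) (hk.comp e.measurable)
    simp only [hVe, MeasurableEquiv.symm_apply_apply]
    exact this
  have h4 := isCondProb_of_condIndepFun hV F.measurable_Y0 F.measurable_R0 hmar
    (hγ2.comp e.symm.measurable) h3
  intro k hk
  have hkm : Measurable fun v : β × ℝ =>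
      {b : Bool | b = a}.indicator (fun _ => k ((e.symm v.1).1, v.2)) (e.symm v.1).2 := by
    refine Measurable.ite ?_ ?_ measurable_const
    · exact (measurable_snd.comp (e.symm.measurable.comp measurable_fst))
        (measurableSet_singleton a)
    · exact hk.comp ((measurable_fst.comp (e.symm.measurable.comp measurable_fst)).prodMk
        measurable_snd)
  have h5 := h4 _ hkm
  simp only [hVe, MeasurableEquiv.symm_apply_apply, Set.univ_inter, Measure.restrict_univ] at h5
  have hA := measurableSet_bool_eq F.measurable_A a
  have e1 (ν : Measure Ω₀) (G : Ω₀ → ℝ≥0∞) : ∫⁻ ω in {ω | F.A ω = a}, G ω ∂ν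
      = ∫⁻ ω, {b : Bool | b = a}.indicator (fun _ => G ω) (F.A ω) ∂ν := by
    rw [← lintegral_indicator hA]
    rfl
  rw [← Measure.restrict_restrict hA, e1, e1, h5]
  refine lintegral_congr fun ω => ?_
  by_cases hω : F.A ω = a <;> simp [hω]

variable {Z : Obs p → E} (hZ : Measurable Z)
  (hγ : ∀ a, ∀ᵐ o ∂(F.obsLaw Q).restrict {o | trt o = a},
    condMean (F.obsLaw Q) {o | trt o = a} Z (fun o => ind (resp o)) (Z o) ∈ Set.Ioo (0 : ℝ) 1)
include hZ hγ

/-- Inverse weighting by the response probability under the observed-data law. -/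
theorem reweights_resp (a : Bool) {u : E → ℝ} (hu : Measurable u)
    (hu0 : ∀ᵐ o ∂(F.obsLaw Q).restrict {o | trt o = a}, 0 ≤ u (Z o)) :
    Reweights (F.obsLaw Q) Z {o | trt o = a} u {o | trt o = a ∧ resp o = true}
      (fun z => u z / condMean (F.obsLaw Q) {o | trt o = a} Z (fun o => ind (resp o)) z) := by
  have := isProbabilityMeasure_obsLaw (F := F) (Q := Q)
  exact (isCondProb_condMean hZ measurable_resp ((hγ a).mono fun o ho => ho.1.le)).reweights
    measurable_condMean hu ((hγ a).mono fun o ho => ho.1) hu0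

variable [StandardBorelSpace Ω₀]

/-- Inverse weighting by the response probability under the joint law of the regressors and the
possibly missing outcome, which is where missingness at random enters. -/
theorem reweights_resp_full (e : E × Bool ≃ᵐ β) {V : Ω₀ → β} (hV : Measurable V)
    (hVe : ∀ ω, V ω = e (Z (F.obs ω), F.A ω))
    (hmar : CondIndepFun (MeasurableSpace.comap V inferInstance) hV.comap_le F.Y0 F.R0 Q)
    (a : Bool) {u : E → ℝ} (hu : Measurable u)
    (hu0 : ∀ᵐ o ∂(F.obsLaw Q).restrict {o | trt o = a}, 0 ≤ u (Z o)) :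
    Reweights Q (fun ω => (Z (F.obs ω), F.Y0 ω)) {ω | F.A ω = a} (fun v => u v.1)
      ({ω | F.A ω = a} ∩ {ω | F.R0 ω = true})
      (fun v => u v.1 / condMean (F.obsLaw Q) {o | trt o = a} Z (fun o => ind (resp o)) v.1) := by
  have := isProbabilityMeasure_obsLaw (F := F) (Q := Q)
  have hset (a : Bool) : MeasurableSet {o : Obs p | trt o = a} :=
    measurableSet_bool_eq measurable_trt a
  have h1 (a : Bool) : IsCondProb Q {ω | F.A ω = a} (fun ω => Z (F.obs ω)) F.R0
      (fun z => condMean (F.obsLaw Q) {o | trt o = a} Z (fun o => ind (resp o)) z) :=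
    (isCondProb_condMean hZ measurable_resp ((hγ a).mono fun o ho => ho.1.le)).of_obsLaw
      (hset a) hZ measurable_resp measurable_condMean
  have h5 := isCondProb_resp_of_condIndepFun
    (γ := fun z a => condMean (F.obsLaw Q) {o | trt o = a} Z (fun o => ind (resp o)) z)
    (fun a => measurable_condMean) h1 e hV hVe hmar a
  have pull {q : Obs p → Prop} (hq : ∀ᵐ o ∂(F.obsLaw Q).restrict {o | trt o = a}, q o) :
      ∀ᵐ ω ∂Q.restrict {ω | F.A ω = a}, q (F.obs ω) := by
    rw [FullData.obsLaw, Measure.restrict_map measurable_obs (hset a)] at hq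
    exact ae_of_ae_map measurable_obs.aemeasurable hq
  exact h5.reweights (measurable_condMean.comp measurable_fst) (hu.comp measurable_fst)
    (pull ((hγ a).mono fun o ho => ho.1)) (pull hu0)

/-- The observed pre-treatment outcomes, weighted by the inverse response probability, represent
all of them. -/
theorem weighted_pre (e : E × Bool ≃ᵐ β) {V : Ω₀ → β} (hV : Measurable V)
    (hVe : ∀ ω, V ω = e (Z (F.obs ω), F.A ω))
    (hmar : CondIndepFun (MeasurableSpace.comap V inferInstance) hV.comap_le F.Y0 F.R0 Q)
    (a : Bool) {u : E → ℝ} (hu : Measurable u)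
    (hu0 : ∀ᵐ o ∂(F.obsLaw Q).restrict {o | trt o = a}, 0 ≤ u (Z o)) :
    (IntegrableOn (fun ω => u (Z (F.obs ω)) * F.Y0 ω) {ω | F.A ω = a} Q ↔
      IntegrableOn (fun o => u (Z o) / condMean (F.obsLaw Q) {o | trt o = a} Z
        (fun o => ind (resp o)) (Z o) * pre o) {o | trt o = a ∧ resp o = true} (F.obsLaw Q)) ∧
    ∫ ω in {ω | F.A ω = a}, u (Z (F.obs ω)) * F.Y0 ω ∂Q
      = ∫ o in {o | trt o = a ∧ resp o = true}, u (Z o) / condMean (F.obsLaw Q) {o | trt o = a} Z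
        (fun o => ind (resp o)) (Z o) * pre o ∂(F.obsLaw Q) := by
  have hr := reweights_resp_full hZ hγ e hV hVe hmar a hu hu0
  have hpair : Measurable fun ω => (Z (F.obs ω), F.Y0 ω) :=
    (hZ.comp measurable_obs).prodMk F.measurable_Y0
  have h1 := hr.integrableOn_iff hpair (k := fun v => v.2) measurable_snd
  have h2 := hr.setIntegral_eq hpair (k := fun v => v.2) measurable_snd
  have hB : MeasurableSet {o : Obs p | trt o = a ∧ resp o = true} :=
    (measurableSet_bool_eq measurable_trt a).inter (measurableSet_bool_eq measurable_resp true)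
  have hG : Measurable fun o => u (Z o) / condMean (F.obsLaw Q) {o | trt o = a} Z
        (fun o => ind (resp o)) (Z o) * pre o :=
    ((hu.comp hZ).div (measurable_condMean.comp hZ)).mul measurable_pre
  have hset : F.obs ⁻¹' {o : Obs p | trt o = a ∧ resp o = true}
      = {ω | F.A ω = a} ∩ {ω | F.R0 ω = true} := rfl
  have hB' : MeasurableSet ({ω | F.A ω = a} ∩ {ω | F.R0 ω = true}) :=
    (measurableSet_bool_eq F.measurable_A a).inter (measurableSet_bool_eq F.measurable_R0 true)
  have hpre : ∀ ω ∈ {ω | F.A ω = a} ∩ {ω | F.R0 ω = true}, pre (F.obs ω) = F.Y0 ω := by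
    intro ω hω
    have : F.R0 ω = true := hω.2
    simp [pre, FullData.obs, this, ind]
  rw [integrableOn_obsLaw_iff hB hG, setIntegral_obsLaw hB hG, hset]
  constructor
  · rw [h1]
    refine integrableOn_congr_fun (fun ω hω => ?_) hB'
    simp only [hpre ω hω]
  · rw [h2]
    refine setIntegral_congr_fun hB' fun ω hω => ?_
    simp only [hpre ω hω]

end MissingAtRandom

/-- The average treatment effect on the treated under the observed treatment fraction. -/
theorem att_eq : F.att Q
    = (∫ ω in {ω | F.A ω = true}, (F.Y11 ω - F.Y10 ω) ∂Q) / meanTrt (F.obsLaw Q) := by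
  have hm : (F.obsLaw Q).real {o | trt o = true} = Q.real {ω | F.A ω = true} := by
    rw [FullData.obsLaw, map_measureReal_apply measurable_obs
      (measurableSet_bool_eq measurable_trt true)]
    rfl
  rw [meanTrt_eq, hm, FullData.att, ProbabilityTheory.cond, integral_smul_measure,
    ENNReal.toReal_inv, smul_eq_mul, Measure.real, inv_mul_eq_div]

end Identification

/-! ### The gradient of the identified parameter -/

section Gradient

variable {p : ℕ} {P : Measure (Obs p)} {g : Obs p → ℝ}

theorem measurableSet_trt (a : Bool) : MeasurableSet {o : Obs p | trt o = a} :=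
  measurableSet_bool_eq measurable_trt a

theorem integral_ind_trt_mul (G : Obs p → ℝ) :
    ∫ o, ind (trt o) * G o ∂P = ∫ o in {o | trt o = true}, G o ∂P := by
  rw [← integral_indicator (measurableSet_trt true)]
  refine integral_congr_ae (Eventually.of_forall fun o => ?_)
  by_cases ho : trt o = true <;> simp [ind, ho]

theorem target_eq (S : Scheme p) : S.target P
    = (∫ o in {o | trt o = true}, S.plug (S.truth P) o ∂P) / meanTrt P := by
  rw [Scheme.target, ← integral_ind_trt_mul, ← integral_div]
  refine integral_congr_ae (Eventually.of_forall fun o => ?_)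
  simp only
  ring

theorem setIntegral_resp (a : Bool) (G : Obs p → ℝ) :
    ∫ o in {o | trt o = a}, ind (resp o) * G o ∂P
      = ∫ o in {o | trt o = a ∧ resp o = true}, G o ∂P := by
  have hR : MeasurableSet {o : Obs p | resp o = true} := measurableSet_bool_eq measurable_resp true
  have : {o : Obs p | trt o = a ∧ resp o = true} = {o | resp o = true} ∩ {o | trt o = a} := by
    ext o
    exact and_comm
  rw [this, ← Measure.restrict_restrict hR, ← integral_indicator hR]
  refine integral_congr_ae (Eventually.of_forall fun o => ?_)
  by_cases ho : resp o = true <;> simp [ind, ho]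

theorem integrableOn_resp_iff (a : Bool) {G : Obs p → ℝ} :
    IntegrableOn (fun o => ind (resp o) * G o) {o | trt o = a} P ↔
      IntegrableOn G {o | trt o = a ∧ resp o = true} P := by
  have hR : MeasurableSet {o : Obs p | resp o = true} := measurableSet_bool_eq measurable_resp true
  have h1 : {o : Obs p | trt o = a ∧ resp o = true} = {o | resp o = true} ∩ {o | trt o = a} := by
    ext o
    exact and_comm
  have h2 : (fun o => ind (resp o) * G o) = {o | resp o = true}.indicator G := by
    ext o
    by_cases ho : resp o = true <;> simp [ind, ho]
  rw [h1, h2, IntegrableOn, integrable_indicator_iff hR, IntegrableOn, IntegrableOn,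
    Measure.restrict_restrict hR]

variable [IsProbabilityMeasure P]

theorem meanTrt_submodel (hg : IsScore P g) {t : ℝ} (ht : ∀ o, |t * g o| ≤ 1 / 2) :
    meanTrt (submodel P g t) = meanTrt P + t * ∫ o, g o * ind (trt o) ∂P := by
  have h := setIntegral_submodel_eq_add (B := Set.univ) hg ht
    (integrableOn_ind measurable_trt)
  simp only [Measure.restrict_univ] at h
  exact h

/-- Quotient rule: a gradient of the numerator `E[A plug]` of the parameter gives one of the
parameter, the influence function. -/
theorem hasDerivAt_target {S : Scheme p} {θ : ℝ} (hP : 0 < meanTrt P) (hg : IsScore P g)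
    (hθ : θ = S.target P) (hφ : Integrable (S.eif P θ) P)
    (hN : HasDerivAt (fun t => ∫ o in {o | trt o = true},
        S.plug (S.truth (submodel P g t)) o ∂(submodel P g t))
      (∫ o, g o * S.moment (S.truth P) o ∂P) 0) :
    HasDerivAt (fun t => S.target (submodel P g t)) (∫ o, g o * S.eif P θ o ∂P) 0 := by
  obtain ⟨K, hK⟩ := hg.2.1
  have hi : Integrable (fun o : Obs p => ind (trt o)) P := by
    rw [← integrableOn_univ]
    exact integrableOn_ind measurable_trt
  have hgi : Integrable (fun o => g o * ind (trt o)) P :=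
    hi.bdd_mul hg.1.aestronglyMeasurable (Eventually.of_forall hK)
  have hgφ : Integrable (fun o => g o * S.eif P θ o) P :=
    hφ.bdd_mul hg.1.aestronglyMeasurable (Eventually.of_forall hK)
  have hD : HasDerivAt (fun t => meanTrt (submodel P g t)) (∫ o, g o * ind (trt o) ∂P) 0 := by
    have h1 := (hasDerivAt_mul_of_tendsto (tendsto_const_nhds
      (x := ∫ o, g o * ind (trt o) ∂P))).const_add (meanTrt P)
    refine h1.congr_of_eventuallyEq ?_
    filter_upwards [hg.eventually_small] with t ht
    exact meanTrt_submodel hg ht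
  have h0 : meanTrt (submodel P g 0) ≠ 0 := by
    rw [submodel_zero]
    exact hP.ne'
  simp only [target_eq]
  refine (hN.div hD h0).congr_deriv ?_
  rw [target_eq] at hθ
  have hmom : ∫ o, g o * S.moment (S.truth P) o ∂P
      = meanTrt P * ∫ o, g o * S.eif P θ o ∂P + θ * ∫ o, g o * ind (trt o) ∂P := by
    rw [← integral_const_mul, ← integral_const_mul, ← integral_add (hgφ.const_mul _)
      (hgi.const_mul _)]
    refine integral_congr_ae (Eventually.of_forall fun o => ?_)
    simp only [Scheme.eif, Scheme.phi]
    field_simp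
    ring
  rw [hmom, submodel_zero, hθ]
  field_simp
  ring

/-- The integral of a score against the moment function, decomposed into the contributions of the
treated and the untreated, respondents and all. -/
theorem integral_score_mul_moment (hg : IsScore P g) {M y a b c r₁ r₀ τ σ : Obs p → ℝ}
    (hM : ∀ o, M o = ind (trt o) * (y o - (a o + ind (resp o) * r₁ o) - b o + c o)
      - (1 - ind (trt o)) * (τ o - ind (resp o) * r₀ o + σ o))
    (hy : IntegrableOn y {o | trt o = true} P) (ha : IntegrableOn a {o | trt o = true} P)
    (hb : IntegrableOn b {o | trt o = true} P) (hc : IntegrableOn c {o | trt o = true} P)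
    (hr₁ : IntegrableOn r₁ {o | trt o = true ∧ resp o = true} P)
    (hr₀ : IntegrableOn r₀ {o | trt o = false ∧ resp o = true} P)
    (hτ : IntegrableOn τ {o | trt o = false} P) (hσ : IntegrableOn σ {o | trt o = false} P) :
    ∫ o, g o * M o ∂P = ∫ o in {o | trt o = true}, g o * y o ∂P
      - (∫ o in {o | trt o = true ∧ resp o = true}, g o * r₁ o ∂P
        + ∫ o in {o | trt o = true}, g o * a o ∂P)
      - (∫ o in {o | trt o = false}, g o * τ o ∂P + ∫ o in {o | trt o = true}, g o * b o ∂P)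
      + (∫ o in {o | trt o = false ∧ resp o = true}, g o * r₀ o ∂P
        - ∫ o in {o | trt o = false}, g o * σ o ∂P
        + ∫ o in {o | trt o = true}, g o * c o ∂P) := by
  obtain ⟨K, hK⟩ := hg.2.1
  have s {G : Obs p → ℝ} {B : Set (Obs p)} (hG : IntegrableOn G B P) :
      IntegrableOn (fun o => g o * G o) B P := IntegrableOn.score_mul hg.1 hK hG
  have hr₁' := (integrableOn_resp_iff true).2 (s hr₁)
  have hr₀' := (integrableOn_resp_iff false).2 (s hr₀)
  have hc1 : {o : Obs p | trt o = true}ᶜ = {o | trt o = false} := by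
    ext o
    simp
  have e1 : Set.EqOn (fun o => g o * M o) (fun o => g o * y o
      - (ind (resp o) * (g o * r₁ o) + g o * a o) - g o * b o + g o * c o)
      {o : Obs p | trt o = true} := by
    intro o (ho : trt o = true)
    simp only [hM, ho, ind, if_true]
    ring
  have e0 : Set.EqOn (fun o => g o * M o) (fun o => ind (resp o) * (g o * r₀ o) - g o * τ o
      - g o * σ o) {o : Obs p | trt o = false} := by
    intro o (ho : trt o = false)
    simp only [hM, ho, ind, Bool.false_eq_true, if_false]
    ring
  have j1 : IntegrableOn (fun o => ind (resp o) * (g o * r₁ o) + g o * a o)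
      {o : Obs p | trt o = true} P := hr₁'.add (s ha)
  have j2 : IntegrableOn (fun o => g o * y o - (ind (resp o) * (g o * r₁ o) + g o * a o))
      {o : Obs p | trt o = true} P := (s hy).sub j1
  have j3 : IntegrableOn (fun o => g o * y o
      - (ind (resp o) * (g o * r₁ o) + g o * a o) - g o * b o)
      {o : Obs p | trt o = true} P := j2.sub (s hb)
  have i1 : IntegrableOn (fun o => g o * y o
      - (ind (resp o) * (g o * r₁ o) + g o * a o) - g o * b o + g o * c o)
      {o : Obs p | trt o = true} P := j3.add (s hc)
  have j0 : IntegrableOn (fun o => ind (resp o) * (g o * r₀ o) - g o * τ o)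
      {o : Obs p | trt o = false} P := hr₀'.sub (s hτ)
  have i0 : IntegrableOn (fun o => ind (resp o) * (g o * r₀ o) - g o * τ o - g o * σ o)
      {o : Obs p | trt o = false} P := j0.sub (s hσ)
  have i1' := i1.congr_fun e1.symm (measurableSet_trt true)
  have i0' := i0.congr_fun e0.symm (measurableSet_trt false)
  have hint : Integrable (fun o => g o * M o) P := by
    rw [← integrableOn_univ, ← Set.union_compl_self {o : Obs p | trt o = true}, hc1]
    exact i1'.union i0'
  rw [← integral_add_compl (measurableSet_trt true) hint, hc1,
    setIntegral_congr_fun (measurableSet_trt true) e1,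
    setIntegral_congr_fun (measurableSet_trt false) e0,
    integral_add j3 (s hc), integral_sub j2 (s hb), integral_sub (s hy) j1,
    integral_add hr₁' (s ha), integral_sub j0 (s hσ), integral_sub hr₀' (s hτ),
    setIntegral_resp, setIntegral_resp]
  ring

/-- The numerator `∫ A (Y₁ - a - (b - c))` of the parameter along a submodel. -/
theorem hasDerivAt_numerator (hg : IsScore P g) {y : Obs p → ℝ} {a b c : ℝ → Obs p → ℝ}
    {d₁ d₂ d₃ : ℝ} {B : Set (Obs p)} (hy : IntegrableOn y B P)
    (ha : ∀ᶠ t in 𝓝 0, IntegrableOn (fun o => 1 * a t o) B P)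
    (hb : ∀ᶠ t in 𝓝 0, IntegrableOn (fun o => 1 * b t o) B P)
    (hc : ∀ᶠ t in 𝓝 0, IntegrableOn (fun o => 1 * c t o) B P)
    (hda : HasDerivAt (fun t => ∫ o in B, 1 * a t o ∂(submodel P g t)) d₁ 0)
    (hdb : HasDerivAt (fun t => ∫ o in B, 1 * b t o ∂(submodel P g t)) d₂ 0)
    (hdc : HasDerivAt (fun t => ∫ o in B, 1 * c t o ∂(submodel P g t)) d₃ 0) :
    HasDerivAt (fun t => ∫ o in B, ((y o - a t o) - (b t o - c t o)) ∂(submodel P g t))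
      (∫ o in B, g o * y o ∂P - d₁ - d₂ + d₃) 0 := by
  have hdy := (hasDerivAt_mul_of_tendsto (tendsto_const_nhds
    (x := ∫ o in B, g o * y o ∂P))).const_add (∫ o in B, y o ∂P)
  refine (((hdy.sub hda).sub hdb).add hdc).congr_of_eventuallyEq ?_
  filter_upwards [hg.eventually_small, ha, hb, hc] with t ht ha hb hc
  simp only [one_mul] at ha hb hc
  have iff (F : Obs p → ℝ) : IntegrableOn F B (submodel P g t) ↔ IntegrableOn F B P :=
    integrableOn_submodel_iff hg.1 ht
  have hy' := (iff _).2 hy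
  have ha' := (iff _).2 ha
  have hb' := (iff _).2 hb
  have hc' := (iff _).2 hc
  simp only [Pi.add_apply, Pi.sub_apply, one_mul]
  have j1 : IntegrableOn (fun o => y o - a t o) B (submodel P g t) := hy'.sub ha'
  have j2 : IntegrableOn (fun o => b t o - c t o) B (submodel P g t) := hb'.sub hc'
  rw [integral_sub j1 j2, integral_sub hy' ha', integral_sub hb' hc',
    ← setIntegral_submodel_eq_add hg ht hy]
  ring

end Gradient

/-! ### The two missingness regimes -/

section Regimes

/-- Odds of treatment given the covariates. -/
def odds {p : ℕ} (P : Measure (Obs p)) (x : Fin p → ℝ) : ℝ := truePi P x / (1 - truePi P x)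

variable {p : ℕ} {Ω₀ : Type*} [MeasurableSpace Ω₀] {F : FullData p Ω₀} {Q : Measure Ω₀}

theorem measurable_odds {P : Measure (Obs p)} : Measurable (odds P) :=
  Measurable.div measurable_condMean (measurable_const.sub measurable_condMean)

theorem measurable_odds_mul_post {P : Measure (Obs p)} :
    Measurable fun o => odds P (cov o) * post o :=
  (measurable_odds.comp measurable_cov).mul measurable_post

theorem integrable_pre (hY0 : Integrable F.Y0 Q) : Integrable pre (F.obsLaw Q) := by
  rw [← integrableOn_univ, integrableOn_obsLaw_iff MeasurableSet.univ measurable_pre,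
    Set.preimage_univ, integrableOn_univ]
  refine hY0.bdd_mul (c := 1) (measurable_ind.comp F.measurable_R0).aestronglyMeasurable
    (Eventually.of_forall fun ω => ?_)
  rw [Real.norm_of_nonneg (ind_nonneg _)]
  exact ind_le_one _

theorem integrable_Y1 (hY10 : Integrable F.Y10 Q) (hY11 : Integrable F.Y11 Q) :
    Integrable F.Y1 Q := by
  have hm := measurable_ind.comp F.measurable_A
  refine (hY11.bdd_mul (c := 1) hm.aestronglyMeasurable (Eventually.of_forall fun ω => ?_)).add
    (hY10.bdd_mul (c := 1) (measurable_const.sub hm).aestronglyMeasurable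
      (Eventually.of_forall fun ω => ?_))
  · rw [Function.comp_apply, Real.norm_of_nonneg (ind_nonneg _)]
    exact ind_le_one _
  · rw [Real.norm_of_nonneg (sub_nonneg.2 (ind_le_one _))]
    change 1 - ind (F.A ω) ≤ 1
    linarith [ind_nonneg (F.A ω)]

theorem integrable_post (hY10 : Integrable F.Y10 Q) (hY11 : Integrable F.Y11 Q) :
    Integrable post (F.obsLaw Q) := by
  rw [← integrableOn_univ, integrableOn_obsLaw_iff MeasurableSet.univ measurable_post,
    Set.preimage_univ, integrableOn_univ]
  exact integrable_Y1 hY10 hY11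

theorem integrableOn_odds_mul {Y : Ω₀ → ℝ}
    (h : Integrable (fun ω => (1 - ind (F.A ω)) * truePi (F.obsLaw Q) (F.X ω)
      / (1 - truePi (F.obsLaw Q) (F.X ω)) * Y ω) Q) :
    IntegrableOn (fun ω => odds (F.obsLaw Q) (F.X ω) * Y ω) {ω | F.A ω = false} Q := by
  refine h.integrableOn.congr_fun (fun ω (hω : F.A ω = false) => ?_)
    (measurableSet_bool_eq F.measurable_A false)
  simp [odds, hω, ind]

theorem integrableOn_odds_post
    (h1 : IntegrableOn (fun ω => odds (F.obsLaw Q) (F.X ω) * F.Y1 ω) {ω | F.A ω = false} Q) :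
    IntegrableOn (fun o => odds (F.obsLaw Q) (cov o) * post o) {o | trt o = false}
      (F.obsLaw Q) := by
  rw [integrableOn_obsLaw_iff (measurableSet_trt false) measurable_odds_mul_post]
  exact h1

theorem ae_restrict_obsLaw {a : Bool} {q : Obs p → Prop} (hq : MeasurableSet {o | q o})
    (h : ∀ᵐ ω ∂Q, F.A ω = a → q (F.obs ω)) :
    ∀ᵐ o ∂(F.obsLaw Q).restrict {o | trt o = a}, q o := by
  rw [FullData.obsLaw, Measure.restrict_map measurable_obs (measurableSet_trt a),
    ae_map_iff measurable_obs.aemeasurable hq]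
  exact (ae_restrict_iff' (measurableSet_bool_eq F.measurable_A a)).2 h

variable [StandardBorelSpace Ω₀] [IsProbabilityMeasure Q]

theorem MARIndep.gamma_mem (hmar : MARIndep F Q) (a : Bool) :
    ∀ᵐ o ∂(F.obsLaw Q).restrict {o | trt o = a}, condMean (F.obsLaw Q) {o | trt o = a} cov
      (fun o => ind (resp o)) (cov o) ∈ Set.Ioo (0 : ℝ) 1 :=
  ae_restrict_obsLaw ((measurable_condMean.comp measurable_cov) measurableSet_Ioo)
    (hmar.weak_overlap.mono fun _ h _ => h a)

theorem MARDep.gamma_mem (hmar : MARDep F Q) (a : Bool) :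
    ∀ᵐ o ∂(F.obsLaw Q).restrict {o | trt o = a}, condMean (F.obsLaw Q) {o | trt o = a}
      (fun o => (cov o, post o)) (fun o => ind (resp o)) (cov o, post o) ∈ Set.Ioo (0 : ℝ) 1 :=
  ae_restrict_obsLaw ((measurable_condMean.comp (measurable_cov.prodMk measurable_post))
    measurableSet_Ioo) (hmar.weak_overlap.mono fun _ h ha => ha ▸ h)

/-- The respondents' regression function of the pre-treatment outcome represents, in weighted
means over a treatment arm, the pre-treatment outcomes of everyone. -/
theorem setIntegral_mul_regression_pre {E : Type*} [MeasurableSpace E] {β : Type*}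
    [MeasurableSpace β] {Z : Obs p → E} (hZ : Measurable Z)
    (hγ : ∀ a, ∀ᵐ o ∂(F.obsLaw Q).restrict {o | trt o = a},
      condMean (F.obsLaw Q) {o | trt o = a} Z (fun o => ind (resp o)) (Z o) ∈ Set.Ioo (0 : ℝ) 1)
    (e : E × Bool ≃ᵐ β) {V : Ω₀ → β} (hV : Measurable V)
    (hVe : ∀ ω, V ω = e (Z (F.obs ω), F.A ω))
    (hmar : CondIndepFun (MeasurableSpace.comap V inferInstance) hV.comap_le F.Y0 F.R0 Q)
    (hY0 : Integrable F.Y0 Q) (a : Bool) {u : E → ℝ} (hu : Measurable u)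
    (hu0 : ∀ᵐ o ∂(F.obsLaw Q).restrict {o | trt o = a}, 0 ≤ u (Z o))
    (huY : IntegrableOn (fun ω => u (Z (F.obs ω)) * F.Y0 ω) {ω | F.A ω = a} Q) :
    IntegrableOn (fun o => u (Z o) / condMean (F.obsLaw Q) {o | trt o = a} Z
      (fun o => ind (resp o)) (Z o) * pre o) {o | trt o = a ∧ resp o = true} (F.obsLaw Q) ∧
    IntegrableOn (fun o => u (Z o) / condMean (F.obsLaw Q) {o | trt o = a} Z
      (fun o => ind (resp o)) (Z o) * condMean (F.obsLaw Q) {o | trt o = a ∧ resp o = true} Z pre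
        (Z o)) {o | trt o = a ∧ resp o = true} (F.obsLaw Q) ∧
    IntegrableOn (fun o => u (Z o) * condMean (F.obsLaw Q) {o | trt o = a ∧ resp o = true} Z pre
      (Z o)) {o | trt o = a} (F.obsLaw Q) ∧
    ∫ o in {o | trt o = a}, u (Z o) * condMean (F.obsLaw Q) {o | trt o = a ∧ resp o = true} Z pre
      (Z o) ∂(F.obsLaw Q) = ∫ ω in {ω | F.A ω = a}, u (Z (F.obs ω)) * F.Y0 ω ∂Q := by
  have := isProbabilityMeasure_obsLaw (F := F) (Q := Q)
  obtain ⟨h1, h2⟩ := weighted_pre hZ hγ e hV hVe hmar a hu hu0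
  have hr := reweights_resp hZ hγ a hu hu0
  have hpre := (integrable_pre hY0).integrableOn (s := {o | trt o = a ∧ resp o = true})
  have h3 := h1.1 huY
  have h4 := integrableOn_mul_condMean hZ hr.measurable_right hpre h3
  refine ⟨h3, h4, (hr.integrableOn_iff hZ measurable_condMean).2 h4, ?_⟩
  rw [hr.setIntegral_eq hZ measurable_condMean, h2,
    setIntegral_mul_condMean hZ hr.measurable_right hpre h3]

/-- Identification of the effect on the treated, given regression functions that represent the
respective outcomes. -/
theorem att_eq_of_setIntegral_eq (hY0 : Integrable F.Y0 Q) (hY10 : Integrable F.Y10 Q)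
    (hY11 : Integrable F.Y11 Q) (hid : Identifiability F Q)
    (h0 : IntegrableOn (fun ω => odds (F.obsLaw Q) (F.X ω) * F.Y0 ω) {ω | F.A ω = false} Q)
    (h1 : IntegrableOn (fun ω => odds (F.obsLaw Q) (F.X ω) * F.Y1 ω) {ω | F.A ω = false} Q)
    {a b c : Obs p → ℝ} (ha : IntegrableOn a {o | trt o = true} (F.obsLaw Q))
    (hb : IntegrableOn b {o | trt o = true} (F.obsLaw Q))
    (hc : IntegrableOn c {o | trt o = true} (F.obsLaw Q))
    (ea : ∫ o in {o | trt o = true}, a o ∂(F.obsLaw Q) = ∫ ω in {ω | F.A ω = true}, F.Y0 ω ∂Q)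
    (eb : ∫ o in {o | trt o = true}, b o ∂(F.obsLaw Q)
      = ∫ o in {o | trt o = false}, odds (F.obsLaw Q) (cov o) * post o ∂(F.obsLaw Q))
    (ec : ∫ o in {o | trt o = true}, c o ∂(F.obsLaw Q)
      = ∫ ω in {ω | F.A ω = false}, odds (F.obsLaw Q) (F.X ω) * F.Y0 ω ∂Q) :
    F.att Q = (∫ o in {o | trt o = true}, ((post o - a o) - (b o - c o)) ∂(F.obsLaw Q))
      / meanTrt (F.obsLaw Q) := by
  have hAt := measurableSet_bool_eq F.measurable_A true
  have hAf := measurableSet_bool_eq F.measurable_A false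
  have hpost := (integrable_post hY10 hY11).integrableOn (s := {o | trt o = true})
  have e1 : ∫ o in {o | trt o = true}, post o ∂(F.obsLaw Q)
      = ∫ ω in {ω | F.A ω = true}, F.Y11 ω ∂Q := by
    rw [setIntegral_obsLaw (measurableSet_trt true) measurable_post]
    refine setIntegral_congr_fun hAt fun ω (hω : F.A ω = true) => ?_
    simp [post, FullData.obs, FullData.Y1, hω, ind]
  have hY : Set.EqOn (fun ω => odds (F.obsLaw Q) (F.X ω) * F.Y1 ω)
      (fun ω => odds (F.obsLaw Q) (F.X ω) * F.Y10 ω) {ω | F.A ω = false} := by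
    intro ω (hω : F.A ω = false)
    simp [FullData.Y1, hω, ind]
  have e2 : ∫ o in {o | trt o = false}, odds (F.obsLaw Q) (cov o) * post o ∂(F.obsLaw Q)
      = ∫ ω in {ω | F.A ω = false}, odds (F.obsLaw Q) (F.X ω) * F.Y10 ω ∂Q := by
    rw [setIntegral_obsLaw (measurableSet_trt false) measurable_odds_mul_post]
    exact setIntegral_congr_fun hAf hY
  have h1' := h1.congr_fun hY hAf
  have e3 := setIntegral_trend hid
  change _ = ∫ ω in {ω | F.A ω = false}, odds (F.obsLaw Q) (F.X ω) * (F.Y10 ω - F.Y0 ω) ∂Q at e3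
  simp only [mul_sub] at e3
  rw [integral_sub hY10.integrableOn hY0.integrableOn, integral_sub h1' h0] at e3
  have j1 : IntegrableOn (fun o => post o - a o) {o | trt o = true} (F.obsLaw Q) := hpost.sub ha
  have j2 : IntegrableOn (fun o => b o - c o) {o | trt o = true} (F.obsLaw Q) := hb.sub hc
  rw [att_eq, integral_sub hY11.integrableOn hY10.integrableOn, integral_sub j1 j2,
    integral_sub hpost ha, integral_sub hb hc, ea, eb, ec, e1, e2]
  congr 1
  linarith

section Cases

variable (hY0 : Integrable F.Y0 Q) (hY10 : Integrable F.Y10 Q)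
    (hY11 : Integrable F.Y11 Q) (hid : Identifiability F Q)
    (h0 : IntegrableOn (fun ω => odds (F.obsLaw Q) (F.X ω) * F.Y0 ω) {ω | F.A ω = false} Q)
    (h1 : IntegrableOn (fun ω => odds (F.obsLaw Q) (F.X ω) * F.Y1 ω) {ω | F.A ω = false} Q)
include hY0 hY10 hY11 hid h0 h1

/-- Identification and pathwise derivative under outcome independent missingness. -/
theorem MARIndep.identification_and_gradient (hmar : MARIndep F Q) :
    F.att Q = (schemeI p).target (F.obsLaw Q) ∧
    ∀ g, IsScore (F.obsLaw Q) g → HasDerivAt (fun t => ∫ o in {o | trt o = true},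
        (schemeI p).plug ((schemeI p).truth (submodel (F.obsLaw Q) g t)) o
          ∂(submodel (F.obsLaw Q) g t))
      (∫ o, g o * (schemeI p).moment ((schemeI p).truth (F.obsLaw Q)) o ∂(F.obsLaw Q)) 0 := by
  have := isProbabilityMeasure_obsLaw (F := F) (Q := Q)
  have hpos := hid.positivity
  have hgam := hmar.gamma_mem
  have hV : Measurable fun ω => (F.X ω, F.A ω) := F.measurable_X.prodMk F.measurable_A
  have hpre (B : Set (Obs p)) := (integrable_pre hY0).integrableOn (s := B)
  have hpost (B : Set (Obs p)) := (integrable_post hY10 hY11).integrableOn (s := B)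
  have hopost := integrableOn_odds_post h1
  have hrb : Reweights (F.obsLaw Q) cov {o | trt o = true} (fun _ => 1)
    {o | trt o = false} (odds (F.obsLaw Q)) := reweights_odds_cov hpos
  have hone : ∀ᵐ o ∂(F.obsLaw Q).restrict {o | trt o = true},
      (0 : ℝ) ≤ (fun _ : Fin p → ℝ => (1 : ℝ)) (cov o) :=
    Eventually.of_forall fun _ => zero_le_one
  have hra := reweights_resp measurable_cov hgam true measurable_const hone
  have hrc := hrb.trans (reweights_resp measurable_cov hgam false measurable_odds
    hrb.nonneg_right)
  obtain ⟨a1, a2, a3, a4⟩ := setIntegral_mul_regression_pre measurable_cov hgam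
    (MeasurableEquiv.refl _) hV (fun _ => rfl) hmar.unconfounded hY0 true
    measurable_const hone (by simpa using hY0.integrableOn)
  obtain ⟨c1, c2, c3, c4⟩ := setIntegral_mul_regression_pre measurable_cov hgam
    (MeasurableEquiv.refl _) hV (fun _ => rfl) hmar.unconfounded hY0 false
    measurable_odds hrb.nonneg_right h0
  have b2 := integrableOn_mul_condMean measurable_cov measurable_odds (hpost _) hopost
  have b3 := (hrb.integrableOn_iff measurable_cov measurable_condMean).2 b2
  have b4 := (hrb.setIntegral_eq measurable_cov measurable_condMean).trans
    (setIntegral_mul_condMean measurable_cov measurable_odds (hpost _) hopost)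
  have c5 := (hrb.integrableOn_iff measurable_cov measurable_condMean).2 c3
  have c6 := (hrb.setIntegral_eq measurable_cov measurable_condMean).trans c4
  simp only [one_mul] at a3 a4 b3 b4 c5 c6
  constructor
  · rw [target_eq]
    exact att_eq_of_setIntegral_eq hY0 hY10 hY11 hid h0 h1 a3 b3 c5 a4 b4 c6
  · intro g hg
    have da := hasDerivAt_setIntegral_condMean_const measurable_cov hra hg (hpre _) a1
    have db := hasDerivAt_setIntegral_condMean_const measurable_cov hrb hg (hpost _) hopost
    have dc := hasDerivAt_setIntegral_condMean_const measurable_cov hrc hg (hpre _) c1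
    refine (hasDerivAt_numerator hg (hpost _) da.1 db.1 dc.1 da.2.2 db.2.2 dc.2.2).congr_deriv ?_
    rw [integral_score_mul_moment hg (y := post) (a := fun o => trueMu0I (F.obsLaw Q) (cov o) true)
      (b := fun o => trueMu1 (F.obsLaw Q) (cov o))
      (c := fun o => trueMu0I (F.obsLaw Q) (cov o) false)
      (r₁ := fun o => 1 / trueGammaI (F.obsLaw Q) (cov o) true
        * (pre o - trueMu0I (F.obsLaw Q) (cov o) true))
      (r₀ := fun o => odds (F.obsLaw Q) (cov o) / trueGammaI (F.obsLaw Q) (cov o) false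
        * (pre o - trueMu0I (F.obsLaw Q) (cov o) false))
      (τ := fun o => odds (F.obsLaw Q) (cov o) * (post o - trueMu1 (F.obsLaw Q) (cov o)))
      (σ := fun _ => 0)]
    · simp only [one_mul, mul_zero, integral_zero, sub_zero]
      rfl
    · intro o
      simp only [schemeI, odds]
      ring
    · exact hpost _
    · exact a3
    · exact b3
    · exact c5
    · simp only [mul_sub]
      exact a1.sub a2
    · simp only [mul_sub]
      exact c1.sub c2
    · simp only [mul_sub]
      exact hopost.sub b2
    · exact integrableOn_zero

/-- Identification and pathwise derivative under outcome dependent missingness. -/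
theorem MARDep.identification_and_gradient (hmar : MARDep F Q) :
    F.att Q = (schemeD p).target (F.obsLaw Q) ∧
    ∀ g, IsScore (F.obsLaw Q) g → HasDerivAt (fun t => ∫ o in {o | trt o = true},
        (schemeD p).plug ((schemeD p).truth (submodel (F.obsLaw Q) g t)) o
          ∂(submodel (F.obsLaw Q) g t))
      (∫ o, g o * (schemeD p).moment ((schemeD p).truth (F.obsLaw Q)) o ∂(F.obsLaw Q)) 0 := by
  have := isProbabilityMeasure_obsLaw (F := F) (Q := Q)
  have hpos := hid.positivity
  have hgam := hmar.gamma_mem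
  have hV : Measurable fun ω => (F.X ω, F.Y1 ω, F.A ω) :=
    F.measurable_X.prodMk (F.measurable_Y1.prodMk F.measurable_A)
  have hZ : Measurable fun o : Obs p => (cov o, post o) := measurable_cov.prodMk measurable_post
  have hpre (B : Set (Obs p)) := (integrable_pre hY0).integrableOn (s := B)
  have hpost (B : Set (Obs p)) := (integrable_post hY10 hY11).integrableOn (s := B)
  have hopost := integrableOn_odds_post h1
  have hrb : Reweights (F.obsLaw Q) cov {o | trt o = true} (fun _ => 1)
    {o | trt o = false} (odds (F.obsLaw Q)) := reweights_odds_cov hpos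
  have hone (a : Bool) : ∀ᵐ o ∂(F.obsLaw Q).restrict {o | trt o = a},
      (0 : ℝ) ≤ (fun _ : (Fin p → ℝ) × ℝ => (1 : ℝ)) (cov o, post o) :=
    Eventually.of_forall fun _ => zero_le_one
  have hom : Measurable fun z : (Fin p → ℝ) × ℝ => odds (F.obsLaw Q) z.1 :=
    measurable_odds.comp measurable_fst
  have hra := reweights_resp hZ hgam true measurable_const (hone true)
  -- reweighting of the regressors `(X, Y₁)` of the inner regression, without and with the odds
  have hri := reweights_resp hZ hgam false measurable_const (hone false)
  have hro := reweights_resp hZ hgam false hom hrb.nonneg_right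
  obtain ⟨a1, a2, a3, a4⟩ := setIntegral_mul_regression_pre hZ hgam
    MeasurableEquiv.prodAssoc hV (fun _ => rfl) hmar.unconfounded hY0 true
    measurable_const (hone true) (by simpa using hY0.integrableOn)
  obtain ⟨i1, -, i3, -⟩ := setIntegral_mul_regression_pre hZ hgam
    MeasurableEquiv.prodAssoc hV (fun _ => rfl) hmar.unconfounded hY0 false
    measurable_const (hone false) (by simpa using hY0.integrableOn)
  obtain ⟨c1, c2, c3, c4⟩ := setIntegral_mul_regression_pre hZ hgam
    MeasurableEquiv.prodAssoc hV (fun _ => rfl) hmar.unconfounded hY0 false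
    hom hrb.nonneg_right h0
  have b2 := integrableOn_mul_condMean measurable_cov measurable_odds (hpost _) hopost
  have b3 := (hrb.integrableOn_iff measurable_cov measurable_condMean).2 b2
  have b4 := (hrb.setIntegral_eq measurable_cov measurable_condMean).trans
    (setIntegral_mul_condMean measurable_cov measurable_odds (hpost _) hopost)
  simp only [one_mul] at a3 a4 b3 b4 i3
  have e2 := integrableOn_mul_condMean measurable_cov measurable_odds i3 c3
  have e3 := (hrb.integrableOn_iff measurable_cov measurable_condMean).2 e2
  have e4 := ((hrb.setIntegral_eq measurable_cov measurable_condMean).trans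
    (setIntegral_mul_condMean measurable_cov measurable_odds i3 c3)).trans c4
  simp only [one_mul] at e3 e4
  constructor
  · rw [target_eq]
    exact att_eq_of_setIntegral_eq hY0 hY10 hY11 hid h0 h1 a3 b3 e3 a4 b4 e4
  · intro g hg
    obtain ⟨K, hK⟩ := hg.2.1
    have da := hasDerivAt_setIntegral_condMean_const hZ hra hg (hpre _) a1
    have db := hasDerivAt_setIntegral_condMean_const measurable_cov hrb hg (hpost _) hopost
    have di := hasDerivAt_setIntegral_condMean_const hZ hri hg (hpre _) i1
    have dm := hasDerivAt_setIntegral_condMean_const hZ hro hg (hpre _) c1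
    have dc := hasDerivAt_setIntegral_condMean measurable_cov hrb hg
      (W := fun t o => trueMu0D (submodel (F.obsLaw Q) g t) (cov o) (post o) false)
      (by simp only [one_mul] at di; exact di.1) dm.1
      (by simp only [submodel_zero]; exact dm.2.1) dm.2.2
    simp only [submodel_zero] at dc
    refine (hasDerivAt_numerator hg (hpost _) da.1 db.1 dc.1 da.2.2 db.2.2 dc.2.2).congr_deriv ?_
    have s {G : Obs p → ℝ} {B : Set (Obs p)} (hG : IntegrableOn G B (F.obsLaw Q)) :
        IntegrableOn (fun o => g o * G o) B (F.obsLaw Q) := IntegrableOn.score_mul hg.1 hK hG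
    rw [integral_score_mul_moment hg (y := post)
      (a := fun o => trueMu0D (F.obsLaw Q) (cov o) (post o) true)
      (b := fun o => trueMu1 (F.obsLaw Q) (cov o))
      (c := fun o => trueEta (F.obsLaw Q) (cov o))
      (r₁ := fun o => 1 / trueGammaD (F.obsLaw Q) (cov o) (post o) true
        * (pre o - trueMu0D (F.obsLaw Q) (cov o) (post o) true))
      (r₀ := fun o => odds (F.obsLaw Q) (cov o) / trueGammaD (F.obsLaw Q) (cov o) (post o) false
        * (pre o - trueMu0D (F.obsLaw Q) (cov o) (post o) false))
      (τ := fun o => odds (F.obsLaw Q) (cov o) * (post o - trueMu1 (F.obsLaw Q) (cov o)))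
      (σ := fun o => odds (F.obsLaw Q) (cov o) * trueEta (F.obsLaw Q) (cov o)
        - odds (F.obsLaw Q) (cov o) * trueMu0D (F.obsLaw Q) (cov o) (post o) false)]
    · have hσ : ∫ o in {o | trt o = false}, g o * (odds (F.obsLaw Q) (cov o)
            * trueEta (F.obsLaw Q) (cov o)
          - odds (F.obsLaw Q) (cov o) * trueMu0D (F.obsLaw Q) (cov o) (post o) false)
            ∂(F.obsLaw Q)
          = ∫ o in {o | trt o = false}, g o * (odds (F.obsLaw Q) (cov o)
            * trueEta (F.obsLaw Q) (cov o)) ∂(F.obsLaw Q)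
          - ∫ o in {o | trt o = false}, g o * (odds (F.obsLaw Q) (cov o)
            * trueMu0D (F.obsLaw Q) (cov o) (post o) false) ∂(F.obsLaw Q) := by
        refine Eq.trans ?_ (integral_sub (s e2) (s c3))
        simp only [mul_sub, trueEta, trueMu0D]
      rw [hσ]
      simp only [one_mul]
      simp only [trueMu0D, trueGammaD, trueMu1, trueEta]
      ring
    · intro o
      simp only [schemeD, odds]
      ring
    · exact hpost _
    · exact a3
    · exact b3
    · exact e3
    · simp only [mul_sub]
      exact a1.sub a2
    · simp only [mul_sub]
      exact c1.sub c2
    · simp only [mul_sub]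
      exact hopost.sub b2
    · exact e2.sub c3

end Cases

/-- The identified parameter is the effect on the treated, and the influence function at the true
nuisances is its gradient. -/
theorem Regime.identification_and_gradient {r : Regime} (hY0 : Integrable F.Y0 Q)
    (hY10 : Integrable F.Y10 Q) (hY11 : Integrable F.Y11 Q) (hid : Identifiability F Q)
    (hmar : r.MAR F Q)
    (hw : ∀ Y ∈ ({F.Y0, F.Y1} : Set (Ω₀ → ℝ)), Integrable (fun ω => (1 - ind (F.A ω)) *
        truePi (F.obsLaw Q) (F.X ω) / (1 - truePi (F.obsLaw Q) (F.X ω)) * Y ω) Q)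
    (hφ : Integrable ((r.scheme p).eif (F.obsLaw Q) (F.att Q)) (F.obsLaw Q)) :
    F.att Q = (r.scheme p).target (F.obsLaw Q) ∧
    ∀ g, IsScore (F.obsLaw Q) g →
      HasDerivAt (fun t => (r.scheme p).target (submodel (F.obsLaw Q) g t))
        (∫ o, g o * (r.scheme p).eif (F.obsLaw Q) (F.att Q) o ∂(F.obsLaw Q)) 0 := by
  have := isProbabilityMeasure_obsLaw (F := F) (Q := Q)
  have h0 := integrableOn_odds_mul (hw F.Y0 (by simp))
  have h1 := integrableOn_odds_mul (hw F.Y1 (by simp))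
  have hP := meanTrt_pos hid.positivity
  cases r with
  | outcomeIndependent =>
    obtain ⟨hθ, hd⟩ := MARIndep.identification_and_gradient hY0 hY10 hY11 hid h0 h1 hmar
    exact ⟨hθ, fun g hg => hasDerivAt_target hP hg hθ hφ (hd g hg)⟩
  | outcomeDependent =>
    obtain ⟨hθ, hd⟩ := MARDep.identification_and_gradient hY0 hY10 hY11 hid h0 h1 hmar
    exact ⟨hθ, fun g hg => hasDerivAt_target hP hg hθ hφ (hd g hg)⟩

end Regimes

end DiDMissing

end

open DiDMissing in
theorem theorem2
    (r : Regime) (p : ℕ)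
    -- the population
    {Ω₀ : Type*} [MeasurableSpace Ω₀] [StandardBorelSpace Ω₀]
    (Q : Measure Ω₀) [IsProbabilityMeasure Q] (F : FullData p Ω₀)
    (hY0 : Integrable F.Y0 Q) (hY10 : Integrable F.Y10 Q) (hY11 : Integrable F.Y11 Q)
    (hid : Identifiability F Q) (hmar : r.MAR F Q)
    -- the sample, its split into folds, the nuisance learner
    {Ω : Type*} [MeasurableSpace Ω] (μ : Measure Ω) [IsProbabilityMeasure μ]
    (J : ℕ) (hJ : 0 < J) (D : ℕ → Ω → Obs p) (s : (m : ℕ) → Ω → Fin (J * m) → Fin J)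
    (hD : IsSplitSample μ (F.obsLaw Q) D s)
    (L : Learner (r.scheme p) J) (hbar : (r.scheme p).N) (ξ : ℝ)
    (hinf : InferenceAssumptions μ (r.scheme p) (F.obsLaw Q) (F.att Q) D s L hbar ξ) :
    -- every solution of the estimating equation is asymptotically normal
    (∀ est : ℕ → Ω → ℝ, (∀ m, AEMeasurable (est m) μ) →
      Tendsto (fun m => μ {ω | ¬ L.EstEq (F.obsLaw Q) m (s m ω) (sample D (J * m) ω) (est m ω)})
        atTop (𝓝 0) →
      AsympNormal μ J est (F.att Q)
        Var[(r.scheme p).phi (F.obsLaw Q) (F.att Q) hbar; F.obsLaw Q]) ∧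
    -- and so is the average of the fold estimators
    AsympNormal μ J (fun m ω => L.avgEst m (s m ω) (sample D (J * m) ω)) (F.att Q)
      Var[(r.scheme p).phi (F.obsLaw Q) (F.att Q) hbar; F.obsLaw Q] ∧
    -- if the limit is the influence function at the true nuisances, then the limiting variance is
    -- the semiparametric efficiency bound for the average treatment effect on the treated
    ((∀ Y ∈ ({F.Y0, F.Y1} : Set (Ω₀ → ℝ)), Integrable (fun ω => (1 - ind (F.A ω)) *
        truePi (F.obsLaw Q) (F.X ω) / (1 - truePi (F.obsLaw Q) (F.X ω)) * Y ω) Q) →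
      (r.scheme p).phi (F.obsLaw Q) (F.att Q) hbar
        =ᵐ[F.obsLaw Q] (r.scheme p).eif (F.obsLaw Q) (F.att Q) →
      F.att Q = (r.scheme p).target (F.obsLaw Q) ∧
      Var[(r.scheme p).phi (F.obsLaw Q) (F.att Q) hbar; F.obsLaw Q]
        = Var[(r.scheme p).eif (F.obsLaw Q) (F.att Q); F.obsLaw Q] ∧
      IsEfficiencyBound (r.scheme p).target (F.obsLaw Q)
        Var[(r.scheme p).eif (F.obsLaw Q) (F.att Q); F.obsLaw Q]) := by
  have := isProbabilityMeasure_obsLaw (F := F) (Q := Q)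
  have hP := meanTrt_pos hid.positivity
  refine ⟨fun est hest hroot => asympNormal_root hJ hP hD hinf hest hroot,
    asympNormal_avgEst hJ hP hD hinf, fun hw heif => ?_⟩
  have hφ := (memLp_congr_ae heif).1 hinf.memLp_limit
  obtain ⟨hθ, hd⟩ := Regime.identification_and_gradient hY0 hY10 hY11 hid hmar hw
    (hφ.integrable one_le_two)
  refine ⟨hθ, variance_congr heif, ?_⟩
  -- the cross-fitted means of the influence function vanish in the limit, so it is centred
  obtain ⟨g, hg, hg2, hgae, hl2⟩ := exists_limit_version hinf
  have h0 := integral_limit_eq_zero (measurable_fittedPhi hinf) hg hg2 hl2 hJ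
    (littleOP_sum_foldMean hP hinf)
  rw [← integral_congr_ae (heif.symm.trans hgae)] at h0
  exact isEfficiencyBound_of_gradient hφ h0 (exists_score hid.positivity) hd
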